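/- Let $\Bbbk$ be a commutative ring (for instance $\mathbb{C}$) and let $B$ be a unital $\Bbbk$-algebra. A $B$-valued probability space $(\mathcal A,\mathbb E)$ consists of a unital $\Bbbk$-algebra $\mathcal A$ with a unital $\Bbbk$-algebra homomorphism $B\to\mathcal A$ (so $B$ acts on $\mathcal A$ from both sides) and a $\Bbbk$-linear map $\mathbb E:\mathcal A\to B$ with $\mathbb E(b_1ab_2)=b_1\mathbb E(a)b_2$ and $\mathbb E(1)=1$. A pair of $B$-faces $(\mathcal A_{\mathcal F},\mathcal A_{\mathcal B})$ of $\mathcal A$ consists of a subalgebra $\mathcal A_{\mathcal F}$ containing $1_{\mathcal A}$ and a not necessarily unital subalgebra $\mathcal A_{\mathcal B}$, both stable under left and right multiplication by $B$. Let $\{(\mathcal A_{i,\mathcal F},\mathcal A_{i,\mathcal B})\}_{i\in\mathcal I}$ be a family of pairs of $B$-faces. **Free-Boolean independence.** Given $B$-$B$-bimodules $\mathring{\mathcal X}_i$ ($i\in\mathcal I$), put $\mathcal X_i=B\oplus\mathring{\mathcal X}_i$, $$\mathcal X=B\oplus\bigoplus_{n\ge1}\ \bigoplus_{i_1\ne i_2\ne\cdots\ne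 i_n}\mathring{\mathcal X}_{i_1}\otimes_B\cdots\otimes_B\mathring{\mathcal X}_{i_n},$$ and let $\mathcal X(i)$ be the sum of $B$ and of those summands with $i_1\neq i$. Let $V_i:\mathcal X\to\mathcal X_i\otimes_B\mathcal X(i)$ be the natural isomorphism. Let $\mathcal L(\cdot)$ denote the algebra of right $B$-linear operators, let $p:\mathcal X\to B$ be the projection, and $\mathbb E_{\mathcal L(\mathcal X)}(T)=p(T(1_B\oplus0))$. For $a\in\mathcal L(\mathcal X_i)$ let $\lambda_i(a)=V_i^{-1}(a\otimes I)V_i$ and $\beta_i(a)=P_i\lambda_i(a)P_i$, where $P_i$ is the projection of $\mathcal X$ onto $B\oplus\mathring{\mathcal X}_i$ that vanishes on the other summands. The family is *free-Boolean independent with amalgamation over $B$* if there are $B$-$B$-bimodules $\mathring{\mathcal X}_i$, unital $\Bbbk$-algebra homomorphisms $\gamma_i:\mathcal A_{i,\mathcal F}\to\mathcal L(\mathcal X_i)$ and not necessarily unital $\Bbbk$-algebra homomorphisms $\delta_i:\mathcal A_{i,\mathcal B}\to\mathcal L(\mathcal X_i)$ such that $$\mathbb E_{\mathcal L(\mathcal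 X)}(T_1\cdots T_n)=\mathbb E(a_1\cdots a_n)$$ for all $n\ge0$, $\omega:[n]\to\mathcal I$, $\chi:[n]\to\{\mathcal F,\mathcal B\}$ and $a_k\in\mathcal A_{\omega(k),\chi(k)}$, where $T_k=\lambda_{\omega(k)}(\gamma_{\omega(k)}(a_k))$ if $\chi(k)=\mathcal F$ and $T_k=\beta_{\omega(k)}(\delta_{\omega(k)}(a_k))$ if $\chi(k)=\mathcal B$. **Combinatorial free-Boolean independence.** For $\chi:[n]\to\{\mathcal F,\mathcal B\}$ let $INC(\chi)$ be the set of noncrossing partitions $\pi$ of $[n]$ such that whenever $v_1<w<v_2$, $v_1$ and $v_2$ lie in the same block of $\pi$ and $\chi(w)=\mathcal B$, then $w$ lies in that block too. It is ordered by $\sigma\le\pi$ if each block of $\sigma$ is contained in a block of $\pi$; let $\mu_{INC}$ be the Möbius function of this poset, and $1_n$ the partition with one block. For a noncrossing partition $\pi$ define $\Phi_\pi(a_1,\dots,a_n)\in B$ recursively: $\Phi_{1_n}(a_1,\dots,a_n)=\mathbb E(a_1\cdots a_n)$, and if $\pi=\pi_1\cup\{V\}$ with an interval block $V=\{l+1,\dots,l+s\}$,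 $l+s<n$, then $$\Phi_\pi(a_1,\dots,a_n)=\Phi_{\pi_1}\bigl(a_1,\dots,a_l,\mathbb E(a_{l+1}\cdots a_{l+s})\,a_{l+s+1},\dots,a_n\bigr).$$ The free-Boolean cumulants are $$\kappa_{\chi,\pi}(a_1,\dots,a_n)=\sum_{\sigma\in INC(\chi),\ \sigma\le\pi}\mu_{INC}(\sigma,\pi)\,\Phi_\sigma(a_1,\dots,a_n),\qquad\pi\in INC(\chi).$$ The family is *combinatorially free-Boolean independent with amalgamation over $B$* if $\kappa_{\chi,1_n}(a_1,\dots,a_n)=0$ whenever $\omega:[n]\to\mathcal I$ is not constant, $\chi:[n]\to\{\mathcal F,\mathcal B\}$ and $a_k\in\mathcal A_{\omega(k),\chi(k)}$ for all $k$. **Theorem.** The family $\{(\mathcal A_{i,\mathcal F},\mathcal A_{i,\mathcal B})\}_{i\in\mathcal I}$ is free-Boolean independent with amalgamation over $B$ if and only if it is combinatorially free-Boolean independent with amalgamation over $B$. -/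

import Mathlib

open scoped TensorProduct DirectSum
open MulOpposite

universe u v w

set_option linter.unusedSectionVars false

namespace FreeBoolean

/-! ### Bimodules and the tensor product over a noncommutative algebra -/

/-- A `B`-`B`-bimodule (with `𝕜` acting centrally); the right action of `B` is an action of
`Bᵐᵒᵖ`. -/
structure Bimod (𝕜 : Type v) (B : Type u) [CommRing 𝕜] [Ring B] [Algebra 𝕜 B] where
  carrier : Type u
  [addCommGroup : AddCommGroup carrier]
  [moduleBase : Module 𝕜 carrier]
  [moduleLeft : Module B carrier]
  [moduleRight : Module Bᵐᵒᵖ carrier]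
  [towerLeft : IsScalarTower 𝕜 B carrier]
  [towerRight : IsScalarTower 𝕜 Bᵐᵒᵖ carrier]
  [comm : SMulCommClass B Bᵐᵒᵖ carrier]

attribute [instance] Bimod.addCommGroup Bimod.moduleBase Bimod.moduleLeft Bimod.moduleRight
  Bimod.towerLeft Bimod.towerRight Bimod.comm

instance {𝕜 : Type v} {B : Type u} [CommRing 𝕜] [Ring B] [Algebra 𝕜 B] :
    CoeSort (Bimod.{u, v} 𝕜 B) (Type u) := ⟨Bimod.carrier⟩

section Tensor

variable (𝕜 : Type v) (B : Type u) [CommRing 𝕜] [Ring B] [Algebra 𝕜 B]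
variable (M : Type*) [AddCommGroup M] [Module 𝕜 M] [Module B M] [Module Bᵐᵒᵖ M]
  [IsScalarTower 𝕜 B M] [IsScalarTower 𝕜 Bᵐᵒᵖ M] [SMulCommClass B Bᵐᵒᵖ M]
variable (N : Type*) [AddCommGroup N] [Module 𝕜 N] [Module B N] [Module Bᵐᵒᵖ N]
  [IsScalarTower 𝕜 B N] [IsScalarTower 𝕜 Bᵐᵒᵖ N] [SMulCommClass B Bᵐᵒᵖ N]
variable (M' : Type*) [AddCommGroup M'] [Module 𝕜 M'] [Module B M'] [Module Bᵐᵒᵖ M']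
  [IsScalarTower 𝕜 B M'] [IsScalarTower 𝕜 Bᵐᵒᵖ M'] [SMulCommClass B Bᵐᵒᵖ M']
variable (N' : Type*) [AddCommGroup N'] [Module 𝕜 N'] [Module B N'] [Module Bᵐᵒᵖ N']
  [IsScalarTower 𝕜 B N'] [IsScalarTower 𝕜 Bᵐᵒᵖ N'] [SMulCommClass B Bᵐᵒᵖ N']

/-- The relations `m b ⊗ n = m ⊗ b n`. -/
def balanced : Submodule 𝕜 (M ⊗[𝕜] N) :=
  Submodule.span 𝕜 {z | ∃ (m : M) (b : B) (n : N), z = (op b • m) ⊗ₜ[𝕜] n - m ⊗ₜ[𝕜] (b • n)}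

/-- The tensor product `M ⊗_B N`. -/
def BTensor : Type _ := (M ⊗[𝕜] N) ⧸ balanced 𝕜 B M N

namespace BTensor

instance : AddCommGroup (BTensor 𝕜 B M N) :=
  inferInstanceAs (AddCommGroup ((M ⊗[𝕜] N) ⧸ balanced 𝕜 B M N))

instance : Module 𝕜 (BTensor 𝕜 B M N) :=
  inferInstanceAs (Module 𝕜 ((M ⊗[𝕜] N) ⧸ balanced 𝕜 B M N))

variable {M N M' N'}

variable (M N) in
/-- The quotient map `M ⊗ N → M ⊗_B N`. -/
def proj : M ⊗[𝕜] N →ₗ[𝕜] BTensor 𝕜 B M N := (balanced 𝕜 B M N).mkQ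

/-- The elementary tensor `m ⊗ n` in `M ⊗_B N`. -/
def tmul (m : M) (n : N) : BTensor 𝕜 B M N := proj 𝕜 B M N (m ⊗ₜ[𝕜] n)

theorem smul_tmul (m : M) (b : B) (n : N) :
    tmul 𝕜 B (op b • m) n = tmul 𝕜 B m (b • n) := by
  rw [tmul, tmul, ← sub_eq_zero, ← map_sub]
  exact (Submodule.Quotient.mk_eq_zero _).2 (Submodule.subset_span ⟨m, b, n, rfl⟩)

theorem add_tmul (m m' : M) (n : N) :
    tmul 𝕜 B (m + m') n = tmul 𝕜 B m n + tmul 𝕜 B m' n := by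
  simp [tmul, TensorProduct.add_tmul]

theorem tmul_add (m : M) (n n' : N) :
    tmul 𝕜 B m (n + n') = tmul 𝕜 B m n + tmul 𝕜 B m n' := by
  simp [tmul, TensorProduct.tmul_add]

theorem smul_tmul_base (z : 𝕜) (m : M) (n : N) :
    tmul 𝕜 B (z • m) n = z • tmul 𝕜 B m n := by
  rw [tmul, tmul, ← map_smul, TensorProduct.smul_tmul']

theorem tmul_smul_base (z : 𝕜) (m : M) (n : N) :
    tmul 𝕜 B m (z • n) = z • tmul 𝕜 B m n := by
  rw [tmul, tmul, ← map_smul, TensorProduct.tmul_smul]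

@[simp]
theorem zero_tmul (n : N) : tmul 𝕜 B (0 : M) n = 0 := by
  simp [tmul]

@[simp]
theorem tmul_zero (m : M) : tmul 𝕜 B m (0 : N) = 0 := by
  simp [tmul]

theorem proj_surjective : Function.Surjective (proj 𝕜 B M N) :=
  (balanced 𝕜 B M N).mkQ_surjective

theorem induction {P : BTensor 𝕜 B M N → Prop} (x : BTensor 𝕜 B M N) (h0 : P 0)
    (ht : ∀ m n, P (tmul 𝕜 B m n)) (ha : ∀ x y, P x → P y → P (x + y)) : P x := by
  obtain ⟨y, rfl⟩ := proj_surjective 𝕜 B x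
  induction y using TensorProduct.induction_on with
  | zero => rw [map_zero]; exact h0
  | tmul m n => exact ht m n
  | add x y hx hy => rw [map_add]; exact ha _ _ hx hy

variable {𝕜 B}

theorem hom_ext {P : Type*} [AddCommGroup P] [Module 𝕜 P] {f g : BTensor 𝕜 B M N →ₗ[𝕜] P}
    (h : ∀ m n, f (tmul 𝕜 B m n) = g (tmul 𝕜 B m n)) : f = g := by
  ext x
  induction x using BTensor.induction with
  | h0 => simp
  | ht m n => exact h m n
  | ha x y hx hy => simp [hx, hy]

/-- The universal property of `M ⊗_B N`. -/
def lift {P : Type*} [AddCommGroup P] [Module 𝕜 P] (f : M →ₗ[𝕜] N →ₗ[𝕜] P)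
    (hf : ∀ m (b : B) n, f (op b • m) n = f m (b • n)) : BTensor 𝕜 B M N →ₗ[𝕜] P :=
  (balanced 𝕜 B M N).liftQ (TensorProduct.lift f) (by
    rw [balanced, Submodule.span_le]
    rintro _ ⟨m, b, n, rfl⟩
    simp [hf])

@[simp]
theorem lift_tmul {P : Type*} [AddCommGroup P] [Module 𝕜 P] (f : M →ₗ[𝕜] N →ₗ[𝕜] P)
    (hf : ∀ m (b : B) n, f (op b • m) n = f m (b • n)) (m : M) (n : N) :
    lift f hf (tmul 𝕜 B m n) = f m n := TensorProduct.lift.tmul m n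

variable (𝕜 B) in
/-- The `𝕜`-bilinear map `(m, n) ↦ m ⊗ n`. -/
def mk : M →ₗ[𝕜] N →ₗ[𝕜] BTensor 𝕜 B M N :=
  LinearMap.mk₂ 𝕜 (tmul 𝕜 B) (add_tmul 𝕜 B) (smul_tmul_base 𝕜 B) (tmul_add 𝕜 B)
    (fun z m n => tmul_smul_base 𝕜 B z m n)

@[simp]
theorem mk_apply (m : M) (n : N) : mk 𝕜 B m n = tmul 𝕜 B m n := rfl

/-- The map `f ⊗ g` for a right `B`-linear `f` and a left `B`-linear `g`. -/
def map (f : M →ₗ[Bᵐᵒᵖ] M') (g : N →ₗ[B] N') : BTensor 𝕜 B M N →ₗ[𝕜] BTensor 𝕜 B M' N' :=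
  lift ((mk 𝕜 B).compl₁₂ (f.restrictScalars 𝕜) (g.restrictScalars 𝕜)) (by
    intro m b n
    simp [smul_tmul])

@[simp]
theorem map_tmul (f : M →ₗ[Bᵐᵒᵖ] M') (g : N →ₗ[B] N') (m : M) (n : N) :
    map (𝕜 := 𝕜) f g (tmul 𝕜 B m n) = tmul 𝕜 B (f m) (g n) := by
  simp [map]

/-- Left multiplication by `b`, as a right `B`-linear map. -/
def leftMul (b : B) : M →ₗ[Bᵐᵒᵖ] M where
  toFun m := b • m
  map_add' := smul_add b
  map_smul' c m := smul_comm b c m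

/-- Right multiplication by `b`, as a left `B`-linear map. -/
def rightMul (b : Bᵐᵒᵖ) : N →ₗ[B] N where
  toFun n := b • n
  map_add' := smul_add b
  map_smul' c n := (smul_comm c b n).symm

@[simp] theorem leftMul_apply (b : B) (m : M) : leftMul b m = b • m := rfl

@[simp] theorem rightMul_apply (b : Bᵐᵒᵖ) (n : N) : rightMul b n = b • n := rfl

/-- The left action `b (m ⊗ n) = b m ⊗ n`. -/
def leftAction : B →+* Module.End 𝕜 (BTensor 𝕜 B M N) where
  toFun b := map (leftMul b) LinearMap.id
  map_one' := hom_ext fun m n => by simp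
  map_mul' b c := hom_ext fun m n => by simp [mul_smul]
  map_zero' := hom_ext fun m n => by simp
  map_add' b c := hom_ext fun m n => by simp [add_smul, add_tmul]

/-- The right action `(m ⊗ n) b = m ⊗ n b`. -/
def rightAction : Bᵐᵒᵖ →+* Module.End 𝕜 (BTensor 𝕜 B M N) where
  toFun b := map LinearMap.id (rightMul b)
  map_one' := hom_ext fun m n => by simp
  map_mul' b c := hom_ext fun m n => by simp [mul_smul]
  map_zero' := hom_ext fun m n => by simp
  map_add' b c := hom_ext fun m n => by simp [add_smul, tmul_add]

instance : Module B (BTensor 𝕜 B M N) :=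
  Module.compHom _ (leftAction (𝕜 := 𝕜) (M := M) (N := N))

instance : Module Bᵐᵒᵖ (BTensor 𝕜 B M N) :=
  Module.compHom _ (rightAction (𝕜 := 𝕜) (M := M) (N := N))

@[simp]
theorem left_smul_tmul (b : B) (m : M) (n : N) :
    b • tmul 𝕜 B m n = tmul 𝕜 B (b • m) n := map_tmul (leftMul b) LinearMap.id m n

@[simp]
theorem right_smul_tmul (b : Bᵐᵒᵖ) (m : M) (n : N) :
    b • tmul 𝕜 B m n = tmul 𝕜 B m (b • n) := map_tmul LinearMap.id (rightMul b) m n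

instance : IsScalarTower 𝕜 B (BTensor 𝕜 B M N) where
  smul_assoc z b x := by
    induction x using BTensor.induction with
    | h0 => simp
    | ht m n => simp [smul_tmul_base]
    | ha x y hx hy => simp [smul_add, hx, hy]

instance : IsScalarTower 𝕜 Bᵐᵒᵖ (BTensor 𝕜 B M N) where
  smul_assoc z b x := by
    induction x using BTensor.induction with
    | h0 => simp
    | ht m n => simp [tmul_smul_base]
    | ha x y hx hy => simp [smul_add, hx, hy]

instance : SMulCommClass B Bᵐᵒᵖ (BTensor 𝕜 B M N) where
  smul_comm b c x := by
    induction x using BTensor.induction with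
    | h0 => simp
    | ht m n => simp
    | ha x y hx hy => simp [smul_add, hx, hy]

end BTensor

end Tensor

namespace BTensor

variable {𝕜 : Type v} {B : Type u} [CommRing 𝕜] [Ring B] [Algebra 𝕜 B]
variable {M : Type*} [AddCommGroup M] [Module 𝕜 M] [Module B M] [Module Bᵐᵒᵖ M]
  [IsScalarTower 𝕜 B M] [IsScalarTower 𝕜 Bᵐᵒᵖ M] [SMulCommClass B Bᵐᵒᵖ M]

variable (𝕜) in
/-- The map `f ⊗ I` on `M ⊗_B N` for a right `B`-linear `f`, as a right `B`-linear map. -/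
def tensorId (f : M →ₗ[Bᵐᵒᵖ] M) (N : Type*) [AddCommGroup N] [Module 𝕜 N] [Module B N]
    [Module Bᵐᵒᵖ N] [IsScalarTower 𝕜 B N] [IsScalarTower 𝕜 Bᵐᵒᵖ N] [SMulCommClass B Bᵐᵒᵖ N] :
    BTensor 𝕜 B M N →ₗ[Bᵐᵒᵖ] BTensor 𝕜 B M N where
  toFun := map (𝕜 := 𝕜) f LinearMap.id
  map_add' := map_add _
  map_smul' b x := by
    induction x using BTensor.induction with
    | h0 => simp
    | ht m n => simp
    | ha x y hx hy => simp only [smul_add, map_add, hx, hy]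

end BTensor

/-! ### The reduced free product -/

noncomputable section FreeProduct

open scoped Classical

variable {𝕜 : Type v} {B : Type u} [CommRing 𝕜] [Ring B] [Algebra 𝕜 B]
variable {ι : Type w} (X : ι → Bimod.{u, v} 𝕜 B)

/-- `word X [i₁, …, iₙ]` is `X i₁ ⊗_B ⋯ ⊗_B X iₙ (⊗_B B)`; the empty word gives `B`. -/
def word : List ι → Bimod.{u, v} 𝕜 B
  | [] => ⟨B⟩
  | i :: l => ⟨BTensor 𝕜 B (X i) (word l)⟩

/-- The identification of `B` with the summand of the empty word. -/
def nilEquiv : B ≃ₗ[𝕜] word X [] := LinearEquiv.refl 𝕜 _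

theorem nilEquiv_right (b : Bᵐᵒᵖ) (c : B) : nilEquiv X (b • c) = b • nilEquiv X c := rfl

theorem nilEquiv_left (b c : B) : nilEquiv X (b • c) = b • nilEquiv X c := rfl

/-- The identification of `X i ⊗_B word X l` with `word X (i :: l)`. -/
def consEquiv (i : ι) (l : List ι) : BTensor 𝕜 B (X i) (word X l) ≃ₗ[𝕜] word X (i :: l) :=
  LinearEquiv.refl 𝕜 _

theorem consEquiv_right (i : ι) (l : List ι) (b : Bᵐᵒᵖ) (t : BTensor 𝕜 B (X i) (word X l)) :
    consEquiv X i l (b • t) = b • consEquiv X i l t := rfl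

theorem consEquiv_left (i : ι) (l : List ι) (b : B) (t : BTensor 𝕜 B (X i) (word X l)) :
    consEquiv X i l (b • t) = b • consEquiv X i l t := rfl

/-- Words `i₁ ≠ i₂ ≠ ⋯ ≠ iₙ`, `n ≥ 0`. -/
abbrev RWord (ι : Type w) : Type w := {l : List ι // l.IsChain (· ≠ ·)}

/-- Words `i₁ ≠ i₂ ≠ ⋯ ≠ iₙ`, `n ≥ 0`, that do not start with `i`. -/
abbrev RWordAvoid (i : ι) : Type w := {l : List ι // l.IsChain (· ≠ ·) ∧ l.head? ≠ some i}

/-- The reduced free product `B ⊕ ⨁_{n ≥ 1} ⨁_{i₁ ≠ ⋯ ≠ iₙ} X i₁ ⊗_B ⋯ ⊗_B X iₙ`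
(the summand of the empty word is `B`). -/
abbrev FreeProd : Type (max w u) := ⨁ l : RWord ι, word X l.1

/-- The part of the reduced free product that is spanned by the words not starting with `i`. -/
abbrev FreeProdAvoid (i : ι) : Type (max w u) := ⨁ l : RWordAvoid i, word X l.1

/-- The word `i :: l`, for `l` not starting with `i`. -/
def RWordAvoid.cons {i : ι} (l : RWordAvoid i) : RWord ι :=
  ⟨i :: l.1, List.isChain_cons.2 ⟨fun j hj hij => l.2.2 (hij ▸ hj), l.2.1⟩⟩

/-- The inclusion of the summand of a word `l` into the reduced free product. -/
def incl (l : RWord ι) : word X l.1 →ₗ[𝕜] FreeProd X :=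
  DirectSum.lof 𝕜 (RWord ι) (fun l => word X l.1) l

/-- The inclusion of the summand of a word `l` that does not start with `i`. -/
def inclAvoid (i : ι) (l : RWordAvoid i) : word X l.1 →ₗ[𝕜] FreeProdAvoid X i :=
  DirectSum.lof 𝕜 (RWordAvoid i) (fun l => word X l.1) l

/-- The inclusion of the summand `X i ⊗_B word X l` of a word `i :: l`. -/
def inclCons (i : ι) (l : RWordAvoid i) :
    BTensor 𝕜 B (X i) (word X l.1) →ₗ[𝕜] FreeProd X :=
  (incl X l.cons).comp (consEquiv X i l.1).toLinearMap

theorem incl_right (l : RWord ι) (b : Bᵐᵒᵖ) (t : word X l.1) :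
    incl X l (b • t) = b • incl X l t :=
  (DirectSum.lof Bᵐᵒᵖ (RWord ι) (fun l => word X l.1) l).map_smul b t

theorem inclAvoid_right (i : ι) (l : RWordAvoid i) (b : Bᵐᵒᵖ) (t : word X l.1) :
    inclAvoid X i l (b • t) = b • inclAvoid X i l t :=
  (DirectSum.lof Bᵐᵒᵖ (RWordAvoid i) (fun l => word X l.1) l).map_smul b t

theorem inclAvoid_left (i : ι) (l : RWordAvoid i) (b : B) (t : word X l.1) :
    inclAvoid X i l (b • t) = b • inclAvoid X i l t :=
  (DirectSum.lof B (RWordAvoid i) (fun l => word X l.1) l).map_smul b t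

theorem inclCons_right (i : ι) (l : RWordAvoid i) (b : Bᵐᵒᵖ)
    (t : BTensor 𝕜 B (X i) (word X l.1)) :
    inclCons X i l (b • t) = b • inclCons X i l t :=
  incl_right X l.cons b (consEquiv X i l.1 t)

/-- On one summand, the natural map `(B ⊕ X i) ⊗_B FreeProdAvoid X i → FreeProd X`,
`(b ⊕ x) ⊗ t ↦ b t + x ⊗ t`. -/
def glueWord (i : ι) (l : RWordAvoid i) :
    (B × X i) →ₗ[𝕜] word X l.1 →ₗ[𝕜] FreeProd X :=
  LinearMap.mk₂ 𝕜
    (fun y t => incl X ⟨l.1, l.2.1⟩ (y.1 • t) + inclCons X i l (BTensor.tmul 𝕜 B y.2 t))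
    (fun y y' t => by
      simp only [Prod.fst_add, Prod.snd_add, add_smul, BTensor.add_tmul, map_add]; abel)
    (fun z y t => by
      simp only [Prod.smul_fst, Prod.smul_snd, smul_assoc, BTensor.smul_tmul_base, map_smul,
        smul_add])
    (fun y t t' => by
      simp only [smul_add, BTensor.tmul_add, map_add]; abel)
    (fun z y t => by
      simp only [smul_comm y.1 z t, BTensor.tmul_smul_base, map_smul, smul_add])

/-- The natural map `(B ⊕ X i) ⊗_B FreeProdAvoid X i → FreeProd X`. -/
def glue (i : ι) : BTensor 𝕜 B (B × X i) (FreeProdAvoid X i) →ₗ[𝕜] FreeProd X :=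
  BTensor.lift (DirectSum.toModule 𝕜 (RWordAvoid i) _ (fun l => (glueWord X i l).flip)).flip (by
    intro y b n
    induction n using DirectSum.induction_on with
    | zero => simp
    | of l t =>
      rw [← DirectSum.of_smul]
      simp only [← DirectSum.lof_eq_of 𝕜, LinearMap.flip_apply, DirectSum.toModule_lof]
      simp only [glueWord, LinearMap.mk₂_apply, Prod.smul_fst, Prod.smul_snd, op_smul_eq_mul,
        mul_smul, BTensor.smul_tmul]
    | add x y hx hy => simp only [smul_add, map_add, hx, hy])

theorem glue_tmul (i : ι) (y : B × X i) (l : RWordAvoid i) (t : word X l.1) :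
    glue X i (BTensor.tmul 𝕜 B y (inclAvoid X i l t)) =
      incl X ⟨l.1, l.2.1⟩ (y.1 • t) + inclCons X i l (BTensor.tmul 𝕜 B y.2 t) := by
  simp [glue, inclAvoid, glueWord]

/-- The map `x ⊗ t ↦ (0 ⊕ x) ⊗ t`. -/
def splitCons (i : ι) (l : RWordAvoid i) :
    BTensor 𝕜 B (X i) (word X l.1) →ₗ[𝕜] BTensor 𝕜 B (B × X i) (FreeProdAvoid X i) :=
  BTensor.lift ((BTensor.mk 𝕜 B).compl₁₂ (LinearMap.inr 𝕜 B (X i)) (inclAvoid X i l)) (by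
    intro m b n
    simp only [LinearMap.compl₁₂_apply, LinearMap.inr_apply, BTensor.mk_apply]
    rw [inclAvoid_left, ← BTensor.smul_tmul]
    simp)

/-- The natural map `FreeProd X → (B ⊕ X i) ⊗_B FreeProdAvoid X i` on one summand: it is
`t ↦ (1 ⊕ 0) ⊗ t` on a word that does not start with `i`, and `x ⊗ t ↦ (0 ⊕ x) ⊗ t` on a
word `i :: l`. -/
def splitWord (i : ι) : (l : List ι) → l.IsChain (· ≠ ·) →
    (word X l →ₗ[𝕜] BTensor 𝕜 B (B × X i) (FreeProdAvoid X i))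
  | [], h => (BTensor.mk 𝕜 B ((1, 0) : B × X i)).comp (inclAvoid X i ⟨[], h, by simp⟩)
  | j :: l, h =>
    if hj : j = i then by
      subst hj
      exact (splitCons X j ⟨l, (List.isChain_cons.1 h).2,
        fun hl => (List.isChain_cons.1 h).1 j hl rfl⟩).comp (consEquiv X j l).symm.toLinearMap
    else
      (BTensor.mk 𝕜 B ((1, 0) : B × X i)).comp (inclAvoid X i ⟨j :: l, h, by simpa using hj⟩)

/-- The natural map `FreeProd X → (B ⊕ X i) ⊗_B FreeProdAvoid X i`. -/
def split (i : ι) : FreeProd X →ₗ[𝕜] BTensor 𝕜 B (B × X i) (FreeProdAvoid X i) :=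
  DirectSum.toModule 𝕜 (RWord ι) _ (fun l => splitWord X i l.1 l.2)

theorem split_incl (i : ι) (l : RWordAvoid i) (t : word X l.1) :
    split X i (incl X ⟨l.1, l.2.1⟩ t) =
      BTensor.tmul 𝕜 B ((1, 0) : B × X i) (inclAvoid X i l t) := by
  obtain ⟨l, hl, hi⟩ := l
  rw [split, incl, DirectSum.toModule_lof]
  cases l with
  | nil => rfl
  | cons j l =>
    have hj : ¬ j = i := by simpa using hi
    simp only [splitWord, dif_neg hj]
    rfl

theorem split_inclCons (i : ι) (l : RWordAvoid i) (x : X i) (t : word X l.1) :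
    split X i (inclCons X i l (BTensor.tmul 𝕜 B x t)) =
      BTensor.tmul 𝕜 B ((0, x) : B × X i) (inclAvoid X i l t) := by
  have h : split X i (inclCons X i l (BTensor.tmul 𝕜 B x t)) =
      splitWord X i l.cons.1 l.cons.2 (consEquiv X i l.1 (BTensor.tmul 𝕜 B x t)) := by
    rw [split, inclCons, incl]
    exact DirectSum.toModule_lof ..
  rw [h]
  change splitWord X i (i :: l.1) l.cons.2 (consEquiv X i l.1 (BTensor.tmul 𝕜 B x t)) = _
  simp [splitWord, splitCons]

theorem split_glue (i : ι) (x : BTensor 𝕜 B (B × X i) (FreeProdAvoid X i)) :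
    split X i (glue X i x) = x := by
  induction x using BTensor.induction with
  | h0 => simp
  | ha x y hx hy => rw [map_add, map_add, hx, hy]
  | ht y n =>
    induction n using DirectSum.induction_on with
    | zero => simp
    | add n n' h h' => rw [BTensor.tmul_add, map_add, map_add, h, h']
    | of l t =>
      change split X i (glue X i (BTensor.tmul 𝕜 B y (inclAvoid X i l t))) =
        BTensor.tmul 𝕜 B y (inclAvoid X i l t)
      rw [glue_tmul, map_add, split_incl, split_inclCons, inclAvoid_left, ← BTensor.smul_tmul,
        ← BTensor.add_tmul]
      congr 1
      ext <;> simp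

theorem glue_split (i : ι) (x : FreeProd X) : glue X i (split X i x) = x := by
  induction x using DirectSum.induction_on with
  | zero => simp
  | add x y hx hy => rw [map_add, map_add, hx, hy]
  | of l t =>
    change glue X i (split X i (incl X l t)) = incl X l t
    by_cases hi : l.1.head? = some i
    · obtain ⟨l, hl⟩ := l
      cases l with
      | nil => simp at hi
      | cons j l =>
        obtain rfl : j = i := by simpa using hi
        let l' : RWordAvoid j :=
          ⟨l, (List.isChain_cons.1 hl).2, fun h => (List.isChain_cons.1 hl).1 j h rfl⟩
        obtain ⟨s, rfl⟩ := (consEquiv X j l).surjective t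
        change glue X j (split X j (inclCons X j l' s)) = inclCons X j l' s
        induction s using BTensor.induction with
        | h0 => simp
        | ha x y hx hy => rw [map_add, map_add, map_add, hx, hy]
        | ht x t =>
          exact (congrArg (glue X j) (split_inclCons X j l' x t)).trans
            ((glue_tmul X j (0, x) l' t).trans (by simp))
    · exact (congrArg (glue X i) (split_incl X i ⟨l.1, l.2, hi⟩ t)).trans
        ((glue_tmul X i (1, 0) ⟨l.1, l.2, hi⟩ t).trans (by simp))

theorem glue_right (i : ι) (b : Bᵐᵒᵖ) (x : BTensor 𝕜 B (B × X i) (FreeProdAvoid X i)) :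
    glue X i (b • x) = b • glue X i x := by
  induction x using BTensor.induction with
  | h0 => simp
  | ha x y hx hy => rw [smul_add, map_add, map_add, hx, hy, smul_add]
  | ht y n =>
    induction n using DirectSum.induction_on with
    | zero => simp
    | add n n' h h' => rw [BTensor.tmul_add, smul_add, map_add, map_add, h, h', smul_add]
    | of l t =>
      change glue X i (b • BTensor.tmul 𝕜 B y (inclAvoid X i l t)) =
        b • glue X i (BTensor.tmul 𝕜 B y (inclAvoid X i l t))
      rw [BTensor.right_smul_tmul, ← inclAvoid_right, glue_tmul, glue_tmul, smul_add,
        ← incl_right, ← inclCons_right, BTensor.right_smul_tmul, smul_comm]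

/-- The natural isomorphism `V i : FreeProd X → (B ⊕ X i) ⊗_B FreeProdAvoid X i`. -/
def V (i : ι) : FreeProd X ≃ₗ[Bᵐᵒᵖ] BTensor 𝕜 B (B × X i) (FreeProdAvoid X i) :=
  LinearEquiv.symm
    { toFun := glue X i
      map_add' := map_add _
      map_smul' := glue_right X i
      invFun := split X i
      left_inv := split_glue X i
      right_inv := glue_split X i }

/-- `lam X i a = V i⁻¹ (a ⊗ I) V i`. The algebra `L(B ⊕ X i)` consists of the right `B`-linear
operators. -/
def lam (i : ι) (a : Module.End Bᵐᵒᵖ (B × X i)) : Module.End Bᵐᵒᵖ (FreeProd X) :=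
  (V X i).symm.toLinearMap ∘ₗ BTensor.tensorId 𝕜 a (FreeProdAvoid X i) ∘ₗ (V X i).toLinearMap

/-- The projection of the reduced free product onto the summand of one word. -/
def wordProj (l : RWord ι) : Module.End Bᵐᵒᵖ (FreeProd X) :=
  DirectSum.lof Bᵐᵒᵖ (RWord ι) (fun l => word X l.1) l ∘ₗ
    DirectSum.component Bᵐᵒᵖ (RWord ι) (fun l => word X l.1) l

/-- The projection `P i` onto `B ⊕ X i`: onto the summands of the words `[]` and `[i]`. -/
def P (i : ι) : Module.End Bᵐᵒᵖ (FreeProd X) :=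
  wordProj X ⟨[], List.IsChain.nil⟩ + wordProj X ⟨[i], List.IsChain.singleton i⟩

/-- `bet X i a = P i (lam i a) P i`. -/
def bet (i : ι) (a : Module.End Bᵐᵒᵖ (B × X i)) : Module.End Bᵐᵒᵖ (FreeProd X) :=
  P X i * lam X i a * P X i

/-- The vector `1 ⊕ 0` of `FreeProd X`. -/
def vac : FreeProd X := incl X ⟨[], List.IsChain.nil⟩ (nilEquiv X 1)

/-- The projection `p` of `FreeProd X` onto `B`. -/
def projB (x : FreeProd X) : B := (nilEquiv X).symm (x ⟨[], List.IsChain.nil⟩)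

/-- The expectation `a ↦ p (a (1 ⊕ 0))` on `L(FreeProd X)`. -/
def expect (a : Module.End Bᵐᵒᵖ (FreeProd X)) : B := projB X (a (vac X))

end FreeProduct

/-! ### Interval-noncrossing partitions -/

/-- The two kinds of faces, free and Boolean. -/
inductive Face
  | free
  | boolean

section Partitions

variable {n : ℕ}

/-- Noncrossing partitions of `Fin n`; a partition is given by its equivalence relation. -/
def IsNoncrossing (π : Setoid (Fin n)) : Prop :=
  ∀ v₁ w₁ v₂ w₂, v₁ < w₁ → w₁ < v₂ → v₂ < w₂ → π v₁ v₂ → π w₁ w₂ → π v₁ w₁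

/-- The set `INC(χ)` of interval-noncrossing partitions, ordered by `σ ≤ π` if every block of
`σ` is contained in a block of `π`. -/
def INC (χ : Fin n → Face) : Type :=
  {π : Setoid (Fin n) // IsNoncrossing π ∧
    ∀ v₁ w v₂, v₁ < w → w < v₂ → π v₁ v₂ → χ w = Face.boolean → π v₁ w}

variable (χ : Fin n → Face)

instance : PartialOrder (INC χ) :=
  inferInstanceAs (PartialOrder {π : Setoid (Fin n) // IsNoncrossing π ∧
    ∀ v₁ w v₂, v₁ < w → w < v₂ → π v₁ v₂ → χ w = Face.boolean → π v₁ w})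

/-- The partition `1_n` with one block. -/
instance : OrderTop (INC χ) where
  top := ⟨⊤, fun _ _ _ _ _ _ _ _ _ => trivial, fun _ _ _ _ _ _ _ => trivial⟩
  le_top _ := le_top (α := Setoid (Fin n))

instance : Finite (INC χ) :=
  Finite.of_injective (fun π : INC χ => (fun v w => π.1 v w : Fin n → Fin n → Prop))
    (fun _ _ h => Subtype.ext (Setoid.ext fun v w => iff_of_eq (congrFun (congrFun h v) w)))

noncomputable instance : Fintype (INC χ) := Fintype.ofFinite _

open scoped Classical in
noncomputable instance : LocallyFiniteOrder (INC χ) := Fintype.toLocallyFiniteOrder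

end Partitions

/-! ### Operator-valued probability spaces and cumulants -/

/-- A `B`-valued probability space: a unital algebra `A` over `B` with a unital `B`-`B`-bimodule
map `E : A → B`. -/
structure ProbSpace (𝕜 : Type v) (B A : Type u) [CommRing 𝕜] [Ring B] [Algebra 𝕜 B] [Ring A]
    [Algebra 𝕜 A] where
  emb : B →ₐ[𝕜] A
  E : A →ₗ[𝕜] B
  E_bimod : ∀ (b₁ : B) (a : A) (b₂ : B), E (emb b₁ * a * emb b₂) = b₁ * E a * b₂
  E_one : E 1 = 1

/-- A pair of `B`-faces: a unital subalgebra and a not necessarily unital subalgebra of `A`, both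
of them `B`-`B`-submodules. -/
structure FacePair {𝕜 : Type v} {B A : Type u} [CommRing 𝕜] [Ring B] [Algebra 𝕜 B] [Ring A]
    [Algebra 𝕜 A] (S : ProbSpace 𝕜 B A) where
  C : Subalgebra 𝕜 A
  D : NonUnitalSubalgebra 𝕜 A
  left_mem_C : ∀ b, ∀ c ∈ C, S.emb b * c ∈ C
  right_mem_C : ∀ b, ∀ c ∈ C, c * S.emb b ∈ C
  left_mem_D : ∀ b, ∀ d ∈ D, S.emb b * d ∈ D
  right_mem_D : ∀ b, ∀ d ∈ D, d * S.emb b ∈ D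

noncomputable section Independence

variable {𝕜 : Type v} {B A : Type u} [CommRing 𝕜] [Ring B] [Algebra 𝕜 B] [Ring A] [Algebra 𝕜 A]
variable (S : ProbSpace 𝕜 B A)

open scoped Classical in
/-- The points of `s` that are the last element of their block in the restriction of `π` to
`s`. -/
def blockEnds {n : ℕ} (π : Setoid (Fin n)) (s : Finset (Fin n)) : Finset (Fin n) :=
  {t ∈ s | ∀ x ∈ s, π t x → x ≤ t}

theorem blockEnds_nonempty {n : ℕ} (π : Setoid (Fin n)) {s : Finset (Fin n)} (hs : s.Nonempty) :
    (blockEnds π s).Nonempty :=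
  ⟨s.max' hs, by simpa [blockEnds, s.max'_mem hs] using fun x hx _ => s.le_max' x hx⟩

open scoped Classical in
/-- The multiplicative extension `Φ_π (a_1, …, a_n)` of the moments, for the restriction of a
noncrossing partition `π` to `s`. The block `V` that ends first is an interval of `s`. If `V` is
all of `s`, the value is `E` of the product of the `a_k`; otherwise `V` is removed, and the entry
that follows `V` is multiplied from the left by `E` of the product of the `a_k` over `V`. -/
def Phi {n : ℕ} (π : Setoid (Fin n)) (s : Finset (Fin n)) (a : Fin n → A) : B :=
  if hs : s.Nonempty then
    let t := (blockEnds π s).min' (blockEnds_nonempty π hs)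
    let V := {x ∈ s | π t x}
    let m := S.E ((V.sort (· ≤ ·)).map a).prod
    if hr : {x ∈ s | t < x}.Nonempty then
      let r := {x ∈ s | t < x}.min' hr
      Phi π (s \ V) (Function.update a r (S.emb m * a r))
    else m
  else 1
termination_by s.card
decreasing_by
  have ht : t ∈ s := (Finset.mem_filter.1 (Finset.min'_mem _ (blockEnds_nonempty π hs))).1
  exact Finset.card_lt_card ⟨Finset.sdiff_subset, fun h =>
    (Finset.mem_sdiff.1 (h ht)).2 (Finset.mem_filter.2 ⟨ht, π.refl t⟩)⟩

open scoped Classical in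
/-- The free-Boolean cumulant
`κ_{χ,π} (a_1, …, a_n) = ∑_{σ ∈ INC(χ), σ ≤ π} μ(σ, π) Φ_σ (a_1, …, a_n)`. -/
def cumulant {n : ℕ} (χ : Fin n → Face) (π : INC χ) (a : Fin n → A) : B :=
  ∑ σ ∈ Finset.univ.filter (fun σ : INC χ => σ ≤ π),
    IncidenceAlgebra.mu ℤ σ π • Phi S σ.1 Finset.univ a

variable {S}

/-- The face of a given kind. -/
def FacePair.face (F : FacePair S) : Face → Set A
  | Face.free => F.C
  | Face.boolean => F.D

variable {ι : Type w} (F : ι → FacePair S)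

/-- Combinatorial free-Boolean independence: the mixed cumulants vanish. -/
def CombFreeBoolean : Prop :=
  ∀ (n : ℕ) (ω : Fin n → ι) (χ : Fin n → Face) (a : Fin n → A),
    (∀ k, a k ∈ (F (ω k)).face (χ k)) → (∃ j k, ω j ≠ ω k) → cumulant S χ ⊤ a = 0

/-- The operator on the reduced free product that represents an element of a face:
`λ_i (γ_i (c))` for the free face and `P_i λ_i (δ_i (d)) P_i` for the Boolean face. -/
def represent (X : ι → Bimod.{u, v} 𝕜 B)
    (γ : ∀ i, (F i).C →ₐ[𝕜] Module.End Bᵐᵒᵖ (B × X i))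
    (δ : ∀ i, (F i).D →ₙₐ[𝕜] Module.End Bᵐᵒᵖ (B × X i)) (i : ι) :
    (f : Face) → (F i).face f → Module.End Bᵐᵒᵖ (FreeProd X)
  | Face.free, c => lam X i (γ i ⟨c.1, c.2⟩)
  | Face.boolean, d => bet X i (δ i ⟨d.1, d.2⟩)

/-- Free-Boolean independence with amalgamation over `B`: the joint distribution of the faces is
that of the operators `λ_i (γ_i (c))` and `P_i λ_i (δ_i (d)) P_i` on a reduced free product. -/
def FreeBooleanIndep : Prop :=
  ∃ (X : ι → Bimod.{u, v} 𝕜 B)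
    (γ : ∀ i, (F i).C →ₐ[𝕜] Module.End Bᵐᵒᵖ (B × X i))
    (δ : ∀ i, (F i).D →ₙₐ[𝕜] Module.End Bᵐᵒᵖ (B × X i)),
    ∀ (n : ℕ) (ω : Fin n → ι) (χ : Fin n → Face) (a : ∀ k, (F (ω k)).face (χ k)),
      expect X (List.ofFn fun k => represent F X γ δ (ω k) (χ k) (a k)).prod =
        S.E (List.ofFn fun k => (a k : A)).prod

end Independence

end FreeBoolean

/-! Both notions of independence are compared with a third condition, `MixedVanish`: the mixed
cumulants `S.kappa` of letters vanish. These cumulants obey a recursion over words that mentions no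
partitions. The moment of `a :: L` is the sum, over all blocks containing the first letter `a`, of
the cumulant of the block times the moment of what follows the block; the moment of each gap is
multiplied into the letter of the block behind it, and letters in gaps have to be free.

The core of the proof is that the operators on a reduced free product obey the same recursion, with
blocks restricted to letters of the colour of `a` (`System.mom_cons`). A vector created from the
vacuum is written as a sum of `ξ ⊗ z` with `ξ` in `B ⊕ X i`, where `ξ` is the vector of an open
block. An operator of colour `i` adds its letter to the open block, closes the block, or closes an
initial segment and leaves the rest open (`System.act_cumVec`); a Boolean operator moreover reduces
`z` to its vacuum part. `System.vec_eq_blockSum` proves the resulting expansion for all colours at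
once. The algebra `A` acting on itself is a system with a single colour, and its cumulants are
`S.kappa`.

If a representation reproduces the moments, the two recursions have equal sums. One-coloured
cumulants then agree (`cum_eq_kappa_of_moments`), and in a mixed word, by induction, the only term
without a partner is the mixed cumulant of the whole word (`mixedVanish_of_moments`). Conversely, `A
= B ⊕ ker E` acts on itself by left multiplication, so `ker E` can be used as the bimodule of every
colour. One-coloured cumulants of this model are those of `A`, and if the mixed ones vanish the two
recursions coincide (`kerSystem_mom`).

It remains to recognise `S.kappa` as the cumulant defined by Möbius inversion. Extended
multiplicatively to partitions (`cumExt`), it sums over all interval-noncrossing partitions to the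
moment (`sum_cumExt`), and over those below `π` to `Φ_π` (`Phi_eq_sum`). Möbius inversion at the
one-block partition then isolates `S.kappa` (`cumulant_top`). -/

namespace FreeBoolean

/-! ### Sums over the blocks of a word -/

noncomputable section BlockSums

open scoped Classical

variable {B α M M' : Type*} [AddCommMonoid M] [AddCommMonoid M']

/-- `blockSumRev E good fr L.reverse Θ` is `blockSum E good fr L Θ`. -/
def blockSumRev (E : List α → B) (good fr : α → Prop) :
    List α → (List (B × α) → List α → M) → M
  | [], Θ => Θ [] []
  | v :: L, Θ => blockSumRev E good fr L fun V h =>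
      Θ V (h ++ [v]) + if good v ∧ ∀ x ∈ h, fr x then Θ (V ++ [(E h, v)]) [] else 0

/-- The sum of `Θ V r` over all subwords `V` of `L` that consist of good letters and have only free
letters in the gap in front of each of their letters. A letter of `V` is recorded together with the
value of `E` at the gap in front of it, and `r` is the part of `L` that follows the last letter
of `V`. -/
def blockSum (E : List α → B) (good fr : α → Prop) (L : List α)
    (Θ : List (B × α) → List α → M) : M :=
  blockSumRev E good fr L.reverse Θ

variable (E : List α → B) (good fr : α → Prop)

@[simp]
theorem blockSum_nil (Θ : List (B × α) → List α → M) : blockSum E good fr [] Θ = Θ [] [] := rfl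

/-- Identities for block sums are proved by induction from the right with this step: the remainder
`h` is exactly the gap that arises if the next letter is chosen. -/
theorem blockSum_snoc (L : List α) (v : α) (Θ : List (B × α) → List α → M) :
    blockSum E good fr (L ++ [v]) Θ = blockSum E good fr L fun V h =>
      Θ V (h ++ [v]) + if good v ∧ ∀ x ∈ h, fr x then Θ (V ++ [(E h, v)]) [] else 0 := by
  simp [blockSum, blockSumRev]

theorem blockSum_add (L : List α) (Θ Θ' : List (B × α) → List α → M) :
    blockSum E good fr L (fun V r => Θ V r + Θ' V r) =
      blockSum E good fr L Θ + blockSum E good fr L Θ' := by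
  induction L using List.reverseRecOn generalizing Θ Θ' with
  | nil => rfl
  | append_singleton L v ih =>
    rw [blockSum_snoc, blockSum_snoc, blockSum_snoc, ← ih]
    congr 1
    funext V h
    split_ifs
    · abel
    · simp

theorem map_blockSum (f : M →+ M') (L : List α) (Θ : List (B × α) → List α → M) :
    f (blockSum E good fr L Θ) = blockSum E good fr L fun V r => f (Θ V r) := by
  induction L using List.reverseRecOn generalizing Θ with
  | nil => rfl
  | append_singleton L v ih =>
    rw [blockSum_snoc, blockSum_snoc, ih]
    congr 1
    funext V h
    split_ifs <;> simp

@[simp]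
theorem blockSum_zero (L : List α) : blockSum E good fr L (fun _ _ => (0 : M)) = 0 := by
  induction L using List.reverseRecOn with
  | nil => rfl
  | append_singleton L v ih =>
    rw [blockSum_snoc]
    simpa using ih

/-- Two block sums agree if their terms do; the hypotheses of `h` are what is known about a term. -/
theorem blockSum_congr' {E E' : List α → B} (L : List α) {Θ Θ' : List (B × α) → List α → M}
    (hE : ∀ h, h.length < L.length → E h = E' h)
    (h : ∀ V r, V.length + r.length ≤ L.length → (∀ e ∈ V, good e.2 ∧ e.2 ∈ L) → (∀ x ∈ r, x ∈ L) →
      ((∀ x ∈ L, fr x) ↔ (∀ e ∈ V, fr e.2) ∧ ∀ x ∈ r, fr x) → Θ V r = Θ' V r) :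
    blockSum E good fr L Θ = blockSum E' good fr L Θ' := by
  induction L using List.reverseRecOn generalizing Θ Θ' with
  | nil => exact h [] [] (by simp) (by simp) (by simp) (by simp)
  | append_singleton L v ih =>
    rw [blockSum_snoc, blockSum_snoc]
    refine ih (fun h hh => hE h (by simp; omega)) fun V r hl hV hr hfr => ?_
    congr 1
    · refine h V (r ++ [v]) (by simp; omega) (fun e he => ⟨(hV e he).1, by simp [(hV e he).2]⟩)
        (fun x hx => ?_) ?_
      · rcases List.mem_append.1 hx with hx | hx
        · simp [hr x hx]
        · simp at hx; simp [hx]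
      · have := hfr
        simp only [List.mem_append, List.mem_singleton] at *
        constructor
        · intro H
          refine ⟨(this.1 fun x hx => H x (.inl hx)).1, ?_⟩
          rintro x (hx | rfl)
          · exact (this.1 fun x hx => H x (.inl hx)).2 x hx
          · exact H x (.inr rfl)
        · rintro ⟨H1, H2⟩ x (hx | rfl)
          · exact this.2 ⟨H1, fun x hx => H2 x (.inl hx)⟩ x hx
          · exact H2 x (.inr rfl)
    · split_ifs with hg
      · rw [hE r (by simp; omega)]
        refine h _ _ (by simp; omega) ?_ (by simp) ?_
        · intro e he
          rcases List.mem_append.1 he with he | he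
          · exact ⟨(hV e he).1, by simp [(hV e he).2]⟩
          · simp at he; subst he; exact ⟨hg.1, by simp⟩
        · simp only [List.mem_append, List.mem_singleton, List.not_mem_nil, false_imp_iff,
            implies_true, and_true]
          constructor
          · rintro H e (he | rfl)
            · exact (hfr.1 fun x hx => H x (.inl hx)).1 e he
            · exact H v (.inr rfl)
          · rintro H x (hx | rfl)
            · exact hfr.2 ⟨fun e he => H e (.inl he), hg.2⟩ x hx
            · exact H _ (.inr rfl)
      · rfl

theorem blockSum_congr (L : List α) {Θ Θ' : List (B × α) → List α → M}
    (h : ∀ V r, V.length + r.length ≤ L.length → (∀ e ∈ V, good e.2 ∧ e.2 ∈ L) → (∀ x ∈ r, x ∈ L) →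
      ((∀ x ∈ L, fr x) ↔ (∀ e ∈ V, fr e.2) ∧ ∀ x ∈ r, fr x) → Θ V r = Θ' V r) :
    blockSum E good fr L Θ = blockSum E good fr L Θ' :=
  blockSum_congr' good fr L (fun _ _ => rfl) h

/-- The term of the empty subword. -/
theorem blockSum_eq_nil_add (L : List α) (Θ : List (B × α) → List α → M) :
    blockSum E good fr L Θ =
      Θ [] L + blockSum E good fr L fun V r => if V = [] then 0 else Θ V r := by
  induction L using List.reverseRecOn generalizing Θ with
  | nil => simp
  | append_singleton L v ih =>
    rw [blockSum_snoc, blockSum_snoc, ih, add_assoc]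
    congr 1
    rw [ih (fun V h => (if V = [] then 0 else Θ V (h ++ [v])) + _)]
    simp only [reduceIte, zero_add]
    congr 1
    simp only [List.append_eq_nil_iff, List.cons_ne_nil, and_false, if_false]
    congr 2
    funext V r
    by_cases hV : V = [] <;> simp [hV]

/-- Only the terms whose subword consists of letters in `good` contribute. -/
theorem blockSum_restrict (L : List α) (Θ : List (B × α) → List α → M) :
    blockSum E good fr L Θ =
      blockSum E (fun _ => True) fr L fun V r => if ∀ e ∈ V, good e.2 then Θ V r else 0 := by
  induction L using List.reverseRecOn generalizing Θ with
  | nil => simp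
  | append_singleton L v ih =>
    rw [blockSum_snoc, blockSum_snoc, ih]
    congr 1
    funext V r
    have hiff : (∀ e ∈ V ++ [(E r, v)], good e.2) ↔ (∀ e ∈ V, good e.2) ∧ good v := by
      simp [or_imp, forall_and]
    simp only [hiff]
    by_cases hV : ∀ e ∈ V, good e.2
    · rw [if_pos hV, if_pos hV, ite_and, ite_and, if_pos trivial]
      by_cases hv : good v <;> simp only [hv, if_true, if_false, and_false, and_true, ite_self]
      simp only [if_pos hV]
    · simp only [zero_add, hV, false_and, if_false, ite_self]

/-- The term of the subword `L` itself. -/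
theorem blockSum_full (hE : E [] = one) (L : List α) (Θ : List (B × α) → List α → M) :
    blockSum E (fun _ => True) fr L Θ = Θ (L.map fun x => (one, x)) [] +
      blockSum E (fun _ => True) fr L fun V r => if V.length < L.length then Θ V r else 0 := by
  induction L using List.reverseRecOn generalizing Θ with
  | nil => simp
  | append_singleton L v ih =>
    rw [blockSum_snoc, blockSum_snoc, ih, ih (fun V h => (if V.length < _ then _ else 0) + _)]
    simp only [List.length_append, List.length_cons, List.length_nil, zero_add, List.length_map,
      List.not_mem_nil, false_imp_iff, implies_true, and_true, if_true, lt_irrefl, if_false,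
      add_zero, Nat.lt_succ_self, true_and, Nat.add_lt_add_iff_right, hE, List.map_append,
      List.map_cons, List.map_nil]
    rw [add_comm (Θ _ ([] ++ [v])), add_assoc]
    congr 2
    congr 1
    funext V r
    by_cases h : V.length < L.length
    · simp [h, Nat.lt_succ_of_lt h]
    · simp [h]

/-- Cutting a subword in two. -/
theorem blockSum_cut (L : List α) (F : List (B × α) → List (B × α) → List α → M) :
    (blockSum E good fr L fun V r =>
      ∑ k ∈ Finset.range V.length, F (V.take k) (V.drop k) r) =
    blockSum E good fr L fun V' r' => blockSum E good fr r' fun V r =>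
      if V = [] then 0 else F V' V r := by
  induction L using List.reverseRecOn generalizing F with
  | nil => simp
  | append_singleton L v ih =>
    rw [blockSum_snoc, blockSum_snoc]
    -- `F'` is what `F` becomes when `v` is appended to the word: `v` joins the remainder or the
    -- second piece.
    obtain ⟨F', hF'⟩ : ∃ F' : List (B × α) → List (B × α) → List α → M,
      F' = fun V' V h => F V' V (h ++ [v]) +
        if good v ∧ ∀ x ∈ h, fr x then F V' (V ++ [(E h, v)]) [] else 0 := ⟨_, rfl⟩
    -- Of the cuts of `V ++ [(E h, v)]` only the one right before the last letter does not come from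
    -- a cut of `V`; it is the extra term on the right.
    have hl : ∀ V h, ((∑ k ∈ Finset.range V.length, F (V.take k) (V.drop k) (h ++ [v])) +
        if good v ∧ ∀ x ∈ h, fr x then ∑ k ∈ Finset.range (V ++ [(E h, v)]).length,
          F ((V ++ [(E h, v)]).take k) ((V ++ [(E h, v)]).drop k) [] else 0) =
        (∑ k ∈ Finset.range V.length, F' (V.take k) (V.drop k) h) +
        if good v ∧ ∀ x ∈ h, fr x then F V [(E h, v)] [] else 0 := by
      intro V h
      simp only [hF']
      split_ifs with hc
      · rw [List.length_append, List.length_singleton, Finset.sum_range_succ,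
          Finset.sum_add_distrib, add_assoc]
        congr 2
        · refine Finset.sum_congr rfl fun k hk => ?_
          have hk := (Finset.mem_range.1 hk).le
          rw [List.take_append_of_le_length hk, List.drop_append_of_le_length hk]
        · simp
      · simp
    simp only [hl]
    rw [blockSum_add, ih, ← blockSum_add, hF']
    congr 1
    funext V h
    simp only [blockSum_nil, reduceIte, ite_self, add_zero]
    rw [blockSum_snoc, eq_comm, blockSum_eq_nil_add, add_comm]
    congr 1
    · congr 1
      funext V' r
      by_cases hV : V' = [] <;> simp [hV]
    · simp

end BlockSums

/-! ### Block sums of a word with a letter added in front -/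

noncomputable section BlockSumsCons

open scoped Classical

variable {B α M : Type*} [Ring B] [AddCommGroup M] [Module B M]

/-- The block sum of a word `a :: L`: the letter `a` is not in front of the last letter of the
subword, or it is the first letter of the subword, or it belongs to the first gap, which is then
expanded by the block of `a`. -/
theorem blockSum_cons (E : List α → B) (fr : α → Prop) (goodI goodJ : α → Prop)
    (a : α) (cc : List (B × α) → B) (L : List α) (hE : E [] = 1)
    (hcc : ∀ g, g.length < L.length →
      E (a :: g) = blockSum E goodJ fr g fun V r => cc V * E r)
    (Θ : List (B × α) → List α → M)
    (hΘ : ∀ b x V r, Θ ((b, x) :: V) r = b • Θ ((1, x) :: V) r) :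
    blockSum E goodI fr (a :: L) Θ = Θ [] (a :: L) +
      (if goodI a then blockSum E goodI fr L fun V r => Θ ((1, a) :: V) r else 0) +
      (if fr a then blockSum E goodJ fr L fun V' r' =>
        if ∀ e ∈ V', fr e.2 then
          cc V' • blockSum E goodI fr r' fun V r => if V = [] then 0 else Θ V r
        else 0 else 0) := by
  induction L using List.reverseRecOn generalizing Θ with
  | nil =>
    have := blockSum_snoc E goodI fr [] a Θ
    simp only [List.nil_append] at this
    rw [this]
    simp [hE]
  | append_singleton L v ih =>
    rw [← List.cons_append, blockSum_snoc, ih]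
    rotate_left
    · intro g hg
      exact hcc g (by simp; omega)
    · intro b x V r
      rw [hΘ b, List.cons_append, hΘ b, smul_add]
      congr 1
      split_ifs <;> simp
    -- The second block starts before `v`, or at `v` with all of `r'` as its gap; in the latter case
    -- `hΘ` pulls out the value of that gap.
    have h2 : ∀ r' : List α,
        (blockSum E goodI fr (r' ++ [v]) fun V r => if V = [] then 0 else Θ V r) =
        (blockSum E goodI fr r' fun V r => if V = [] then 0 else Θ V (r ++ [v]) +
          if goodI v ∧ ∀ x ∈ r, fr x then Θ (V ++ [(E r, v)]) [] else 0) +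
        if goodI v ∧ ∀ x ∈ r', fr x then E r' • Θ [(1, v)] [] else (0 : M) := by
      intro r'
      rw [blockSum_snoc, blockSum_eq_nil_add, add_comm]
      congr 1
      · congr 1
        funext V r
        by_cases hV : V = [] <;> simp [hV]
      · simp only [reduceIte, zero_add, List.nil_append]
        split_ifs with h h'
        · simp at h'
        · exact hΘ _ _ _ _
        · rfl
    rw [blockSum_snoc (good := goodI), blockSum_snoc (good := goodJ)]
    have h3 : ∀ V' r', ((if ∀ e ∈ V', fr e.2 then cc V' •
          (blockSum E goodI fr (r' ++ [v]) fun V r => if V = [] then 0 else Θ V r) else 0) +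
        if goodJ v ∧ ∀ x ∈ r', fr x then
          (if ∀ e ∈ V' ++ [(E r', v)], fr e.2 then cc (V' ++ [(E r', v)]) •
            (blockSum E goodI fr [] fun V r => if V = [] then 0 else Θ V r) else 0) else 0) =
        (if ∀ e ∈ V', fr e.2 then cc V' •
          (blockSum E goodI fr r' fun V r => if V = [] then 0 else Θ V (r ++ [v]) +
            if goodI v ∧ ∀ x ∈ r, fr x then Θ (V ++ [(E r, v)]) [] else 0) else 0) +
        if (∀ e ∈ V', fr e.2) ∧ goodI v ∧ ∀ x ∈ r', fr x then
          (cc V' * E r') • Θ [(1, v)] [] else (0 : M) := by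
      intro V' r'
      simp only [blockSum_nil, reduceIte, smul_zero, ite_self, add_zero]
      by_cases hV : ∀ e ∈ V', fr e.2
      · rw [if_pos hV, if_pos hV, h2, smul_add]
        congr 1
        rw [smul_ite, smul_zero, smul_smul]
        exact if_congr (by rw [and_iff_right hV]) rfl rfl
      · rw [if_neg hV, if_neg hV, if_neg fun h => hV h.1, add_zero]
    -- The terms in which `v` is the only letter of the subword and `a` lies in its gap are summed
    -- by the expansion `hcc` of `E (a :: L)`, giving one term with the gap `a :: L`.
    have h4 : (blockSum E goodJ fr L fun V' r' =>
          if (∀ e ∈ V', fr e.2) ∧ goodI v ∧ ∀ x ∈ r', fr x then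
          (cc V' * E r') • Θ [(1, v)] [] else (0 : M)) =
        if goodI v ∧ ∀ x ∈ L, fr x then E (a :: L) • Θ [(1, v)] [] else 0 := by
      split_ifs with h
      · rw [hcc L (by simp)]
        have := map_blockSum E goodJ fr
          ((LinearMap.toSpanSingleton B M (Θ [(1, v)] [])).toAddMonoidHom)
          L (fun V r => cc V * E r)
        simp only [LinearMap.toAddMonoidHom_coe, LinearMap.toSpanSingleton_apply] at this
        rw [this]
        refine blockSum_congr _ _ _ _ fun V r _ _ _ hf => ?_
        rw [if_pos ⟨(hf.1 h.2).1, h.1, (hf.1 h.2).2⟩]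
      · refine (blockSum_congr _ _ _ _ fun V r _ _ _ hf => ?_).trans (blockSum_zero E goodJ fr L)
        rw [if_neg]
        rintro ⟨h1, h2, h3⟩
        exact h ⟨h2, hf.2 ⟨h1, h3⟩⟩
    simp only [h3]
    rw [blockSum_add E goodJ fr L (fun V' r' => if ∀ e ∈ V', fr e.2 then cc V' • _ else 0), h4]
    by_cases ha : fr a
    · have : (goodI v ∧ ∀ x ∈ a :: L, fr x) ↔ (goodI v ∧ ∀ x ∈ L, fr x) := by simp [ha]
      simp only [this, ha, if_true, List.nil_append, List.cons_append]
      rw [hΘ]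
      abel
    · have : ¬ (goodI v ∧ ∀ x ∈ a :: L, fr x) := by simp [ha]
      simp only [this, ha, if_false, List.cons_append, add_zero]

end BlockSumsCons

/-! ### Abstract free-Boolean systems -/

noncomputable section System

open scoped Classical

variable (B : Type*) [Ring B] (ι α : Type*) (Y : ι → Type*) [∀ i, AddCommGroup (Y i)]
  [∀ i, Module B (Y i)] (X : Type*) [AddCommGroup X] [Module B X]

/-- The properties of the action of the letters `a : α` on a reduced free product `X` of the
`Y i` that determine the joint moments. The vector `mu i ξ z` stands for `ξ ⊗ z'`, where `z'` is
the part of `z` in the words that do not start with `i`. -/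
structure System where
  col : α → ι
  fr : α → Prop
  one : ∀ i, Y i
  p : ∀ i, Y i →ₗ[B] B
  vac : X
  P : X →ₗ[B] B
  mu : ∀ i, Y i →ₗ[B] X →+ X
  act : ∀ i, α → Y i →+ Y i
  T : α → X →+ X
  P_vac : P vac = 1
  mu_vac : ∀ i (b : B), mu i (one i) (b • vac) = b • vac
  P_mu : ∀ i ξ z, P (mu i ξ z) = p i ξ * P z
  mu_one_mu : ∀ i ξ z, mu i (one i) (mu i ξ z) = p i ξ • mu i (one i) z
  mu_one_mu_of_ne : ∀ i j ξ z, i ≠ j →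
    mu j ξ z - mu i (one i) (mu j ξ z) = p j ξ • (z - mu i (one i) z)
  T_free : ∀ a ξ z, fr a → T a (mu (col a) ξ z) = mu (col a) (act (col a) a ξ) z
  T_boolean : ∀ a ξ z, ¬ fr a →
    T a (mu (col a) ξ z) = mu (col a) (act (col a) a ξ) (P z • vac)

namespace System

variable {B ι α Y X} (F : System B ι α Y X)

/-- The vector that a word creates from the vacuum. -/
def vec (L : List α) : X := L.foldr (fun a z => F.T a z) F.vac

/-- The moment of a word. -/
def mom (L : List α) : B := F.P (F.vec L)

@[simp] theorem vec_nil : F.vec [] = F.vac := rfl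

@[simp] theorem vec_cons (a : α) (L : List α) : F.vec (a :: L) = F.T a (F.vec L) := rfl

@[simp] theorem mom_nil : F.mom [] = 1 := F.P_vac

/-- The vector-valued cumulants of the colour `i`. -/
def cumVec (i : ι) : List (B × α) → Y i
  | [] => F.one i
  | (b, a) :: V => b • (F.act i a (cumVec i V) - F.p i (F.act i a (cumVec i V)) • F.one i -
      ∑ k ∈ Finset.range V.length, if F.fr a ∧ ∀ e ∈ V.take k, F.fr e.2 then
        F.p i (F.act i a (cumVec i (V.take k))) • cumVec i (V.drop k) else 0)
termination_by V => V.length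
decreasing_by all_goals simp

/-- The cumulant of the letter `a` followed by the entries of `V`. -/
def cum (i : ι) (a : α) (V : List (B × α)) : B := F.p i (F.act i a (F.cumVec i V))

theorem cumVec_nil (i : ι) : F.cumVec i [] = F.one i := by rw [cumVec]

theorem cumVec_cons (i : ι) (b : B) (a : α) (V : List (B × α)) :
    F.cumVec i ((b, a) :: V) = b • (F.act i a (F.cumVec i V) - F.cum i a V • F.one i -
      ∑ k ∈ Finset.range V.length, if F.fr a ∧ ∀ e ∈ V.take k, F.fr e.2 then
        F.cum i a (V.take k) • F.cumVec i (V.drop k) else 0) := by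
  rw [cumVec]; rfl

/-- The subtractions in `cumVec` are made for this: a letter joins the open block, closes it, or
closes an initial segment of it. In the last case the closed part lies in the gap in front of an
open block, and therefore all its letters have to be free. -/
theorem act_cumVec (i : ι) (a : α) (V : List (B × α)) :
    F.act i a (F.cumVec i V) = F.cumVec i ((1, a) :: V) + F.cum i a V • F.one i +
      ∑ k ∈ Finset.range V.length, if F.fr a ∧ ∀ e ∈ V.take k, F.fr e.2 then
        F.cum i a (V.take k) • F.cumVec i (V.drop k) else 0 := by
  rw [cumVec_cons, one_smul]; abel

/-- `z`, or its vacuum part if `V` contains a Boolean letter. -/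
def cutoff (V : List (B × α)) : X →+ X :=
  if ∀ e ∈ V, F.fr e.2 then AddMonoidHom.id X
  else (LinearMap.toSpanSingleton B X F.vac ∘ₗ F.P).toAddMonoidHom

theorem cutoff_free {V : List (B × α)} (h : ∀ e ∈ V, F.fr e.2) (z : X) : F.cutoff V z = z := by
  rw [cutoff, if_pos h]; rfl

theorem cutoff_boolean {V : List (B × α)} (h : ¬ ∀ e ∈ V, F.fr e.2) (z : X) :
    F.cutoff V z = F.P z • F.vac := by
  rw [cutoff, if_neg h]; rfl

theorem P_cutoff (V : List (B × α)) (z : X) : F.P (F.cutoff V z) = F.P z := by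
  by_cases h : ∀ e ∈ V, F.fr e.2
  · rw [F.cutoff_free h]
  · rw [F.cutoff_boolean h, map_smul, F.P_vac, smul_eq_mul, mul_one]

/-- The cutoff treats both kinds of letters uniformly: a Boolean letter reduces `z` to its vacuum
part, and after one such reduction further letters change nothing. -/
theorem T_mu_cutoff (a : α) (V : List (B × α)) (ξ : Y (F.col a)) (z : X) :
    F.T a (F.mu (F.col a) ξ (F.cutoff V z)) =
      F.mu (F.col a) (F.act (F.col a) a ξ) (F.cutoff ((1, a) :: V) z) := by
  by_cases ha : F.fr a
  · rw [F.T_free a _ _ ha]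
    by_cases h : ∀ e ∈ V, F.fr e.2
    · rw [F.cutoff_free h, F.cutoff_free (by simpa [ha] using h)]
    · rw [F.cutoff_boolean h, F.cutoff_boolean (by simpa [ha] using h)]
  · rw [F.T_boolean a _ _ ha, P_cutoff, F.cutoff_boolean (by simp [ha])]

/-- The block expansion of the vector of a word, provided that of the shorter words. -/
theorem vec_cons_eq (a : α) (L : List α)
    (hL : F.vec L = blockSum F.mom (fun x => F.col x = F.col a) F.fr L fun V r =>
      F.mu (F.col a) (F.cumVec (F.col a) V) (F.cutoff V (F.vec r))) :
    F.vec (a :: L) = blockSum F.mom (fun x => F.col x = F.col a) F.fr L fun V r =>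
      F.mu (F.col a) (F.act (F.col a) a (F.cumVec (F.col a) V))
        (F.cutoff ((1, a) :: V) (F.vec r)) := by
  rw [vec_cons, hL, map_blockSum]
  simp only [T_mu_cutoff]

/-- `P` is multiplicative on `mu` and does not see the cutoff. The expansion of `F.vec L` is a
hypothesis because this lemma is already needed, for the gaps, inside the induction that proves that
expansion. -/
theorem mom_cons_aux (a : α) (L : List α)
    (hL : F.vec L = blockSum F.mom (fun x => F.col x = F.col a) F.fr L fun V r =>
      F.mu (F.col a) (F.cumVec (F.col a) V) (F.cutoff V (F.vec r))) :
    F.mom (a :: L) = blockSum F.mom (fun x => F.col x = F.col a) F.fr L fun V r =>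
      F.cum (F.col a) a V * F.mom r := by
  have := map_blockSum F.mom (fun x => F.col x = F.col a) F.fr F.P.toAddMonoidHom L
    fun V r => F.mu (F.col a) (F.act (F.col a) a (F.cumVec (F.col a) V))
        (F.cutoff ((1, a) :: V) (F.vec r))
  simp only [LinearMap.toAddMonoidHom_coe, P_mu, P_cutoff] at this
  rw [mom, F.vec_cons_eq a L hL, this]
  rfl

theorem cutoff_vac (V : List (B × α)) : F.cutoff V F.vac = F.vac := by
  by_cases h : ∀ e ∈ V, F.fr e.2
  · rw [F.cutoff_free h]
  · rw [F.cutoff_boolean h, F.P_vac, one_smul]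

theorem mu_one_vac (i : ι) : F.mu i (F.one i) F.vac = F.vac := by
  simpa using F.mu_vac i 1

/-- Induction on the length, for all colours at once. The vector of `a :: L` is known from the
expansion of `L` in the colour of `a`, while `blockSum_cons` sorts the claimed expansion in the
colour `i` by the position of `a`. If `a` has colour `i`, the terms recombine by `act_cumVec`.
Otherwise `a` lies outside the block or in its first gap, and the second possibility is matched with
the expansion of the remainder in the colour `i`. -/
theorem vec_eq_blockSum (L : List α) (i : ι) :
    F.vec L = blockSum F.mom (fun x => F.col x = i) F.fr L fun V r =>
      F.mu i (F.cumVec i V) (F.cutoff V (F.vec r)) := by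
  induction h : L.length using Nat.strong_induction_on generalizing L i with
  | _ n ih =>
  subst h
  cases L with
  | nil => simp [cumVec_nil, mu_one_vac, cutoff_vac]
  | cons a L =>
    have hL := ih L.length (by simp) L (F.col a) rfl
    have hcc : ∀ g : List α, g.length < L.length → F.mom (a :: g) =
        blockSum F.mom (fun x => F.col x = F.col a) F.fr g fun V r =>
          F.cum (F.col a) a V * F.mom r := fun g hg =>
      F.mom_cons_aux a g (ih g.length (by simp; omega) g _ rfl)
    rw [blockSum_cons F.mom F.fr (fun x => F.col x = i) (fun x => F.col x = F.col a) a
      (F.cum (F.col a) a) L F.mom_nil hcc]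
    rotate_left
    · intro b x V r
      have h1 : F.cumVec i ((b, x) :: V) = b • F.cumVec i ((1, x) :: V) := by
        rw [cumVec_cons, cumVec_cons, one_smul]
      have h2 : F.cutoff ((b, x) :: V) = F.cutoff ((1, x) :: V) := by
        simp [cutoff]
      rw [h1, h2, map_smul, AddMonoidHom.smul_apply]
    rw [F.cutoff_free (by simp), cumVec_nil]
    by_cases hi : F.col a = i
    · subst hi
      have hone := map_blockSum F.mom (fun x => F.col x = F.col a) F.fr
        (F.mu (F.col a) (F.one (F.col a))) L fun V r =>
          F.mu (F.col a) (F.act (F.col a) a (F.cumVec (F.col a) V))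
            (F.cutoff ((1, a) :: V) (F.vec r))
      rw [← F.vec_cons_eq a L hL] at hone
      rw [if_pos rfl, hone, F.vec_cons_eq a L hL]
      -- A block of `a` that is closed inside the first gap, followed by an open block of the same
      -- colour, is one subword cut in two.
      have hcut := blockSum_cut F.mom (fun x => F.col x = F.col a) F.fr L fun V' V r =>
        if F.fr a ∧ ∀ e ∈ V', F.fr e.2 then F.cum (F.col a) a V' •
          F.mu (F.col a) (F.cumVec (F.col a) V) (F.cutoff V (F.vec r)) else 0
      have hthird : (if F.fr a then blockSum F.mom (fun x => F.col x = F.col a) F.fr L fun V' r' =>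
          if ∀ e ∈ V', F.fr e.2 then F.cum (F.col a) a V' •
            blockSum F.mom (fun x => F.col x = F.col a) F.fr r' fun V r =>
              if V = [] then 0 else F.mu (F.col a) (F.cumVec (F.col a) V) (F.cutoff V (F.vec r))
          else 0 else 0) = blockSum F.mom (fun x => F.col x = F.col a) F.fr L fun V' r' =>
            blockSum F.mom (fun x => F.col x = F.col a) F.fr r' fun V r => if V = [] then 0 else
              if F.fr a ∧ ∀ e ∈ V', F.fr e.2 then F.cum (F.col a) a V' •
                F.mu (F.col a) (F.cumVec (F.col a) V) (F.cutoff V (F.vec r)) else 0 := by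
        by_cases ha : F.fr a
        · rw [if_pos ha]
          congr 1
          funext V' r'
          by_cases hV' : ∀ e ∈ V', F.fr e.2
          · have := map_blockSum F.mom (fun x => F.col x = F.col a) F.fr
              (DistribSMul.toAddMonoidHom X (F.cum (F.col a) a V')) r' fun V r =>
              if V = [] then 0 else F.mu (F.col a) (F.cumVec (F.col a) V) (F.cutoff V (F.vec r))
            simp only [DistribSMul.toAddMonoidHom_apply] at this
            rw [if_pos hV', this]
            congr 1
            funext V r
            simp only [smul_ite, smul_zero,
              if_pos (⟨ha, hV'⟩ : F.fr a ∧ ∀ e ∈ V', F.fr e.2)]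
          · rw [if_neg hV', eq_comm]
            simp only [if_neg fun h : F.fr a ∧ ∀ e ∈ V', F.fr e.2 => hV' h.2, ite_self,
              blockSum_zero]
        · simp [ha]
      rw [hthird, ← hcut, ← blockSum_add, ← blockSum_add]
      congr 1
      funext V r
      rw [F.mu_one_mu, F.act_cumVec, map_add, map_add, AddMonoidHom.add_apply,
        AddMonoidHom.add_apply, add_comm (F.mu _ (F.cumVec _ _) _), ← F.act_cumVec, map_smul]
      congr 1
      rw [map_sum, AddMonoidHom.finsetSum_apply]
      refine Finset.sum_congr rfl fun k _ => ?_
      split_ifs with hk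
      -- The letters that are split off are free, so they have no influence on the cutoff.
      · have : F.cutoff ((1, a) :: V) = F.cutoff (V.drop k) := by
          have hiff : (∀ e ∈ (1, a) :: V, F.fr e.2) ↔ ∀ e ∈ V.drop k, F.fr e.2 := by
            constructor
            · exact fun h e he => h e (List.mem_cons_of_mem _ (List.mem_of_mem_drop he))
            · intro h e he
              rcases List.mem_cons.1 he with rfl | he
              · exact hk.1
              · rw [← List.take_append_drop k V, List.mem_append] at he
                exact he.elim (hk.2 e) (h e)
          simp only [cutoff, hiff]
        rw [map_smul, AddMonoidHom.smul_apply, this]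
      · simp
    -- What has to be computed is `id - F.mu i (F.one i)` on the vector, in the free product the
    -- projection onto the words that start with `i`.
    · rw [if_neg hi, add_zero, ← sub_eq_iff_eq_add']
      have hdiff := map_blockSum F.mom (fun x => F.col x = F.col a) F.fr
        (AddMonoidHom.id X - F.mu i (F.one i)) L fun V r =>
          F.mu (F.col a) (F.act (F.col a) a (F.cumVec (F.col a) V))
            (F.cutoff ((1, a) :: V) (F.vec r))
      rw [← F.vec_cons_eq a L hL] at hdiff
      simp only [AddMonoidHom.sub_apply, AddMonoidHom.id_apply,
        F.mu_one_mu_of_ne i (F.col a) _ _ (Ne.symm hi)] at hdiff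
      rw [hdiff]
      by_cases ha : F.fr a
      · rw [if_pos ha]
        refine blockSum_congr _ _ _ _ fun V r hr _ _ _ => ?_
        by_cases hV : ∀ e ∈ V, F.fr e.2
        -- Without Boolean letters the remainder is intact, and its own expansion in the colour `i`,
        -- without the empty subword, is the missing sum.
        · rw [if_pos hV, F.cutoff_free (by simpa [ha] using hV)]
          congr 1
          have hr' := ih r.length (by simp; omega) r i rfl
          rw [blockSum_eq_nil_add, F.cutoff_free (by simp), cumVec_nil] at hr'
          exact sub_eq_iff_eq_add'.2 hr'
        -- A Boolean letter leaves a multiple of the vacuum, on which the projection vanishes.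
        · rw [if_neg hV, F.cutoff_boolean (by simpa [ha] using hV), F.mu_vac, sub_self, smul_zero]
      · rw [if_neg ha, eq_comm]
        refine (blockSum_zero F.mom (fun x => F.col x = F.col a) F.fr L).symm.trans ?_
        congr 1
        funext V r
        rw [F.cutoff_boolean (by simp [ha]), F.mu_vac, sub_self, smul_zero]

/-- The moment of a word is the sum of the cumulants of the blocks that contain the first letter,
times the moment of the rest. -/
theorem mom_cons (a : α) (L : List α) :
    F.mom (a :: L) = blockSum F.mom (fun x => F.col x = F.col a) F.fr L fun V r =>
      F.cum (F.col a) a V * F.mom r :=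
  F.mom_cons_aux a L (F.vec_eq_blockSum L _)

end System

end System

/-! ### The reduced free product as a free-Boolean system -/

noncomputable section FreeProductSystem

open scoped Classical

variable {𝕜 : Type v} {B : Type u} [CommRing 𝕜] [Ring B] [Algebra 𝕜 B]
variable {ι : Type w} (X : ι → Bimod.{u, v} 𝕜 B)

theorem incl_left (l : RWord ι) (b : B) (t : word X l.1) :
    incl X l (b • t) = b • incl X l t :=
  (DirectSum.lof B (RWord ι) (fun l => word X l.1) l).map_smul b t

theorem inclCons_left (i : ι) (l : RWordAvoid i) (b : B) (t : BTensor 𝕜 B (X i) (word X l.1)) :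
    inclCons X i l (b • t) = b • inclCons X i l t :=
  incl_left X l.cons b (consEquiv X i l.1 t)

theorem glue_left (i : ι) (b : B) (x : BTensor 𝕜 B (B × X i) (FreeProdAvoid X i)) :
    glue X i (b • x) = b • glue X i x := by
  induction x using BTensor.induction with
  | h0 => simp
  | ha x y hx hy => rw [smul_add, map_add, map_add, hx, hy, smul_add]
  | ht y n =>
    induction n using DirectSum.induction_on with
    | zero => simp
    | add n n' h h' => rw [BTensor.tmul_add, smul_add, map_add, map_add, h, h', smul_add]
    | of l t =>
      change glue X i (b • BTensor.tmul 𝕜 B y (inclAvoid X i l t)) =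
        b • glue X i (BTensor.tmul 𝕜 B y (inclAvoid X i l t))
      rw [BTensor.left_smul_tmul, glue_tmul, glue_tmul, smul_add, ← incl_left,
        ← inclCons_left, BTensor.left_smul_tmul, Prod.smul_fst, Prod.smul_snd, smul_assoc]

theorem split_left (i : ι) (b : B) (z : FreeProd X) : split X i (b • z) = b • split X i z := by
  conv_lhs => rw [← glue_split X i z, ← glue_left, split_glue]

/-- The map `(b ⊕ x) ⊗ n ↦ b n`. -/
def contract (i : ι) : BTensor 𝕜 B (B × X i) (FreeProdAvoid X i) →ₗ[𝕜] FreeProdAvoid X i :=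
  BTensor.lift (LinearMap.mk₂ 𝕜 (fun y n => y.1 • n)
    (fun y y' n => by simp [add_smul])
    (fun z y n => by simp)
    (fun y n n' => by simp)
    (fun z y n => smul_comm _ _ _)) (by
    intro y b n
    simp [mul_smul])

@[simp]
theorem contract_tmul (i : ι) (y : B × X i) (n : FreeProdAvoid X i) :
    contract X i (BTensor.tmul 𝕜 B y n) = y.1 • n :=
  BTensor.lift_tmul _ _ y n

theorem contract_left (i : ι) (b : B) (x : BTensor 𝕜 B (B × X i) (FreeProdAvoid X i)) :
    contract X i (b • x) = b • contract X i x := by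
  induction x using BTensor.induction with
  | h0 => simp
  | ha x y hx hy => rw [smul_add, map_add, map_add, hx, hy, smul_add]
  | ht y n => simp [mul_smul]

/-- The part of a vector in the words that do not start with `i`. -/
def avoidPart (i : ι) : FreeProd X →ₗ[𝕜] FreeProdAvoid X i := contract X i ∘ₗ split X i

@[simp]
theorem avoidPart_glue (i : ι) (x : BTensor 𝕜 B (B × X i) (FreeProdAvoid X i)) :
    avoidPart X i (glue X i x) = contract X i x := by
  simp [avoidPart, split_glue]

theorem avoidPart_left (i : ι) (b : B) (z : FreeProd X) :
    avoidPart X i (b • z) = b • avoidPart X i z := by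
  simp [avoidPart, split_left, contract_left]

/-- The inclusion of the words that do not start with `i`. -/
def ofAvoid (i : ι) (n : FreeProdAvoid X i) : FreeProd X :=
  glue X i (BTensor.tmul 𝕜 B (1, 0) n)

theorem ofAvoid_left (i : ι) (b : B) (n : FreeProdAvoid X i) :
    ofAvoid X i (b • n) = b • ofAvoid X i n := by
  rw [ofAvoid, ofAvoid, ← glue_left, ← BTensor.smul_tmul, BTensor.left_smul_tmul]
  congr 2
  ext <;> simp

theorem ofAvoid_inclAvoid (i : ι) (l : RWordAvoid i) (t : word X l.1) :
    ofAvoid X i (inclAvoid X i l t) = incl X ⟨l.1, l.2.1⟩ t := by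
  rw [ofAvoid, glue_tmul]; simp

theorem glue_tmul_eq (i : ι) (y : B × X i) (n : FreeProdAvoid X i) :
    glue X i (BTensor.tmul 𝕜 B y n) =
      y.1 • ofAvoid X i n + glue X i (BTensor.tmul 𝕜 B (0, y.2) n) := by
  rw [ofAvoid, ← glue_left, BTensor.left_smul_tmul, ← map_add, ← BTensor.add_tmul]
  congr 2
  ext <;> simp

theorem exists_tensor_induction {C : FreeProd X → Prop} (i : ι) (z : FreeProd X) (h0 : C 0)
    (ht : ∀ y n, C (glue X i (BTensor.tmul 𝕜 B y n)))
    (ha : ∀ x y, C x → C y → C (x + y)) : C z := by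
  rw [← glue_split X i z]
  induction split X i z using BTensor.induction with
  | h0 => simpa using h0
  | ht y n => exact ht y n
  | ha x y hx hy => rw [map_add]; exact ha _ _ hx hy

theorem FreeProdAvoid.induction {i : ι} {C : FreeProdAvoid X i → Prop} (n : FreeProdAvoid X i)
    (h0 : C 0) (ht : ∀ l t, C (inclAvoid X i l t)) (ha : ∀ x y, C x → C y → C (x + y)) : C n := by
  induction n using DirectSum.induction_on with
  | zero => exact h0
  | add x y hx hy => exact ha x y hx hy
  | of l t => exact ht l t

/-- The projection onto `B`, as a left linear map. -/
def projBL : FreeProd X →ₗ[B] B where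
  toFun := projB X
  map_add' _ _ := rfl
  map_smul' _ _ := rfl

theorem projB_incl_of_ne {l : RWord ι} (hl : l.1 ≠ []) (t : word X l.1) :
    projB X (incl X l t) = 0 := by
  have : (incl X l t : FreeProd X) ⟨[], List.IsChain.nil⟩ = 0 :=
    DirectSum.of_eq_of_ne _ _ _ fun h => hl (congrArg Subtype.val h).symm
  rw [projB, this, map_zero]

theorem projB_incl_nil (t : B) :
    projB X (incl X ⟨[], List.IsChain.nil⟩ (nilEquiv X t)) = t := by
  have : (incl X ⟨[], List.IsChain.nil⟩ (nilEquiv X t) : FreeProd X) ⟨[], List.IsChain.nil⟩ =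
      nilEquiv X t :=
    DirectSum.of_eq_same _ _
  rw [projB, this, LinearEquiv.symm_apply_apply]

theorem projB_glue_zero (i : ι) (x : X i) (n : FreeProdAvoid X i) :
    projB X (glue X i (BTensor.tmul 𝕜 B (0, x) n)) = 0 := by
  change projBL X _ = 0
  induction n using FreeProdAvoid.induction with
  | h0 => simp
  | ha n n' h h' => rw [BTensor.tmul_add, map_add, map_add, h, h', add_zero]
  | ht l t =>
    rw [glue_tmul]
    simp only [zero_smul, map_zero, zero_add]
    exact projB_incl_of_ne X (l := l.cons) (by simp [RWordAvoid.cons]) _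

theorem projB_glue (i : ι) (y : B × X i) (n : FreeProdAvoid X i) :
    projBL X (glue X i (BTensor.tmul 𝕜 B y n)) = y.1 * projBL X (ofAvoid X i n) := by
  rw [glue_tmul_eq, map_add, map_smul]
  exact (congrArg _ (projB_glue_zero X i y.2 n)).trans (add_zero _)

/-- Dropping the words that start with `i` keeps the empty word. -/
theorem projB_ofAvoid_avoidPart (i : ι) (z : FreeProd X) :
    projBL X (ofAvoid X i (avoidPart X i z)) = projBL X z := by
  induction z using exists_tensor_induction X i with
  | h0 => simp [ofAvoid]
  | ht y n => rw [avoidPart_glue, contract_tmul, ofAvoid_left, map_smul, projB_glue, smul_eq_mul]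
  | ha x y hx hy =>
    have : ∀ m n, ofAvoid X i (m + n) = ofAvoid X i m + ofAvoid X i n := fun m n => by
      simp [ofAvoid, BTensor.tmul_add]
    rw [map_add, this, map_add, map_add, hx, hy]

/-- `1`, as an element of the part that avoids `i`. -/
def vacAvoid (i : ι) : FreeProdAvoid X i :=
  inclAvoid X i ⟨[], List.IsChain.nil, by simp⟩ (nilEquiv X 1)

theorem ofAvoid_vacAvoid (i : ι) : ofAvoid X i (vacAvoid X i) = vac X :=
  ofAvoid_inclAvoid X i ⟨[], List.IsChain.nil, by simp⟩ _

theorem avoidPart_ofAvoid (i : ι) (n : FreeProdAvoid X i) :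
    avoidPart X i (ofAvoid X i n) = n := by
  simp [ofAvoid]

theorem avoidPart_vac (i : ι) : avoidPart X i (vac X) = vacAvoid X i := by
  rw [← ofAvoid_vacAvoid X i, avoidPart_ofAvoid]

/-- All words involved start with `j`, hence not with `i`. -/
theorem ofAvoid_avoidPart_glue_zero {i j : ι} (hij : i ≠ j) (x : X j) (n : FreeProdAvoid X j) :
    ofAvoid X i (avoidPart X i (glue X j (BTensor.tmul 𝕜 B (0, x) n))) =
      glue X j (BTensor.tmul 𝕜 B (0, x) n) := by
  induction n using FreeProdAvoid.induction with
  | h0 => simp [ofAvoid]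
  | ha n n' h h' =>
    rw [BTensor.tmul_add, map_add, map_add]
    conv_rhs => rw [← h, ← h']
    simp [ofAvoid, BTensor.tmul_add]
  | ht l t =>
    rw [glue_tmul]
    simp only [zero_smul, map_zero, zero_add]
    have := ofAvoid_inclAvoid X i ⟨j :: l.1, l.cons.2, by simpa using hij.symm⟩
      (consEquiv X j l.1 (BTensor.tmul 𝕜 B x t))
    change ofAvoid X i (avoidPart X i (incl X l.cons (consEquiv X j l.1 (BTensor.tmul 𝕜 B x t)))) =
      incl X l.cons (consEquiv X j l.1 (BTensor.tmul 𝕜 B x t))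
    change _ = incl X l.cons _ at this
    rw [← this, avoidPart_ofAvoid]

/-- The map `z ↦ ξ ⊗ z'`, where `z'` is the part of `z` that avoids `i`. -/
def tensorAvoid (i : ι) : (B × X i) →ₗ[B] FreeProd X →+ FreeProd X where
  toFun ξ := (glue X i ∘ₗ BTensor.mk 𝕜 B ξ ∘ₗ avoidPart X i).toAddMonoidHom
  map_add' ξ ξ' := AddMonoidHom.ext fun z => by
    change glue X i (BTensor.tmul 𝕜 B (ξ + ξ') (avoidPart X i z)) =
      glue X i (BTensor.tmul 𝕜 B ξ (avoidPart X i z)) +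
        glue X i (BTensor.tmul 𝕜 B ξ' (avoidPart X i z))
    rw [BTensor.add_tmul, map_add]
  map_smul' b ξ := AddMonoidHom.ext fun z => by
    change glue X i (BTensor.tmul 𝕜 B (b • ξ) (avoidPart X i z)) =
      b • glue X i (BTensor.tmul 𝕜 B ξ (avoidPart X i z))
    rw [← glue_left, BTensor.left_smul_tmul]

theorem tensorAvoid_apply (i : ι) (ξ : B × X i) (z : FreeProd X) :
    tensorAvoid X i ξ z = glue X i (BTensor.tmul 𝕜 B ξ (avoidPart X i z)) := rfl

theorem tensorAvoid_one (i : ι) (z : FreeProd X) :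
    tensorAvoid X i (1, 0) z = ofAvoid X i (avoidPart X i z) := rfl

theorem tensorAvoid_one_left (i : ι) (b : B) (z : FreeProd X) :
    tensorAvoid X i (1, 0) (b • z) = b • tensorAvoid X i (1, 0) z := by
  rw [tensorAvoid_one, tensorAvoid_one, avoidPart_left, ofAvoid_left]

/-- Only the summand `ξ.1 • n` of `ξ ⊗ n` can contain words that start with `i`; the other summand
consists of words that start with `j`. -/
theorem glue_sub_tensorAvoid_one {i j : ι} (hij : i ≠ j) (ξ : B × X j) (n : FreeProdAvoid X j) :
    glue X j (BTensor.tmul 𝕜 B ξ n) - tensorAvoid X i (1, 0) (glue X j (BTensor.tmul 𝕜 B ξ n)) =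
      ξ.1 • (ofAvoid X j n - tensorAvoid X i (1, 0) (ofAvoid X j n)) := by
  rw [glue_tmul_eq, map_add, tensorAvoid_one_left, smul_sub, tensorAvoid_one X i (glue X j _),
    ofAvoid_avoidPart_glue_zero X hij]
  abel

/-- Both sides are the part of `z` in the words that start with `i`, and this part is not affected
by removing the words that start with `j`. -/
theorem ofAvoid_sub_tensorAvoid_one {i j : ι} (hij : i ≠ j) (z : FreeProd X) :
    ofAvoid X j (avoidPart X j z) - tensorAvoid X i (1, 0) (ofAvoid X j (avoidPart X j z)) =
      z - tensorAvoid X i (1, 0) z := by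
  induction z using exists_tensor_induction X j with
  | h0 => simp [ofAvoid]
  | ht y n =>
    rw [avoidPart_glue, contract_tmul, ofAvoid_left, tensorAvoid_one_left, ← smul_sub,
      glue_sub_tensorAvoid_one X hij]
  | ha x y hx hy =>
    have : ∀ m n, ofAvoid X j (m + n) = ofAvoid X j m + ofAvoid X j n := fun m n => by
      simp [ofAvoid, BTensor.tmul_add]
    rw [map_add, this, map_add, map_add, add_sub_add_comm, add_sub_add_comm, hx, hy]

theorem lam_glue (i : ι) (a : Module.End Bᵐᵒᵖ (B × X i)) (ξ : B × X i) (n : FreeProdAvoid X i) :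
    lam X i a (glue X i (BTensor.tmul 𝕜 B ξ n)) = glue X i (BTensor.tmul 𝕜 B (a ξ) n) := by
  change glue X i (BTensor.map (𝕜 := 𝕜) a LinearMap.id
    (split X i (glue X i (BTensor.tmul 𝕜 B ξ n)))) = _
  rw [split_glue, BTensor.map_tmul]
  rfl

theorem wordProj_incl_same (l : RWord ι) (t : word X l.1) :
    wordProj X l (incl X l t) = incl X l t := by
  change incl X l ((incl X l t : FreeProd X) l) = _
  congr 1
  exact DirectSum.of_eq_same _ _

theorem wordProj_incl_of_ne {l l' : RWord ι} (h : l ≠ l') (t : word X l'.1) :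
    wordProj X l (incl X l' t) = 0 := by
  change incl X l ((incl X l' t : FreeProd X) l) = _
  rw [show (incl X l' t : FreeProd X) l = 0 from DirectSum.of_eq_of_ne _ _ _ h, map_zero]

theorem wordProj_inclCons_same (i : ι) (l : RWordAvoid i)
    (t : BTensor 𝕜 B (X i) (word X l.1)) :
    wordProj X l.cons (inclCons X i l t) = inclCons X i l t :=
  wordProj_incl_same X l.cons (consEquiv X i l.1 t)

theorem wordProj_inclCons_of_ne (i : ι) (l : RWordAvoid i) {l' : RWord ι} (h : l' ≠ l.cons)
    (t : BTensor 𝕜 B (X i) (word X l.1)) : wordProj X l' (inclCons X i l t) = 0 :=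
  wordProj_incl_of_ne X h (consEquiv X i l.1 t)

/-- In `ξ ⊗ w`, for a word `w` that does not start with `i`, the words `[]` and `[i]` occur only if
`w` is empty; so `P X i` reduces the second factor to its vacuum part. -/
theorem P_glue (i : ι) (ξ : B × X i) (n : FreeProdAvoid X i) :
    P X i (glue X i (BTensor.tmul 𝕜 B ξ n)) =
      glue X i (BTensor.tmul 𝕜 B ξ (projBL X (ofAvoid X i n) • vacAvoid X i)) := by
  induction n using FreeProdAvoid.induction with
  | h0 => simp [ofAvoid]
  | ha n n' h h' =>
    have : ofAvoid X i (n + n') = ofAvoid X i n + ofAvoid X i n' := by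
      simp [ofAvoid, BTensor.tmul_add]
    rw [BTensor.tmul_add, map_add, map_add, h, h', this, map_add, add_smul, BTensor.tmul_add,
      map_add]
  | ht l t =>
    rw [ofAvoid_inclAvoid, glue_tmul]
    obtain ⟨l, hl, hi⟩ := l
    cases l with
    | nil =>
      obtain ⟨t, rfl⟩ := (nilEquiv X).surjective t
      rw [show projBL X (incl X ⟨[], hl⟩ (nilEquiv X t)) = t from projB_incl_nil X t]
      have ht : t • vacAvoid X i =
          inclAvoid X i ⟨[], List.IsChain.nil, by simp⟩ (nilEquiv X t) := by
        rw [vacAvoid, ← inclAvoid_left, ← nilEquiv_left, smul_eq_mul, mul_one]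
      rw [ht, glue_tmul, map_add]
      congr 1
      · rw [P, LinearMap.add_apply, wordProj_incl_same,
          wordProj_incl_of_ne X (fun h => by simpa using congrArg Subtype.val h), add_zero]
      · rw [P, LinearMap.add_apply, wordProj_inclCons_of_ne X i _
          (fun h => by simpa [RWordAvoid.cons] using congrArg Subtype.val h), zero_add]
        exact wordProj_inclCons_same X i ⟨[], hl, hi⟩ _
    | cons j l =>
      rw [show projBL X (incl X ⟨j :: l, hl⟩ t) = 0 from
        projB_incl_of_ne X (l := ⟨j :: l, hl⟩) (by simp) t, zero_smul,
        BTensor.tmul_zero, map_zero]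
      have hj : j ≠ i := by simpa using hi
      rw [map_add, P, LinearMap.add_apply, LinearMap.add_apply]
      rw [wordProj_incl_of_ne X (fun h => by simpa using congrArg Subtype.val h),
        wordProj_incl_of_ne X (fun h => hj (by simpa using (congrArg Subtype.val h).symm :
          j = i ∧ l = []).1),
        wordProj_inclCons_of_ne X i _
          (fun h => by simpa [RWordAvoid.cons] using congrArg Subtype.val h),
        wordProj_inclCons_of_ne X i _
          (fun h => by simpa [RWordAvoid.cons] using congrArg Subtype.val h)]
      simp

/-- The projection applied last is redundant: after the first one the second factor is a multiple of
the vacuum, and `lam` does not touch it. -/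
theorem bet_glue (i : ι) (a : Module.End Bᵐᵒᵖ (B × X i)) (ξ : B × X i) (n : FreeProdAvoid X i) :
    bet X i a (glue X i (BTensor.tmul 𝕜 B ξ n)) =
      glue X i (BTensor.tmul 𝕜 B (a ξ) (projBL X (ofAvoid X i n) • vacAvoid X i)) := by
  have hv : projBL X (vac X) = 1 := projB_incl_nil X 1
  rw [bet, Module.End.mul_apply, Module.End.mul_apply, P_glue, lam_glue, P_glue, ofAvoid_left,
    map_smul, ofAvoid_vacAvoid, hv, smul_eq_mul, mul_one]

theorem lam_tensorAvoid (i : ι) (a : Module.End Bᵐᵒᵖ (B × X i)) (ξ : B × X i) (z : FreeProd X) :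
    lam X i a (tensorAvoid X i ξ z) = tensorAvoid X i (a ξ) z :=
  lam_glue X i a ξ _

theorem bet_tensorAvoid (i : ι) (a : Module.End Bᵐᵒᵖ (B × X i)) (ξ : B × X i) (z : FreeProd X) :
    bet X i a (tensorAvoid X i ξ z) = tensorAvoid X i (a ξ) (projBL X z • vac X) := by
  rw [tensorAvoid_apply, tensorAvoid_apply, bet_glue, projB_ofAvoid_avoidPart, avoidPart_left,
    avoidPart_vac]

section

variable {A : Type u} [Ring A] [Algebra 𝕜 A] {S : ProbSpace 𝕜 B A} (F : ι → FacePair S)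

/-- The elements of the faces. -/
abbrev Letter : Type (max u w) := Σ i, Σ f : Face, (F i).face f

variable (γ : ∀ i, (F i).C →ₐ[𝕜] Module.End Bᵐᵒᵖ (B × X i))
    (δ : ∀ i, (F i).D →ₙₐ[𝕜] Module.End Bᵐᵒᵖ (B × X i))

/-- The operator on `B ⊕ X i` that represents an element of a face. -/
def localRep (i : ι) : (f : Face) → (F i).face f → Module.End Bᵐᵒᵖ (B × X i)
  | Face.free, c => γ i ⟨c.1, c.2⟩
  | Face.boolean, d => δ i ⟨d.1, d.2⟩

/-- The operator on `B ⊕ X i` that represents a letter of the colour `i`. -/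
def letterAct (i : ι) (a : Letter F) : (B × X i) →+ (B × X i) :=
  -- The value `0` is a default: the rules of a system concern only the action of a letter on the
  -- space of its own colour.
  if h : a.1 = i then h ▸ (localRep X F γ δ a.1 a.2.1 a.2.2).toAddMonoidHom else 0

theorem letterAct_self (a : Letter F) (ξ : B × X a.1) :
    letterAct X F γ δ a.1 a ξ = localRep X F γ δ a.1 a.2.1 a.2.2 ξ := by
  rw [letterAct, dif_pos rfl]; rfl

theorem represent_free (a : Letter F) (h : a.2.1 = Face.free) (ξ : B × X a.1) (z : FreeProd X) :
    represent F X γ δ a.1 a.2.1 a.2.2 (tensorAvoid X a.1 ξ z) =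
      tensorAvoid X a.1 (letterAct X F γ δ a.1 a ξ) z := by
  rw [letterAct_self]
  obtain ⟨i, f, a⟩ := a
  obtain rfl : f = Face.free := h
  exact lam_tensorAvoid X i (γ i ⟨a.1, a.2⟩) ξ z

theorem represent_boolean (a : Letter F) (h : ¬ a.2.1 = Face.free) (ξ : B × X a.1)
    (z : FreeProd X) :
    represent F X γ δ a.1 a.2.1 a.2.2 (tensorAvoid X a.1 ξ z) =
      tensorAvoid X a.1 (letterAct X F γ δ a.1 a ξ) (projBL X z • vac X) := by
  rw [letterAct_self]
  obtain ⟨i, f, a⟩ := a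
  cases f with
  | free => exact absurd rfl h
  | boolean => exact bet_tensorAvoid X i (δ i ⟨a.1, a.2⟩) ξ z

/-- The system of the operators that represent the faces on the reduced free product. -/
def freeSystem : System B ι (Letter F) (fun i => B × X i) (FreeProd X) where
  col a := a.1
  fr a := a.2.1 = Face.free
  one _ := (1, 0)
  p i := LinearMap.fst B B (X i)
  vac := vac X
  P := projBL X
  mu := tensorAvoid X
  act := letterAct X F γ δ
  T a := (represent F X γ δ a.1 a.2.1 a.2.2).toAddMonoidHom
  P_vac := projB_incl_nil X 1
  mu_vac i b := by
    rw [tensorAvoid_one_left, tensorAvoid_one, avoidPart_vac, ofAvoid_vacAvoid]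
  P_mu i ξ z := by
    rw [tensorAvoid_apply, projB_glue, projB_ofAvoid_avoidPart]; rfl
  mu_one_mu i ξ z := by
    rw [tensorAvoid_one, tensorAvoid_one, tensorAvoid_apply, avoidPart_glue, contract_tmul,
      ofAvoid_left]; rfl
  mu_one_mu_of_ne i j ξ z hij := by
    rw [tensorAvoid_apply X j, glue_sub_tensorAvoid_one X hij, ofAvoid_sub_tensorAvoid_one X hij]
    rfl
  T_free a ξ z h := represent_free X F γ δ a h ξ z
  T_boolean a ξ z h := represent_boolean X F γ δ a h ξ z

theorem freeSystem_mom (L : List (Letter F)) :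
    (freeSystem X F γ δ).mom L =
      expect X (L.map fun a => represent F X γ δ a.1 a.2.1 a.2.2).prod := by
  have : ∀ L : List (Letter F), (freeSystem X F γ δ).vec L =
      (L.map fun a => represent F X γ δ a.1 a.2.1 a.2.2).prod (vac X) := by
    intro L
    induction L with
    | nil => rfl
    | cons a L ih =>
      rw [System.vec_cons, ih, List.map_cons, List.prod_cons]
      rfl
  rw [System.mom, this]
  rfl

end

end FreeProductSystem

/-! ### The cumulants of a probability space -/

noncomputable section ProbSystem

open scoped Classical

theorem blockSum_map {B α β M : Type*} [AddCommMonoid M] (E : List β → B) (good fr : β → Prop)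
    (g : α → β) (L : List α) (Θ : List (B × β) → List β → M) :
    blockSum E good fr (L.map g) Θ =
      blockSum (fun h => E (h.map g)) (fun x => good (g x)) (fun x => fr (g x)) L fun V r =>
        Θ (V.map fun e => (e.1, g e.2)) (r.map g) := by
  induction L using List.reverseRecOn generalizing Θ with
  | nil => rfl
  | append_singleton L v ih =>
    rw [List.map_append, List.map_singleton, blockSum_snoc, blockSum_snoc, ih]
    simp

variable {𝕜 : Type v} {B A : Type u} [CommRing 𝕜] [Ring B] [Algebra 𝕜 B] [Ring A] [Algebra 𝕜 A]
variable (S : ProbSpace 𝕜 B A)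

theorem ProbSpace.E_left (b : B) (a : A) : S.E (S.emb b * a) = b * S.E a := by
  simpa using S.E_bimod b a 1

theorem ProbSpace.E_right (a : A) (b : B) : S.E (a * S.emb b) = S.E a * b := by
  simpa using S.E_bimod 1 a b

theorem ProbSpace.E_emb (b : B) : S.E (S.emb b) = b := by
  simpa [S.E_one] using S.E_left b 1

/-- The algebra `A`, as a left `B`-module. -/
def ProbSpace.Carrier (_ : ProbSpace 𝕜 B A) : Type u := A

instance : AddCommGroup S.Carrier := inferInstanceAs (AddCommGroup A)

instance : Module B S.Carrier := Module.compHom A (S.emb : B →+* A)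

/-- The algebra `A`, acting on itself, as a system with one colour. -/
def ProbSpace.system : System B Unit (A × Face) (fun _ => S.Carrier) S.Carrier where
  col _ := ()
  fr a := a.2 = Face.free
  one _ := (1 : A)
  p _ := { toFun := fun x => S.E x, map_add' := S.E.map_add, map_smul' := S.E_left }
  vac := (1 : A)
  P := { toFun := fun x => S.E x, map_add' := S.E.map_add, map_smul' := S.E_left }
  -- With a single colour the free product is `B ⊕ X`, here `A` itself, and the only word that
  -- avoids the colour is the empty one; so the avoiding part of `z` is `E z`.
  mu _ :=
    { toFun := fun ξ : A => ((AddMonoidHom.mulLeft ξ).comp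
        ((S.emb : B →+ A).comp (S.E : A →+ B)) : A →+ A)
      map_add' := fun (ξ ξ' : A) => AddMonoidHom.ext fun z : A => add_mul ξ ξ' (S.emb (S.E z))
      map_smul' := fun b (ξ : A) => AddMonoidHom.ext fun z : A =>
        mul_assoc (S.emb b) ξ (S.emb (S.E z)) }
  act _ a := (AddMonoidHom.mulLeft a.1 : A →+ A)
  T a := (AddMonoidHom.mulLeft a.1 : A →+ A)
  P_vac := S.E_one
  mu_vac _ b := by
    change (1 : A) * S.emb (S.E (S.emb b * 1)) = S.emb b * 1
    rw [one_mul, mul_one, S.E_emb]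
  P_mu _ := fun (ξ z : A) => S.E_right ξ (S.E z)
  mu_one_mu _ := fun (ξ z : A) => by
    change (1 : A) * S.emb (S.E (ξ * S.emb (S.E z))) = S.emb (S.E ξ) * (1 * S.emb (S.E z))
    rw [one_mul, one_mul, S.E_right, map_mul]
  mu_one_mu_of_ne i j _ _ h := absurd (Subsingleton.elim i j) h
  T_free a := fun (ξ z : A) _ => (mul_assoc a.1 ξ (S.emb (S.E z))).symm
  -- Since `mu` only sees `E z`, passing to the vacuum part changes nothing. The face of an entry
  -- matters only through the gap condition.
  T_boolean a := fun (ξ z : A) _ => by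
    change a.1 * (ξ * S.emb (S.E z)) = a.1 * ξ * S.emb (S.E (S.emb (S.E z) * 1))
    rw [mul_one, S.E_emb, mul_assoc]

theorem ProbSpace.system_mom (L : List (A × Face)) :
    S.system.mom L = S.E (L.map Prod.fst).prod := by
  have : ∀ L : List (A × Face), S.system.vec L = (L.map Prod.fst).prod := by
    intro L
    induction L with
    | nil => rfl
    | cons a L ih => rw [System.vec_cons, ih, List.map_cons, List.prod_cons]; rfl
  rw [System.mom, this]
  rfl

/-- Multiply the coefficients of the entries into the entries. -/
def ProbSpace.absorb (e : B × (A × Face)) : A × Face := (S.emb e.1 * e.2.1, e.2.2)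

/-- The free-Boolean cumulant of the entries `x` and `W`. -/
def ProbSpace.kappa (x : A × Face) (W : List (A × Face)) : B :=
  S.system.cum () x (W.map fun y => (1, y))

theorem ProbSpace.absorb_one (y : A × Face) : S.absorb (1, y) = y := by
  simp [absorb]

/-- By associativity and the left `B`-linearity of `S.E`, a factor `b` in the first entry comes out
of every term of the recursion. This is special to `A`; for a general representation nothing of the
kind is known. -/
theorem ProbSpace.cumVec_absorb (V : List (B × (A × Face))) :
    S.system.cumVec () V = S.system.cumVec () (V.map fun e => (1, S.absorb e)) := by
  induction h : V.length using Nat.strong_induction_on generalizing V with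
  | _ n ih =>
  subst h
  cases V with
  | nil => rfl
  | cons e V =>
    obtain ⟨b, a⟩ := e
    have hact : ∀ W, S.system.act () (S.absorb (b, a)) W = b • S.system.act () a W :=
      fun W : A => mul_assoc (S.emb b) a.1 W
    have hcum : ∀ W, S.system.cum () (S.absorb (b, a)) W = b * S.system.cum () a W := fun W => by
      rw [System.cum, hact, map_smul]; rfl
    rw [List.map_cons, System.cumVec_cons, System.cumVec_cons, one_smul, smul_sub, smul_sub,
      hact, hcum, mul_smul, ← ih V.length (by simp) V rfl, Finset.smul_sum, List.length_map]
    have hc : ∀ W : List (B × (A × Face)), W.length < V.length + 1 →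
        S.system.cum () a W = S.system.cum () a (W.map fun e => (1, S.absorb e)) := fun W hW => by
      rw [System.cum, System.cum, ih W.length (by simpa using hW) W rfl]
    rw [← hc V (by simp)]
    congr 1
    refine Finset.sum_congr rfl fun k hk => ?_
    rw [← List.map_take, ← List.map_drop, smul_ite, smul_zero]
    refine if_congr ?_ ?_ rfl
    · simp only [List.mem_map, forall_exists_index, and_imp, forall_apply_eq_imp_iff₂]
      rfl
    · rw [hcum, mul_smul, ← hc _ (by simp),
        ← ih (V.drop k).length (by simp) _ rfl]

theorem ProbSpace.cum_eq_kappa (x : A × Face) (V : List (B × (A × Face))) :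
    S.system.cum () x V = S.kappa x (V.map S.absorb) := by
  rw [kappa, System.cum, S.cumVec_absorb, List.map_map]
  rfl

/-- `System.mom_cons` for one colour, where every letter is admitted to the block. Both directions
of the comparison play this off against the recursion in the free product. -/
theorem ProbSpace.system_mom_cons (x : A × Face) (L : List (A × Face)) :
    S.system.mom (x :: L) = blockSum S.system.mom (fun _ => True) (fun y => y.2 = Face.free) L
      fun V r => S.kappa x (V.map S.absorb) * S.system.mom r := by
  simp only [← S.cum_eq_kappa]
  exact (S.system.mom_cons x L).trans (congrArg (fun g => blockSum S.system.mom g _ L _)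
    (funext fun _ => eq_true rfl))

end ProbSystem

/-! ### Independence and vanishing cumulants -/

noncomputable section Comparison

open scoped Classical

variable {𝕜 : Type v} {B A : Type u} [CommRing 𝕜] [Ring B] [Algebra 𝕜 B] [Ring A] [Algebra 𝕜 A]
variable {S : ProbSpace 𝕜 B A} {ι : Type w} (F : ι → FacePair S)

/-- The element of `A` and the face of a letter. -/
def Letter.val {F : ι → FacePair S} (a : Letter F) : A × Face := (a.2.2.1, a.2.1)

/-- The mixed cumulants of letters vanish. -/
def MixedVanish : Prop :=
  ∀ (a : Letter F) (L : List (Letter F)), (∃ x ∈ L, x.1 ≠ a.1) →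
    S.kappa a.val (L.map Letter.val) = 0

/-- The letter `b a`. -/
def Letter.smul {F : ι → FacePair S} (b : B) (a : Letter F) : Letter F :=
  ⟨a.1, a.2.1, S.emb b * a.2.2.1, by
    obtain ⟨i, f, a, ha⟩ := a
    cases f with
    | free => exact (F i).left_mem_C b a ha
    | boolean => exact (F i).left_mem_D b a ha⟩

theorem Letter.val_smul {F : ι → FacePair S} (b : B) (a : Letter F) :
    (Letter.smul b a).val = S.absorb (b, a.val) := rfl

/-- The element `b` of the free face of colour `j`. -/
def scalarLetter (j : ι) (b : B) : Letter F :=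
  ⟨j, Face.free, S.emb b, show S.emb b ∈ (F j).C by
    simpa using (F j).left_mem_C b 1 (F j).C.one_mem⟩

/-- The word with the scalars written as letters of colour `j`. -/
def expand (j : ι) (V : List (B × Letter F)) : List (Letter F) :=
  V.flatMap fun e => [scalarLetter F j e.1, e.2]

/-! ### From equal moments to vanishing mixed cumulants -/

section Forward

variable {X : ι → Bimod.{u, v} 𝕜 B} {γ : ∀ i, (F i).C →ₐ[𝕜] Module.End Bᵐᵒᵖ (B × X i)}
    {δ : ∀ i, (F i).D →ₙₐ[𝕜] Module.End Bᵐᵒᵖ (B × X i)}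

/-- The scalar letters have the colour `j ≠ i` and are free, so they never enter a block and never
obstruct a gap. Each gap ends with the scalar in front of the chosen letter, which `hE` splits off
as a right factor. -/
theorem blockSum_expand {M : Type*} [AddCommMonoid M] (E : List (Letter F) → B) {i j : ι}
    (hij : j ≠ i)
    (hE : ∀ V b, E (expand F j V ++ [scalarLetter F j b]) = E (expand F j V) * b)
    (V : List (B × Letter F)) (Θ : List (B × Letter F) → List (Letter F) → M) :
    blockSum E (fun x => x.1 = i) (fun x => x.2.1 = Face.free) (expand F j V) Θ =
      blockSum (fun h => E (expand F j h)) (fun e => e.2.1 = i) (fun e => e.2.2.1 = Face.free) V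
        fun W r => Θ (W.map fun q => (q.1 * q.2.1, q.2.2)) (expand F j r) := by
  induction V using List.reverseRecOn generalizing Θ with
  | nil => rfl
  | append_singleton V e ih =>
    have h1 : ∀ (W : List (B × Letter F)), expand F j (W ++ [e]) =
        (expand F j W ++ [scalarLetter F j e.1]) ++ [e.2] := by
      intro W; simp [expand]
    rw [h1, blockSum_snoc, blockSum_snoc, ih, blockSum_snoc]
    congr 1
    funext W r
    rw [if_neg (fun h => hij h.1 : ¬ ((scalarLetter F j e.1).1 = i ∧ _)), add_zero, h1]
    congr 1
    have hfr : (∀ x ∈ expand F j r ++ [scalarLetter F j e.1], x.2.1 = Face.free) ↔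
        ∀ x ∈ r, x.2.2.1 = Face.free := by
      simp only [expand, List.mem_append, List.mem_flatMap, List.mem_cons, List.not_mem_nil,
        or_false]
      constructor
      · intro h x hx
        exact h x.2 (.inl ⟨x, hx, .inr rfl⟩)
      · rintro h x (⟨y, hy, rfl | rfl⟩ | rfl)
        · rfl
        · exact h y hy
        · rfl
    rw [hE, List.map_append]
    exact if_congr (and_congr Iff.rfl hfr) rfl rfl

theorem prod_expand (j : ι) (V : List (B × Letter F)) :
    (((expand F j V).map Letter.val).map Prod.fst).prod =
      ((V.map fun e => (Letter.smul e.1 e.2).val).map Prod.fst).prod := by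
  induction V with
  | nil => rfl
  | cons e V ih =>
    simp only [expand, List.flatMap_cons, List.map_append, List.prod_append] at ih ⊢
    rw [ih]
    simp only [List.map_cons, List.prod_cons, List.map_nil, List.prod_nil, mul_one]
    rfl

theorem mom_expand (j : ι) (V : List (B × Letter F)) :
    S.system.mom ((expand F j V).map Letter.val) =
      S.system.mom (V.map fun e => (Letter.smul e.1 e.2).val) := by
  rw [S.system_mom, S.system_mom, prod_expand]

/-- The maps `γ` and `δ` are not assumed to respect the action of `B`, so the coefficients in `V`
cannot be moved into the operators. They are inserted as letters of a second colour `j` instead,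
which are controlled by the moments. For the word so obtained the two recursions agree in all proper
subwords by induction, and hence also in the full one. -/
theorem cum_eq_kappa_of_moments
    (h : ∀ L, (freeSystem X F γ δ).mom L = S.system.mom (L.map Letter.val)) {i j : ι}
    (hij : j ≠ i) (a : Letter F) (ha : a.1 = i)
    (V : List (B × Letter F)) (hV : ∀ e ∈ V, e.2.1 = i) :
    (freeSystem X F γ δ).cum i a V =
      S.kappa a.val (V.map fun e => (Letter.smul e.1 e.2).val) := by
  induction hn : V.length using Nat.strong_induction_on generalizing V with
  | _ n ih =>
  subst hn
  set G := freeSystem X F γ δ with hG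
  have hE : ∀ V b, G.mom (expand F j V ++ [scalarLetter F j b]) = G.mom (expand F j V) * b := by
    intro V b
    rw [h, h, S.system_mom, S.system_mom, List.map_append, List.map_append, List.prod_append]
    simp only [List.map_cons, List.map_nil, List.prod_cons, List.prod_nil, mul_one]
    exact S.E_right _ b
  have h1 : G.mom (a :: expand F j V) =
      blockSum (fun h => G.mom (expand F j h)) (fun _ => True) (fun e => e.2.2.1 = Face.free) V
        fun W r => G.cum i a (W.map fun q => (q.1 * q.2.1, q.2.2)) * G.mom (expand F j r) := by
    subst ha
    rw [G.mom_cons]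
    refine (blockSum_expand F G.mom hij hE V _).trans ?_
    rw [blockSum_restrict]
    refine blockSum_congr _ _ _ _ fun W r _ hW _ _ => ?_
    rw [if_pos]
    · rfl
    · exact fun e he => hV _ (hW e he).2
  have h2 : G.mom (a :: expand F j V) =
      blockSum (fun h => G.mom (expand F j h)) (fun _ => True) (fun e => e.2.2.1 = Face.free) V
        fun W r => S.kappa a.val (W.map fun q => (Letter.smul (q.1 * q.2.1) q.2.2).val) *
          G.mom (expand F j r) := by
    have : G.mom (a :: expand F j V) =
        S.system.mom (a.val :: V.map fun e => (Letter.smul e.1 e.2).val) := by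
      rw [h, List.map_cons, S.system_mom, List.map_cons, List.prod_cons, prod_expand, S.system_mom]
      rfl
    rw [this, S.system_mom_cons, blockSum_map]
    simp only [← mom_expand F j, ← h]
    congr 1
    funext W r
    congr 2
    rw [List.map_map]
    refine List.map_congr_left fun q _ => ?_
    simp [Letter.val_smul, ProbSpace.absorb, mul_assoc]
  -- In the term of the full block every gap contains nothing but the inserted scalar, so exactly
  -- the given coefficients appear.
  rw [h1, blockSum_full _ _ (one := 1) (by simp [expand]), eq_comm,
    blockSum_full _ _ (one := 1) (by simp [expand])] at h2
  simp only [List.map_map] at h2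
  have h3 : (blockSum (fun h => G.mom (expand F j h)) (fun _ => True)
      (fun e => e.2.2.1 = Face.free) V fun W r => if W.length < V.length then
        G.cum i a (W.map fun q => (q.1 * q.2.1, q.2.2)) * G.mom (expand F j r) else 0) =
      blockSum (fun h => G.mom (expand F j h)) (fun _ => True) (fun e => e.2.2.1 = Face.free) V
        fun W r => if W.length < V.length then
          S.kappa a.val (W.map fun q => (Letter.smul (q.1 * q.2.1) q.2.2).val) *
          G.mom (expand F j r) else 0 := by
    refine blockSum_congr _ _ _ _ fun W r _ hW _ _ => ?_
    split_ifs with hlt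
    · rw [ih _ (by simpa using hlt) (W.map fun q => (q.1 * q.2.1, q.2.2)) _ rfl, List.map_map]
      · rfl
      · intro e he
        obtain ⟨q, hq, rfl⟩ := List.mem_map.1 he
        exact hV q.2 (hW q hq).2
    · rfl
  rw [h3] at h2
  have h4 := (add_right_cancel h2).symm
  simpa [expand, Function.comp_def] using h4

/-- The moment of `a :: L` is a sum over one-coloured blocks in the free product and over all blocks
in `A`. One-coloured terms agree and shorter mixed ones vanish by induction, which leaves the
cumulant of the whole word. -/
theorem mixedVanish_of_moments
    (h : ∀ L, (freeSystem X F γ δ).mom L = S.system.mom (L.map Letter.val)) : MixedVanish F := by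
  intro a L hL
  induction hn : L.length using Nat.strong_induction_on generalizing L with
  | _ n ih =>
  subst hn
  obtain ⟨x, hx, hxa⟩ := hL
  set G := freeSystem X F γ δ with hG
  have h1 : G.mom (a :: L) =
      blockSum G.mom (fun _ => True) (fun x => x.2.1 = Face.free) L fun V r =>
        if ∀ e ∈ V, e.2.1 = a.1 then
          S.kappa a.val (V.map fun e => (Letter.smul e.1 e.2).val) * G.mom r else 0 := by
    rw [G.mom_cons, blockSum_restrict]
    refine blockSum_congr _ _ _ _ fun V r _ _ _ _ => ?_
    refine if_ctx_congr Iff.rfl (fun hV => ?_) fun _ => rfl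
    -- The letter `x` supplies the second colour that carries the scalars.
    rw [← cum_eq_kappa_of_moments F h hxa a rfl V hV]
    rfl
  have h2 : G.mom (a :: L) =
      blockSum G.mom (fun _ => True) (fun x => x.2.1 = Face.free) L fun V r =>
          S.kappa a.val (V.map fun e => (Letter.smul e.1 e.2).val) * G.mom r := by
    rw [h, List.map_cons, S.system_mom_cons, blockSum_map]
    simp only [← h, List.map_map]
    rfl
  rw [h1, blockSum_full _ _ (one := 1) G.mom_nil, eq_comm,
    blockSum_full _ _ (one := 1) G.mom_nil, if_neg] at h2
  swap
  · intro H
    exact hxa (H (1, x) (List.mem_map_of_mem hx))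
  have h3 : (blockSum G.mom (fun _ => True) (fun x => x.2.1 = Face.free) L fun V r =>
      if V.length < L.length then if ∀ e ∈ V, e.2.1 = a.1 then
          S.kappa a.val (V.map fun e => (Letter.smul e.1 e.2).val) * G.mom r else 0 else 0) =
      blockSum G.mom (fun _ => True) (fun x => x.2.1 = Face.free) L fun V r =>
        if V.length < L.length then
          S.kappa a.val (V.map fun e => (Letter.smul e.1 e.2).val) * G.mom r else 0 := by
    refine blockSum_congr _ _ _ _ fun V r _ _ _ _ => ?_
    split_ifs with hl hV
    · rfl
    · push Not at hV
      obtain ⟨e, he, hea⟩ := hV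
      have := ih V.length hl (V.map fun e => Letter.smul e.1 e.2)
        ⟨Letter.smul e.1 e.2, List.mem_map_of_mem he, hea⟩ (by simp)
      rw [List.map_map] at this
      rw [show S.kappa a.val (V.map fun e => (Letter.smul e.1 e.2).val) = 0 from this, zero_mul]
    · rfl
  rw [h3] at h2
  have h4 := add_right_cancel h2
  simpa [Function.comp_def, Letter.val_smul, ProbSpace.absorb_one] using h4

end Forward

end Comparison

/-! ### The model on the kernel of the expectation -/

noncomputable section KernelModel

open scoped Classical

variable {𝕜 : Type v} {B A : Type u} [CommRing 𝕜] [Ring B] [Algebra 𝕜 B] [Ring A] [Algebra 𝕜 A]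
variable (S : ProbSpace 𝕜 B A)

/-- The kernel of the expectation. -/
abbrev ProbSpace.Ker : Type u := LinearMap.ker S.E

instance : SMul B S.Ker :=
  ⟨fun b x => ⟨S.emb b * x, by rw [LinearMap.mem_ker, S.E_left, LinearMap.mem_ker.1 x.2, mul_zero]⟩⟩

instance : SMul Bᵐᵒᵖ S.Ker :=
  ⟨fun b x => ⟨x * S.emb b.unop, by
    rw [LinearMap.mem_ker, S.E_right, LinearMap.mem_ker.1 x.2, zero_mul]⟩⟩

theorem ProbSpace.coe_left_smul (b : B) (x : S.Ker) : ((b • x : S.Ker) : A) = S.emb b * x := rfl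

theorem ProbSpace.coe_right_smul (b : Bᵐᵒᵖ) (x : S.Ker) :
    ((b • x : S.Ker) : A) = x * S.emb b.unop := rfl

instance : Module B S.Ker where
  one_smul x := Subtype.ext (by simp [S.coe_left_smul])
  mul_smul b c x := Subtype.ext (by simp [S.coe_left_smul, mul_assoc])
  smul_zero b := Subtype.ext (by simp [S.coe_left_smul])
  smul_add b x y := Subtype.ext (by simp [S.coe_left_smul, mul_add])
  add_smul b c x := Subtype.ext (by simp [S.coe_left_smul, add_mul])
  zero_smul x := Subtype.ext (by simp [S.coe_left_smul])

instance : Module Bᵐᵒᵖ S.Ker where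
  one_smul x := Subtype.ext (by simp [S.coe_right_smul])
  mul_smul b c x := Subtype.ext (by simp [S.coe_right_smul, mul_assoc])
  smul_zero b := Subtype.ext (by simp [S.coe_right_smul])
  smul_add b x y := Subtype.ext (by simp [S.coe_right_smul, add_mul])
  add_smul b c x := Subtype.ext (by simp [S.coe_right_smul, mul_add])
  zero_smul x := Subtype.ext (by simp [S.coe_right_smul])

instance : IsScalarTower 𝕜 B S.Ker where
  smul_assoc z b x := Subtype.ext (by simp [S.coe_left_smul])

instance : IsScalarTower 𝕜 Bᵐᵒᵖ S.Ker where
  smul_assoc z b x := Subtype.ext (by simp [S.coe_right_smul])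

instance : SMulCommClass B Bᵐᵒᵖ S.Ker where
  smul_comm b c x := Subtype.ext (by simp [S.coe_left_smul, S.coe_right_smul, mul_assoc])

/-- The kernel of the expectation, as a bimodule. -/
def ProbSpace.kerBimod : Bimod.{u, v} 𝕜 B := ⟨S.Ker⟩

/-- The decomposition of `A` as `B ⊕ ker E`. -/
def ProbSpace.toKer : A →+ B × S.kerBimod where
  toFun a := (S.E a, (⟨a - S.emb (S.E a), by
    rw [LinearMap.mem_ker, map_sub, S.E_emb, sub_self]⟩ : S.Ker))
  map_zero' := Prod.ext (by simp) (Subtype.ext (by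
    change (0 : A) - S.emb (S.E 0) = 0
    simp))
  map_add' a a' := Prod.ext (by simp) (Subtype.ext (by
    change a + a' - S.emb (S.E (a + a')) = (a - S.emb (S.E a)) + (a' - S.emb (S.E a'))
    rw [map_add, map_add]; abel))

/-- The sum map `B ⊕ ker E → A`. -/
def ProbSpace.ofKer : B × S.kerBimod →+ A where
  toFun y := S.emb y.1 + (show S.Ker from y.2).1
  map_zero' := by
    change S.emb 0 + (0 : A) = 0
    simp
  map_add' y y' := by
    change S.emb (y.1 + y'.1) + ((show S.Ker from y.2).1 + (show S.Ker from y'.2).1) = _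
    rw [map_add]; abel

theorem ProbSpace.ofKer_toKer (a : A) : S.ofKer (S.toKer a) = a :=
  add_sub_cancel (S.emb (S.E a)) a

theorem ProbSpace.E_ofKer (y : B × S.kerBimod) : S.E (S.ofKer y) = y.1 := by
  change S.E (S.emb y.1 + (show S.Ker from y.2).1) = y.1
  rw [map_add, S.E_emb, LinearMap.mem_ker.1 (show S.Ker from y.2).2, add_zero]

theorem ProbSpace.ofKer_injective : Function.Injective S.ofKer := by
  intro y y' h
  have h1 : y.1 = y'.1 := by rw [← S.E_ofKer, h, S.E_ofKer]
  refine Prod.ext h1 (Subtype.ext ?_)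
  change S.emb y.1 + (show S.Ker from y.2).1 = S.emb y'.1 + (show S.Ker from y'.2).1 at h
  rw [h1] at h
  exact add_left_cancel h

theorem ProbSpace.ofKer_right (b : Bᵐᵒᵖ) (y : B × S.kerBimod) :
    S.ofKer (b • y) = S.ofKer y * S.emb b.unop := by
  change S.emb (y.1 * b.unop) + (show S.Ker from y.2).1 * S.emb b.unop = _
  rw [map_mul, ← add_mul]
  rfl

theorem ProbSpace.ofKer_left (b : B) (y : B × S.kerBimod) :
    S.ofKer (b • y) = S.emb b * S.ofKer y := by
  change S.emb (b * y.1) + S.emb b * (show S.Ker from y.2).1 = _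
  rw [map_mul, ← mul_add]
  rfl

theorem ProbSpace.ofKer_base (z : 𝕜) (y : B × S.kerBimod) :
    S.ofKer (z • y) = z • S.ofKer y := by
  change S.emb (z • y.1) + z • (show S.Ker from y.2).1 = _
  rw [map_smul, ← smul_add]
  rfl

/-- Left multiplication on `A = B ⊕ ker E`. -/
def ProbSpace.mulKer : A →ₐ[𝕜] Module.End Bᵐᵒᵖ (B × S.kerBimod) :=
  AlgHom.ofLinearMap
    { toFun := fun a =>
        { toFun := fun y => S.toKer (a * S.ofKer y)
          map_add' := fun y y' => by rw [map_add, mul_add, map_add]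
          map_smul' := fun b y => S.ofKer_injective (by
            rw [RingHom.id_apply, S.ofKer_toKer, S.ofKer_right, S.ofKer_right, S.ofKer_toKer,
              mul_assoc]) }
      map_add' := fun a a' => LinearMap.ext fun y => S.ofKer_injective (by
        rw [LinearMap.add_apply, map_add]
        change S.ofKer (S.toKer _) = S.ofKer (S.toKer _) + S.ofKer (S.toKer _)
        rw [S.ofKer_toKer, S.ofKer_toKer, S.ofKer_toKer, add_mul])
      map_smul' := fun z a => LinearMap.ext fun y => S.ofKer_injective (by
        rw [LinearMap.smul_apply, RingHom.id_apply, S.ofKer_base]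
        change S.ofKer (S.toKer _) = z • S.ofKer (S.toKer _)
        rw [S.ofKer_toKer, S.ofKer_toKer, smul_mul_assoc]) }
    (LinearMap.ext fun y => S.ofKer_injective (by
      change S.ofKer (S.toKer _) = S.ofKer y
      rw [S.ofKer_toKer, one_mul]))
    (fun a a' => LinearMap.ext fun y => S.ofKer_injective (by
      change S.ofKer (S.toKer _) = S.ofKer (S.toKer (a * S.ofKer (S.toKer _)))
      rw [S.ofKer_toKer, S.ofKer_toKer, S.ofKer_toKer, mul_assoc]))

theorem ProbSpace.ofKer_mulKer (a : A) (y : B × S.kerBimod) :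
    S.ofKer (S.mulKer a y) = a * S.ofKer y :=
  S.ofKer_toKer _

variable {S} {ι : Type w} (F : ι → FacePair S)

/-- The free faces act on `B ⊕ ker E` by multiplication. -/
def kerFree (i : ι) : (F i).C →ₐ[𝕜] Module.End Bᵐᵒᵖ (B × S.kerBimod) :=
  S.mulKer.comp (F i).C.val

/-- The Boolean faces act on `B ⊕ ker E` by multiplication. -/
def kerBoolean (i : ι) : (F i).D →ₙₐ[𝕜] Module.End Bᵐᵒᵖ (B × S.kerBimod) :=
  (S.mulKer : A →ₙₐ[𝕜] Module.End Bᵐᵒᵖ (B × S.kerBimod)).comp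
    (NonUnitalSubalgebraClass.subtype (F i).D)

/-- The system of the multiplication operators. -/
abbrev kerSystem : System B ι (Letter F) (fun _ => B × S.kerBimod)
    (FreeProd fun _ : ι => S.kerBimod) :=
  freeSystem (fun _ => S.kerBimod) F (kerFree F) (kerBoolean F)

theorem ofKer_act (a : Letter F) (y : B × S.kerBimod) :
    S.ofKer ((kerSystem F).act a.1 a y) = a.val.1 * S.ofKer y := by
  have := letterAct_self (fun _ => S.kerBimod) F (kerFree F) (kerBoolean F) a y
  change S.ofKer (letterAct _ F (kerFree F) (kerBoolean F) a.1 a y) = _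
  rw [this]
  obtain ⟨i, f, a⟩ := a
  cases f <;> exact S.ofKer_mulKer _ _

/-- `S.ofKer` turns the action of a letter of colour `i` into multiplication in `A`, so both sides
satisfy the same recursion. -/
theorem ofKer_cumVec (i : ι) (V : List (B × Letter F)) (hV : ∀ e ∈ V, e.2.1 = i) :
    S.ofKer ((kerSystem F).cumVec i V) =
      S.system.cumVec () (V.map fun e => (e.1, e.2.val)) := by
  induction hn : V.length using Nat.strong_induction_on generalizing V with
  | _ n ih =>
  subst hn
  cases V with
  | nil =>
    rw [System.cumVec_nil, List.map_nil, System.cumVec_nil]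
    change S.emb 1 + (0 : A) = (1 : A)
    simp
  | cons e V =>
    obtain ⟨b, a⟩ := e
    have ha : a.1 = i := hV (b, a) (by simp)
    subst ha
    have hact : ∀ W : List (B × Letter F), (∀ e ∈ W, e.2.1 = a.1) → W.length < V.length + 1 →
        S.ofKer ((kerSystem F).act a.1 a ((kerSystem F).cumVec a.1 W)) =
          S.system.act () a.val (S.system.cumVec () (W.map fun e => (e.1, e.2.val))) := by
      intro W hW hl
      rw [ofKer_act, ih W.length (by simpa using hl) W hW rfl]
      rfl
    have hcum : ∀ W : List (B × Letter F), (∀ e ∈ W, e.2.1 = a.1) → W.length < V.length + 1 →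
        (kerSystem F).cum a.1 a W =
          S.system.cum () a.val (W.map fun e => (e.1, e.2.val)) := by
      intro W hW hl
      rw [System.cum, System.cum, ← hact W hW hl]
      exact (S.E_ofKer _).symm
    have hV' : ∀ e ∈ V, e.2.1 = a.1 := fun e he => hV e (List.mem_cons_of_mem _ he)
    rw [List.map_cons, System.cumVec_cons, System.cumVec_cons, S.ofKer_left, map_sub, map_sub,
      hact V hV' (by simp), hcum V hV' (by simp), map_sum]
    have hone : ∀ c : B, S.ofKer (c • (kerSystem F).one a.1) = c • S.system.one () := by
      intro c
      rw [S.ofKer_left]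
      change S.emb c * (S.emb 1 + (0 : A)) = S.emb c * 1
      simp
    rw [hone, List.length_map]
    refine congrArg (fun x : A => S.emb b * x) ?_
    refine congrArg₂ (fun x y : A => x - y) rfl ?_
    refine Finset.sum_congr rfl fun k hk => ?_
    rw [apply_ite S.ofKer, map_zero, ← List.map_take, ← List.map_drop]
    refine if_congr ?_ ?_ rfl
    · simp only [List.mem_map, forall_exists_index, and_imp, forall_apply_eq_imp_iff₂]
      rfl
    · rw [S.ofKer_left, ih (V.drop k).length (by simp) _
        (fun e he => hV' e (List.mem_of_mem_drop he)) rfl,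
        hcum _ (fun e he => hV' e (List.mem_of_mem_take he)) (by simp)]
      rfl

theorem kerSystem_cum (a : Letter F) (V : List (B × Letter F)) (hV : ∀ e ∈ V, e.2.1 = a.1) :
    (kerSystem F).cum a.1 a V =
      S.kappa a.val (V.map fun e => (Letter.smul e.1 e.2).val) := by
  have := S.cum_eq_kappa a.val (V.map fun e => (e.1, e.2.val))
  rw [List.map_map] at this
  refine Eq.trans ?_ this
  rw [System.cum, System.cum, ← ofKer_cumVec F a.1 V hV]
  exact (S.E_ofKer _).symm.trans (congrArg S.E (ofKer_act F a _))

/-- Gaps and remainders agree by induction. Blocks with a letter of another colour than `a` are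
absent on one side and contribute zero on the other by `h`. -/
theorem kerSystem_mom (h : MixedVanish F) (L : List (Letter F)) :
    (kerSystem F).mom L = S.system.mom (L.map Letter.val) := by
  induction hn : L.length using Nat.strong_induction_on generalizing L with
  | _ n ih =>
  subst hn
  cases L with
  | nil => rw [List.map_nil, System.mom_nil, System.mom_nil]
  | cons a L =>
    rw [System.mom_cons, List.map_cons, S.system_mom_cons, blockSum_map]
    refine (blockSum_congr' (E' := fun h => S.system.mom (h.map Letter.val)) (Θ' := fun V r =>
      S.kappa a.val (V.map fun e => (Letter.smul e.1 e.2).val) * S.system.mom (r.map Letter.val))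
      _ _ L (fun g hg => ih g.length (by simp; omega) g rfl)
      fun V r hl hV _ _ => ?_).trans ?_
    · rw [ih r.length (by simp; omega) r rfl, ← kerSystem_cum F a V fun e he => (hV e he).1]
      rfl
    · rw [blockSum_restrict]
      refine blockSum_congr _ _ _ _ fun V r _ _ _ _ => ?_
      rw [List.map_map]
      split_ifs with hV
      · rfl
      · rw [eq_comm]
        push Not at hV
        obtain ⟨e, he, hea⟩ := hV
        have := h a (V.map fun e => Letter.smul e.1 e.2)
          ⟨Letter.smul e.1 e.2, List.mem_map_of_mem he, hea⟩
        rw [List.map_map] at this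
        exact (congrArg (· * _) this).trans (zero_mul _)

theorem ofFn_comp_get {α β : Type*} (L : List α) (f : α → β) :
    (List.ofFn fun k => f (L.get k)) = L.map f := by
  conv_rhs => rw [← List.ofFn_get L, List.map_ofFn]
  rfl

/-- Free-Boolean independence is the vanishing of the mixed cumulants of letters. -/
theorem freeBooleanIndep_iff_mixedVanish : FreeBooleanIndep F ↔ MixedVanish F := by
  have key : ∀ (X : ι → Bimod.{u, v} 𝕜 B) (γ : ∀ i, (F i).C →ₐ[𝕜] Module.End Bᵐᵒᵖ (B × X i))
      (δ : ∀ i, (F i).D →ₙₐ[𝕜] Module.End Bᵐᵒᵖ (B × X i)),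
      (∀ (n : ℕ) (ω : Fin n → ι) (χ : Fin n → Face) (a : ∀ k, (F (ω k)).face (χ k)),
        expect X (List.ofFn fun k => represent F X γ δ (ω k) (χ k) (a k)).prod =
          S.E (List.ofFn fun k => (a k : A)).prod) ↔
      ∀ L, (freeSystem X F γ δ).mom L = S.system.mom (L.map Letter.val) := by
    intro X γ δ
    constructor
    · intro h L
      have := h L.length (fun k => (L.get k).1) (fun k => (L.get k).2.1) (fun k => (L.get k).2.2)
      rw [freeSystem_mom, S.system_mom, List.map_map]
      have e1 := ofFn_comp_get L fun a => represent F X γ δ a.1 a.2.1 a.2.2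
      have e2 := ofFn_comp_get L fun a => (a.2.2 : A)
      rw [e1, e2] at this
      exact this
    · intro h n ω χ a
      have := h (List.ofFn fun k => ⟨ω k, χ k, a k⟩)
      rw [freeSystem_mom, S.system_mom, List.map_map, List.map_ofFn, List.map_ofFn] at this
      exact this
  constructor
  · rintro ⟨X, γ, δ, h⟩
    exact mixedVanish_of_moments F ((key X γ δ).1 h)
  · intro h
    -- The kernel of the expectation serves as the bimodule of every colour.
    exact ⟨_, _, _, (key _ _ _).2 (kerSystem_mom F h)⟩

end KernelModel

/-! ### Expanding a block sum from the left -/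

noncomputable section LeftExpansion

open scoped Classical

variable {B α M : Type*} [AddCommMonoid M]

/-- The part of the block sum of `g ++ L` in which no letter of the subword belongs to `g`,
expanded along the first letter of the subword. -/
def blockSumFrom (E : List α → B) (good fr : α → Prop) :
    List α → List α → (List (B × α) → List α → M) → M
  | g, [], Θ => Θ [] g
  | g, v :: L, Θ => blockSumFrom E good fr (g ++ [v]) L Θ +
      if good v ∧ ∀ x ∈ g, fr x then blockSum E good fr L fun V r => Θ ((E g, v) :: V) r else 0

theorem blockSumFrom_snoc (E : List α → B) (good fr : α → Prop) (g L : List α) (v : α)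
    (Θ : List (B × α) → List α → M) :
    blockSumFrom E good fr g (L ++ [v]) Θ = blockSumFrom E good fr g L fun V h =>
      Θ V (h ++ [v]) + if good v ∧ ∀ x ∈ h, fr x then Θ (V ++ [(E h, v)]) [] else 0 := by
  induction L generalizing g with
  | nil => simp [blockSumFrom]
  | cons u L ih =>
    rw [List.cons_append, blockSumFrom, blockSumFrom, ih, blockSum_snoc]
    rfl

/-- `blockSum` is built from the right, whereas a partition is explored from the left, by the next
element of its first block; `sum_cumExt_cons` needs the second description. -/
theorem blockSum_eq_blockSumFrom (E : List α → B) (good fr : α → Prop) (L : List α)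
    (Θ : List (B × α) → List α → M) :
    blockSum E good fr L Θ = blockSumFrom E good fr [] L Θ := by
  induction L using List.reverseRecOn generalizing Θ with
  | nil => rfl
  | append_singleton L v ih => rw [blockSum_snoc, blockSumFrom_snoc, ih]

end LeftExpansion

/-! ### Additivity of the cumulants -/

noncomputable section CumulantLinear

open scoped Classical

variable {𝕜 : Type v} {B A : Type u} [CommRing 𝕜] [Ring B] [Algebra 𝕜 B] [Ring A] [Algebra 𝕜 A]
variable (S : ProbSpace 𝕜 B A)

/-- The vector-valued cumulant of the entries `W`. -/
def ProbSpace.kappaVec (W : List (A × Face)) : A := S.system.cumVec () (W.map fun y => (1, y))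

theorem ProbSpace.kappa_eq (x : A × Face) (W : List (A × Face)) :
    S.kappa x W = S.E (x.1 * S.kappaVec W) := rfl

theorem ProbSpace.kappaVec_cons (x : A × Face) (W : List (A × Face)) :
    S.kappaVec (x :: W) = x.1 * S.kappaVec W - S.emb (S.kappa x W) -
      ∑ k ∈ Finset.range W.length, if x.2 = Face.free ∧ ∀ y ∈ W.take k, y.2 = Face.free then
        S.emb (S.kappa x (W.take k)) * S.kappaVec (W.drop k) else 0 := by
  refine (S.system.cumVec_cons () 1 x _).trans ?_
  rw [one_smul]
  refine congrArg₂ (fun a b : A => a - b) ?_ ?_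
  · exact congrArg (fun b : A => x.1 * S.kappaVec W - b) (mul_one _)
  · rw [List.length_map]
    refine Finset.sum_congr rfl fun k _ => ?_
    rw [← List.map_take, ← List.map_drop]
    refine if_congr ?_ rfl rfl
    simp only [List.mem_map, forall_exists_index, and_imp, forall_apply_eq_imp_iff₂]
    rfl

theorem ProbSpace.kappa_add_head (x y : A) (f : Face) (W : List (A × Face)) :
    S.kappa (x + y, f) W = S.kappa (x, f) W + S.kappa (y, f) W := by
  simp only [kappa_eq, add_mul, map_add]

theorem ProbSpace.kappa_smul_head (b : B) (x : A) (f : Face) (W : List (A × Face)) :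
    S.kappa (S.emb b * x, f) W = b * S.kappa (x, f) W := by
  simp only [kappa_eq, mul_assoc, S.E_left]

/-- Induction on the length: in each term of the recursion exactly one factor contains the entry in
question. -/
theorem ProbSpace.kappaVec_add (x y : A) (f : Face) (p q : List (A × Face)) :
    S.kappaVec (p ++ (x + y, f) :: q) =
      S.kappaVec (p ++ (x, f) :: q) + S.kappaVec (p ++ (y, f) :: q) := by
  induction hn : p.length + q.length using Nat.strong_induction_on generalizing p q with
  | _ n ih =>
  subst hn
  cases p with
  | nil =>
    simp only [List.nil_append, kappaVec_cons, kappa_add_head, add_mul, map_add]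
    have : ∀ u v : ℕ → A, (∑ k ∈ Finset.range q.length,
        if f = Face.free ∧ ∀ y ∈ q.take k, y.2 = Face.free then u k + v k else 0) =
        (∑ k ∈ Finset.range q.length,
          if f = Face.free ∧ ∀ y ∈ q.take k, y.2 = Face.free then u k else 0) +
        ∑ k ∈ Finset.range q.length,
          if f = Face.free ∧ ∀ y ∈ q.take k, y.2 = Face.free then v k else 0 := by
      intro u v
      rw [← Finset.sum_add_distrib]
      refine Finset.sum_congr rfl fun k _ => ?_
      split_ifs <;> simp
    rw [this]
    abel
  | cons z p =>
    have hV : ∀ p' q' : List (A × Face), p'.length + q'.length < p.length + 1 + q.length →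
        S.kappaVec (p' ++ (x + y, f) :: q') =
          S.kappaVec (p' ++ (x, f) :: q') + S.kappaVec (p' ++ (y, f) :: q') :=
      fun p' q' h => ih _ (by simpa using h) p' q' rfl
    have hK : ∀ p' q' : List (A × Face), p'.length + q'.length < p.length + 1 + q.length →
        S.kappa z (p' ++ (x + y, f) :: q') =
          S.kappa z (p' ++ (x, f) :: q') + S.kappa z (p' ++ (y, f) :: q') := fun p' q' h => by
      simp only [kappa_eq, hV p' q' h, mul_add, map_add]
    simp only [List.cons_append, kappaVec_cons]
    rw [hV p q (by omega), hK p q (by omega)]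
    have hs : ∀ w : A, (p ++ (w, f) :: q).length = p.length + 1 + q.length := by
      intro w; simp; omega
    simp only [hs]
    have : ∀ k, (if z.2 = Face.free ∧ ∀ w ∈ (p ++ (x + y, f) :: q).take k, w.2 = Face.free then
          S.emb (S.kappa z ((p ++ (x + y, f) :: q).take k)) *
            S.kappaVec ((p ++ (x + y, f) :: q).drop k) else 0) =
        (if z.2 = Face.free ∧ ∀ w ∈ (p ++ (x, f) :: q).take k, w.2 = Face.free then
          S.emb (S.kappa z ((p ++ (x, f) :: q).take k)) *
            S.kappaVec ((p ++ (x, f) :: q).drop k) else 0) +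
        (if z.2 = Face.free ∧ ∀ w ∈ (p ++ (y, f) :: q).take k, w.2 = Face.free then
          S.emb (S.kappa z ((p ++ (y, f) :: q).take k)) *
            S.kappaVec ((p ++ (y, f) :: q).drop k) else 0) := by
      intro k
      -- The changed entry is among the first `k`, or it belongs to the rest.
      rcases Nat.lt_or_ge p.length k with hk | hk
      · obtain ⟨j, rfl⟩ : ∃ j, k = p.length + (j + 1) := ⟨k - p.length - 1, by omega⟩
        have hfr : ∀ w : A, (z.2 = Face.free ∧
            ∀ u ∈ (p ++ (w, f) :: q).take (p.length + (j + 1)), u.2 = Face.free) ↔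
            (z.2 = Face.free ∧ (∀ u ∈ p, u.2 = Face.free) ∧ f = Face.free ∧
              ∀ u ∈ q.take j, u.2 = Face.free) := by
          intro w
          rw [List.take_length_add_append, List.take_succ_cons]
          simp only [List.mem_append, List.mem_cons, or_imp, forall_and, forall_eq]
        simp only [hfr]
        simp only [List.take_length_add_append, List.drop_length_add_append, List.take_succ_cons,
          List.drop_succ_cons]
        split_ifs
        -- The identity is claimed for every `k`, also beyond the range of summation, where `take`
        -- returns the whole list.
        · by_cases hj : j < q.length
          · rw [hK p (q.take j) (by simp; omega), map_add, add_mul]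
          · rw [List.take_of_length_le (by omega), hK p q (by omega), map_add, add_mul]
        · simp
      · simp only [List.take_append_of_le_length hk, List.drop_append_of_le_length hk]
        split_ifs
        · rw [hV _ _ (by simp), mul_add]
        · simp
    simp only [this, Finset.sum_add_distrib]
    rw [mul_add, map_add]
    abel

/-- The cumulant of a nonempty list of entries. -/
def ProbSpace.kappaList : List (A × Face) → B
  | [] => 1
  | x :: W => S.kappa x W

theorem ProbSpace.kappaList_add (x y : A) (f : Face) (p q : List (A × Face)) :
    S.kappaList (p ++ (x + y, f) :: q) =
      S.kappaList (p ++ (x, f) :: q) + S.kappaList (p ++ (y, f) :: q) := by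
  cases p with
  | nil => exact S.kappa_add_head x y f q
  | cons z p =>
    simp only [List.cons_append, kappaList]
    rw [kappa_eq, kappa_eq, kappa_eq, kappaVec_add, mul_add, map_add]

theorem ProbSpace.kappaList_smul (b : B) (x : A) (f : Face) (q : List (A × Face)) :
    S.kappaList ((S.emb b * x, f) :: q) = b * S.kappaList ((x, f) :: q) :=
  S.kappa_smul_head b x f q

end CumulantLinear

/-! ### The multiplicative extension of the cumulants -/

noncomputable section Extension

open scoped Classical

variable {𝕜 : Type v} {B A : Type u} [CommRing 𝕜] [Ring B] [Algebra 𝕜 B] [Ring A] [Algebra 𝕜 A]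
variable (S : ProbSpace 𝕜 B A) {J : Type*} (χ : J → Face) (σ : Setoid J)

/-- The cumulant `κ_σ` of a partition `σ` of the indices of the entries of a list. The entries in
front of the list that belong to the block of its first entry are collected in `acc`, and the value
of a gap between two consecutive entries of a block is multiplied into the second one. -/
def ProbSpace.cumExt : List (J × A) → List (A × Face) → B
  | [], _ => 1
  | e :: L, acc =>
    match _h : L.dropWhile (fun x => ¬ σ e.1 x.1) with
    | [] => S.kappaList (acc ++ [(e.2, χ e.1)]) * cumExt L []
    | e' :: L' => cumExt
        ((e'.1, S.emb (cumExt (L.takeWhile fun x => ¬ σ e.1 x.1) []) * e'.2) :: L')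
        (acc ++ [(e.2, χ e.1)])
termination_by L => L.length
decreasing_by
  · simp
  · exact Nat.lt_succ_of_le (List.takeWhile_prefix _).length_le
  · have := (List.dropWhile_suffix (l := L) fun x => ¬ σ e.1 x.1).length_le
    rw [_h] at this
    simp at this ⊢
    omega

@[simp]
theorem ProbSpace.cumExt_nil (acc : List (A × Face)) : S.cumExt χ σ [] acc = 1 := by rw [cumExt]

theorem ProbSpace.cumExt_last (e : J × A) {L : List (J × A)} (acc : List (A × Face))
    (h : ∀ x ∈ L, ¬ σ e.1 x.1) :
    S.cumExt χ σ (e :: L) acc = S.kappaList (acc ++ [(e.2, χ e.1)]) * S.cumExt χ σ L [] := by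
  have h1 : L.dropWhile (fun x => ¬ σ e.1 x.1) = [] := by
    rw [List.dropWhile_eq_nil_iff]; simpa using h
  rw [cumExt]
  split
  · rfl
  · rename_i h2; rw [h1] at h2; cases h2

theorem ProbSpace.cumExt_next (e e' : J × A) {g : List (J × A)} (L : List (J × A))
    (acc : List (A × Face)) (h : ∀ x ∈ g, ¬ σ e.1 x.1) (h' : σ e.1 e'.1) :
    S.cumExt χ σ (e :: (g ++ e' :: L)) acc =
      S.cumExt χ σ ((e'.1, S.emb (S.cumExt χ σ g []) * e'.2) :: L) (acc ++ [(e.2, χ e.1)]) := by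
  have h1 : (g ++ e' :: L).dropWhile (fun x => ¬ σ e.1 x.1) = e' :: L := by
    rw [List.dropWhile_append_of_pos (by simpa using h),
      List.dropWhile_cons_of_neg (by simpa using h')]
  have h2 : (g ++ e' :: L).takeWhile (fun x => ¬ σ e.1 x.1) = g := by
    rw [List.takeWhile_append_of_pos (by simpa using h),
      List.takeWhile_cons_of_neg (by simpa using h')]
    simp
  rw [cumExt]
  split
  · rename_i h3; rw [h1] at h3; cases h3
  · rename_i h3
    rw [h1] at h3
    cases h3
    rw [h2]

/-- The first entry of a list in the block of a given index. -/
theorem exists_next (m : J) (L : List (J × A)) : (∀ x ∈ L, ¬ σ m x.1) ∨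
    ∃ g e L', L = g ++ e :: L' ∧ (∀ x ∈ g, ¬ σ m x.1) ∧ σ m e.1 := by
  induction L with
  | nil => left; simp
  | cons e L ih =>
    by_cases h : σ m e.1
    · exact .inr ⟨[], e, L, rfl, by simp, h⟩
    · rcases ih with ih | ⟨g, e', L', rfl, hg, he⟩
      · exact .inl (by simpa using ⟨h, by simpa using ih⟩)
      · exact .inr ⟨e :: g, e', L', rfl, by simpa using ⟨h, by simpa using hg⟩, he⟩

/-- Used to replace a partition by its restrictions to a gap and to what remains. -/
theorem ProbSpace.cumExt_congr {σ σ' : Setoid J} (L : List (J × A)) (acc : List (A × Face))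
    (h : ∀ x ∈ L, ∀ y ∈ L, σ x.1 y.1 ↔ σ' x.1 y.1) :
    S.cumExt χ σ L acc = S.cumExt χ σ' L acc := by
  induction hn : L.length using Nat.strong_induction_on generalizing L acc with
  | _ n ih =>
  subst hn
  cases L with
  | nil => simp
  | cons e L =>
    have he : ∀ x ∈ L, σ e.1 x.1 ↔ σ' e.1 x.1 := fun x hx => h e (by simp) x (by simp [hx])
    rcases exists_next σ e.1 L with hL | ⟨g, e', L', rfl, hg, he'⟩
    · rw [S.cumExt_last χ σ e acc hL, S.cumExt_last χ σ' e acc fun x hx => by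
        rw [← he x hx]; exact hL x hx]
      rw [ih L.length (by simp) L [] (fun x hx y hy => h x (by simp [hx]) y (by simp [hy])) rfl]
    · rw [S.cumExt_next χ σ e e' L' acc hg he', S.cumExt_next χ σ' e e' L' acc
        (fun x hx => by rw [← he x (by simp [hx])]; exact hg x hx) ((he e' (by simp)).1 he')]
      rw [ih g.length (by simp) g []
        (fun x hx y hy => h x (by simp [hx]) y (by simp [hy])) rfl]
      refine ih _ ?_ _ _ ?_ rfl
      · simp
      · intro x hx y hy
        simp only [List.mem_cons] at hx hy
        rcases hx with rfl | hx <;> rcases hy with rfl | hy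
        · exact h e' (by simp) e' (by simp)
        · exact h e' (by simp) y (by simp [hy])
        · exact h x (by simp [hx]) e' (by simp)
        · exact h x (by simp [hx]) y (by simp [hy])

/-- Additivity in a collected entry. -/
theorem ProbSpace.cumExt_add_acc (x y : A) (f : Face) (p q : List (A × Face)) (L : List (J × A))
    (hL : L ≠ []) :
    S.cumExt χ σ L (p ++ (x + y, f) :: q) =
      S.cumExt χ σ L (p ++ (x, f) :: q) + S.cumExt χ σ L (p ++ (y, f) :: q) := by
  induction hn : L.length using Nat.strong_induction_on generalizing L q with
  | _ n ih =>
  subst hn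
  cases L with
  | nil => exact absurd rfl hL
  | cons e L =>
    rcases exists_next σ e.1 L with hL | ⟨g, e', L', rfl, hg, he'⟩
    · simp only [S.cumExt_last χ σ e _ hL, List.append_assoc, List.cons_append, kappaList_add,
        add_mul]
    · simp only [S.cumExt_next χ σ e e' L' _ hg he', List.append_assoc, List.cons_append]
      exact ih _ (by simp) _ _ (by simp) rfl

theorem ProbSpace.cumExt_add_head (j : J) (x y : A) (q : List (J × A)) (acc : List (A × Face)) :
    S.cumExt χ σ ((j, x + y) :: q) acc =
      S.cumExt χ σ ((j, x) :: q) acc + S.cumExt χ σ ((j, y) :: q) acc := by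
  rcases exists_next σ j q with hL | ⟨g, e', L', rfl, hg, he'⟩
  · simp only [S.cumExt_last χ σ (j, _) _ hL, kappaList_add, add_mul]
  · simp only [S.cumExt_next χ σ (j, _) e' L' _ hg he']
    exact S.cumExt_add_acc χ σ x y _ acc [] _ (by simp)

/-- Additivity in an entry of the list. -/
theorem ProbSpace.cumExt_add (j : J) (x y : A) (p q : List (J × A)) (acc : List (A × Face)) :
    S.cumExt χ σ (p ++ (j, x + y) :: q) acc =
      S.cumExt χ σ (p ++ (j, x) :: q) acc + S.cumExt χ σ (p ++ (j, y) :: q) acc := by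
  induction hn : p.length + q.length using Nat.strong_induction_on generalizing p q acc with
  | _ n ih =>
  subst hn
  cases p with
  | nil => exact S.cumExt_add_head χ σ j x y q acc
  | cons e p =>
    simp only [List.cons_append]
    rcases exists_next σ e.1 p with hp | ⟨g, e', p', rfl, hg, he'⟩
    · by_cases hj : σ e.1 j
      · simp only [S.cumExt_next χ σ e (j, _) q acc hp hj, mul_add]
        exact S.cumExt_add_head χ σ j _ _ q _
      · rcases exists_next σ e.1 q with hq | ⟨g, e', q', rfl, hg, he'⟩
        · have hl : ∀ z : A, ∀ x ∈ p ++ (j, z) :: q, ¬ σ e.1 x.1 := by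
            intro z x hx
            simp only [List.mem_append, List.mem_cons] at hx
            rcases hx with hx | rfl | hx
            · exact hp x hx
            · exact hj
            · exact hq x hx
          rw [S.cumExt_last χ σ e acc (hl _), S.cumExt_last χ σ e acc (hl _),
            S.cumExt_last χ σ e acc (hl _), ih _ (by simp) p q [] rfl, mul_add]
        · have hl : ∀ z : A, ∀ x ∈ p ++ (j, z) :: g, ¬ σ e.1 x.1 := by
            intro z x hx
            simp only [List.mem_append, List.mem_cons] at hx
            rcases hx with hx | rfl | hx
            · exact hp x hx
            · exact hj
            · exact hg x hx
          have hs : ∀ z : A, p ++ (j, z) :: (g ++ e' :: q') = (p ++ (j, z) :: g) ++ e' :: q' := by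
            intro z; simp
          simp only [hs]
          rw [S.cumExt_next χ σ e e' q' acc (hl _) he', S.cumExt_next χ σ e e' q' acc (hl _) he',
            S.cumExt_next χ σ e e' q' acc (hl _) he', ih _ (by simp; omega) p g [] rfl, map_add,
            add_mul]
          exact S.cumExt_add_head χ σ _ _ _ q' _
    · simp only [List.append_assoc, List.cons_append, S.cumExt_next χ σ e e' _ acc hg he']
      exact ih _ (by simp) (_ :: p') q _ rfl

/-- This takes a sum over the partitions of a gap, or of a removed interval, out of the entry into
which it is multiplied. -/
theorem ProbSpace.cumExt_sum {T : Type*} (t : Finset T) (j : J) (x : A) (c : T → B)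
    (p q : List (J × A)) (acc : List (A × Face)) :
    S.cumExt χ σ (p ++ (j, S.emb (∑ k ∈ t, c k) * x) :: q) acc =
      ∑ k ∈ t, S.cumExt χ σ (p ++ (j, S.emb (c k) * x) :: q) acc := by
  let φ : B →+ B := AddMonoidHom.mk' (fun b => S.cumExt χ σ (p ++ (j, S.emb b * x) :: q) acc)
    fun b c => by rw [map_add, add_mul, S.cumExt_add]
  exact map_sum φ c t

theorem ProbSpace.cumExt_smul_acc (b : B) (x : A) (f : Face) (q : List (A × Face))
    (L : List (J × A)) (hL : L ≠ []) :
    S.cumExt χ σ L ((S.emb b * x, f) :: q) = b * S.cumExt χ σ L ((x, f) :: q) := by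
  induction hn : L.length using Nat.strong_induction_on generalizing L q with
  | _ n ih =>
  subst hn
  cases L with
  | nil => exact absurd rfl hL
  | cons e L =>
    rcases exists_next σ e.1 L with hL | ⟨g, e', L', rfl, hg, he'⟩
    · simp only [S.cumExt_last χ σ e _ hL, List.cons_append, kappaList_smul, mul_assoc]
    · simp only [S.cumExt_next χ σ e e' L' _ hg he', List.cons_append]
      exact ih _ (by simp) _ _ (by simp) rfl

theorem ProbSpace.cumExt_smul (b : B) (j : J) (x : A) (q : List (J × A)) :
    S.cumExt χ σ ((j, S.emb b * x) :: q) [] = b * S.cumExt χ σ ((j, x) :: q) [] := by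
  rcases exists_next σ j q with hL | ⟨g, e', L', rfl, hg, he'⟩
  · simp only [S.cumExt_last χ σ (j, _) _ hL, List.nil_append, kappaList_smul, mul_assoc]
  · simp only [S.cumExt_next χ σ (j, _) e' L' _ hg he', List.nil_append]
    exact S.cumExt_smul_acc χ σ b x _ [] _ (by simp)

/-- No block meets both lists, so every block of `L` is closed before `L'` begins. For empty `L` the
collected entries would be lost, hence `hL`. -/
theorem ProbSpace.cumExt_append (L L' : List (J × A)) (acc : List (A × Face))
    (hL : L = [] → acc = []) (h : ∀ x ∈ L, ∀ y ∈ L', ¬ σ x.1 y.1) :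
    S.cumExt χ σ (L ++ L') acc = S.cumExt χ σ L acc * S.cumExt χ σ L' [] := by
  induction hn : L.length using Nat.strong_induction_on generalizing L acc with
  | _ n ih =>
  subst hn
  cases L with
  | nil => simp [hL rfl]
  | cons e L =>
    have hL' : ∀ y ∈ L', ¬ σ e.1 y.1 := h e (by simp)
    rw [List.cons_append]
    rcases exists_next σ e.1 L with hl | ⟨g, e', L'', rfl, hg, he'⟩
    · rw [S.cumExt_last χ σ e acc hl, S.cumExt_last χ σ e acc, mul_assoc,
        ih L.length (by simp) L [] (fun _ => rfl) (fun x hx => h x (by simp [hx])) rfl]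
      intro x hx
      rcases List.mem_append.1 hx with hx | hx
      · exact hl x hx
      · exact hL' x hx
    · rw [List.append_assoc, List.cons_append, S.cumExt_next χ σ e e' _ acc hg he',
        S.cumExt_next χ σ e e' _ acc hg he']
      refine ih _ (by simp) (_ :: L'') _ (by simp) ?_ rfl
      intro x hx
      simp only [List.mem_cons] at hx
      rcases hx with rfl | hx
      · exact h e' (by simp)
      · exact h x (by simp [hx])

/-- Removing an interval that is a union of blocks. -/
theorem ProbSpace.cumExt_remove (W : List (J × A)) (j : J) (x : A) (p q : List (J × A))
    (acc : List (A × Face)) (hp : p = [] → acc = [])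
    (h : ∀ w ∈ W, ∀ y ∈ p ++ (j, x) :: q, ¬ σ w.1 y.1) :
    S.cumExt χ σ (p ++ (W ++ (j, x) :: q)) acc =
      S.cumExt χ σ (p ++ (j, S.emb (S.cumExt χ σ W []) * x) :: q) acc := by
  induction hn : p.length + q.length using Nat.strong_induction_on generalizing p q acc with
  | _ n ih =>
  subst hn
  cases p with
  | nil =>
    rw [hp rfl, List.nil_append, List.nil_append, S.cumExt_smul, S.cumExt_append]
    · simp
    · intro w hw y hy
      exact h w hw y (by simpa using hy)
  | cons e p =>
    have heW : ∀ w ∈ W, ¬ σ e.1 w.1 := fun w hw hs => h w hw e (by simp) (σ.symm hs)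
    have hsub : ∀ p' q', (∀ y ∈ p', y ∈ e :: p) → (∀ y ∈ q', y ∈ q) →
        ∀ w ∈ W, ∀ y ∈ p' ++ (j, x) :: q', ¬ σ w.1 y.1 := by
      intro p' q' h1 h2 w hw y hy
      refine h w hw y ?_
      simp only [List.mem_append, List.mem_cons] at hy
      rcases hy with hy | rfl | hy
      · exact List.mem_append_left _ (h1 y hy)
      · simp
      · simp [h2 y hy]
    simp only [List.cons_append]
    rcases exists_next σ e.1 p with hp | ⟨g, e', p', rfl, hg, he'⟩
    · have hpW : ∀ y ∈ p ++ W, ¬ σ e.1 y.1 := by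
        intro y hy
        rcases List.mem_append.1 hy with hy | hy
        · exact hp y hy
        · exact heW y hy
      -- No entry of `p` continues the block of `e`. If the entry behind `W` does, then `W` is the
      -- end of a gap, whose value factors. Otherwise `W` and that entry stay together, in one gap
      -- or behind the block.
      by_cases hj : σ e.1 j
      · rw [← List.append_assoc, S.cumExt_next χ σ e (j, x) q acc hpW hj,
          S.cumExt_next χ σ e (j, _) q acc hp hj, S.cumExt_append χ σ p W [] (fun _ => rfl)]
        · simp only [map_mul, mul_assoc]
        · intro y hy w hw hs
          exact h w hw y (by simp [hy]) (σ.symm hs)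
      · rcases exists_next σ e.1 q with hq | ⟨g, e', q', rfl, hg, he'⟩
        · rw [S.cumExt_last χ σ e acc, S.cumExt_last χ σ e acc,
            ih _ (by simp) p q [] (fun _ => rfl) (hsub p q (by simp +contextual) (by simp)) rfl]
          · intro y hy
            simp only [List.mem_append, List.mem_cons] at hy
            rcases hy with hy | rfl | hy
            exacts [hp y hy, hj, hq y hy]
          · intro y hy
            simp only [List.mem_append, List.mem_cons] at hy
            rcases hy with hy | hy | rfl | hy
            exacts [hp y hy, heW y hy, hj, hq y hy]
        · have hs1 : p ++ (W ++ (j, x) :: (g ++ e' :: q')) =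
              (p ++ (W ++ (j, x) :: g)) ++ e' :: q' := by simp
          have hs2 : ∀ z : A, p ++ (j, z) :: (g ++ e' :: q') =
              (p ++ (j, z) :: g) ++ e' :: q' := by simp
          rw [hs1, hs2, S.cumExt_next χ σ e e' q' acc _ he', S.cumExt_next χ σ e e' q' acc _ he',
            ih _ (by simp; omega) p g [] (fun _ => rfl)
              (hsub p g (by simp +contextual) (by simp +contextual)) rfl]
          · intro y hy
            simp only [List.mem_append, List.mem_cons] at hy
            rcases hy with hy | rfl | hy
            exacts [hp y hy, hj, hg y hy]
          · intro y hy
            simp only [List.mem_append, List.mem_cons] at hy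
            rcases hy with hy | hy | rfl | hy
            exacts [hp y hy, heW y hy, hj, hg y hy]
    · rw [List.append_assoc, List.append_assoc, List.cons_append, List.cons_append,
        S.cumExt_next χ σ e e' _ acc hg he', S.cumExt_next χ σ e e' _ acc hg he']
      refine ih _ (by simp) (_ :: p') q _ (by simp) ?_ rfl
      intro w hw y hy
      simp only [List.cons_append, List.mem_cons] at hy
      rcases hy with rfl | hy
      · exact h w hw e' (by simp)
      · exact h w hw y (by simp at hy ⊢; tauto)

end Extension

/-! ### Interval-noncrossing partitions of a list of indices -/

noncomputable section ListPartitions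

open scoped Classical

variable {n : ℕ}

instance : Finite (Setoid (Fin n)) :=
  Finite.of_injective (fun π : Setoid (Fin n) => (fun v w => π v w : Fin n → Fin n → Prop))
    (fun _ _ h => Setoid.ext fun v w => iff_of_eq (congrFun (congrFun h v) w))

instance : Fintype (Setoid (Fin n)) := Fintype.ofFinite _

variable (χ : Fin n → Face)

/-- The interval-noncrossing partitions of the indices in `l`, extended by singletons. -/
structure IsPart (l : List (Fin n)) (σ : Setoid (Fin n)) : Prop where
  supp : ∀ x y, σ x y → x ≠ y → x ∈ l
  nc : IsNoncrossing σ
  inc : ∀ v₁ w v₂, v₁ < w → w < v₂ → σ v₁ v₂ → w ∈ l → χ w = Face.boolean → σ v₁ w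

/-- The finite set of the interval-noncrossing partitions of the indices in `l`. -/
def parts (l : List (Fin n)) : Finset (Setoid (Fin n)) := {σ | IsPart χ l σ}

/-- The restriction of a partition to the indices in `l`, extended by singletons. -/
def restr (σ : Setoid (Fin n)) (l : List (Fin n)) : Setoid (Fin n) where
  r x y := x = y ∨ x ∈ l ∧ y ∈ l ∧ σ x y
  iseqv :=
    { refl := fun x => .inl rfl
      symm := by
        rintro x y (rfl | ⟨hx, hy, h⟩)
        · exact .inl rfl
        · exact .inr ⟨hy, hx, σ.symm h⟩
      trans := by
        rintro x y z (rfl | ⟨hx, hy, h⟩) (rfl | ⟨hy', hz, h'⟩)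
        · exact .inl rfl
        · exact .inr ⟨hy', hz, h'⟩
        · exact .inr ⟨hx, hy, h⟩
        · exact .inr ⟨hx, hz, σ.trans h h'⟩ }

/-- The partition that is `σ` on the indices in `l` and `τ` on the others. -/
def glueOn (l : List (Fin n)) (σ τ : Setoid (Fin n)) : Setoid (Fin n) where
  r x y := (x ∈ l ↔ y ∈ l) ∧ (x ∈ l → σ x y) ∧ (x ∉ l → τ x y)
  iseqv :=
    { refl := fun x => ⟨Iff.rfl, fun _ => σ.refl x, fun _ => τ.refl x⟩
      symm := fun ⟨h, h1, h2⟩ =>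
        ⟨h.symm, fun hy => σ.symm (h1 (h.2 hy)), fun hy => τ.symm (h2 (mt h.1 hy))⟩
      trans := fun ⟨h, h1, h2⟩ ⟨h', h1', h2'⟩ =>
        ⟨h.trans h', fun hx => σ.trans (h1 hx) (h1' (h.1 hx)),
          fun hx => τ.trans (h2 hx) (h2' (mt h.2 hx))⟩ }

theorem restr_iff {σ : Setoid (Fin n)} {l : List (Fin n)} {x y : Fin n} :
    restr σ l x y ↔ x = y ∨ x ∈ l ∧ y ∈ l ∧ σ x y := Iff.rfl

theorem glueOn_iff {σ τ : Setoid (Fin n)} {l : List (Fin n)} {x y : Fin n} :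
    glueOn l σ τ x y ↔ (x ∈ l ↔ y ∈ l) ∧ (x ∈ l → σ x y) ∧ (x ∉ l → τ x y) := Iff.rfl

theorem restr_iff_of_mem {σ : Setoid (Fin n)} {l : List (Fin n)} {x y : Fin n} (hx : x ∈ l)
    (hy : y ∈ l) : restr σ l x y ↔ σ x y := by
  rw [restr_iff]
  constructor
  · rintro (rfl | ⟨_, _, h⟩)
    · exact σ.refl x
    · exact h
  · exact fun h => .inr ⟨hx, hy, h⟩

theorem mem_parts {l : List (Fin n)} {σ : Setoid (Fin n)} : σ ∈ parts χ l ↔ IsPart χ l σ := by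
  simp [parts]

variable {χ}

theorem IsPart.restr {l l' : List (Fin n)} {σ : Setoid (Fin n)} (h : IsPart χ l σ)
    (hl : ∀ x ∈ l', x ∈ l) : IsPart χ l' (restr σ l') where
  supp x y hxy hne := by
    rw [restr_iff] at hxy
    tauto
  nc := by
    intro v₁ w₁ v₂ w₂ h1 h2 h3 hv hw
    rcases hv with rfl | ⟨a, b, c⟩
    · exact absurd (h1.trans h2) (lt_irrefl _)
    rcases hw with rfl | ⟨a', b', c'⟩
    · exact absurd (h2.trans h3) (lt_irrefl _)
    exact .inr ⟨a, a', h.nc _ _ _ _ h1 h2 h3 c c'⟩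
  inc := by
    intro v₁ w v₂ h1 h2 hv hw hχ
    rcases hv with rfl | ⟨a, b, c⟩
    · exact absurd (h1.trans h2) (lt_irrefl _)
    exact .inr ⟨a, hw, h.inc _ _ _ h1 h2 c (hl _ hw) hχ⟩

theorem IsPart.supp_right {l : List (Fin n)} {σ : Setoid (Fin n)} (h : IsPart χ l σ) (x y : Fin n)
    (hxy : σ x y) (hne : x ≠ y) : y ∈ l := h.supp y x (σ.symm hxy) hne.symm

theorem IsPart.restr_eq {l : List (Fin n)} {σ : Setoid (Fin n)} (h : IsPart χ l σ) :
    FreeBoolean.restr σ l = σ := by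
  ext x y
  rw [restr_iff]
  constructor
  · rintro (rfl | ⟨_, _, h⟩)
    · exact σ.refl x
    · exact h
  · intro hxy
    by_cases hne : x = y
    · exact .inl hne
    · exact .inr ⟨h.supp x y hxy hne, h.supp_right x y hxy hne, hxy⟩

/-- The partitions of `l` below `π`, for a block `l₁` of `π` that is an interval of `l`, are the
pairs of a partition of `l₁` and a partition of the rest below `π`. -/
theorem sum_parts_split {M : Type*} [AddCommMonoid M] {l l₁ l₂ : List (Fin n)}
    {π : Setoid (Fin n)} (hl : ∀ x, x ∈ l ↔ x ∈ l₁ ∨ x ∈ l₂) (hd : ∀ x ∈ l₁, x ∉ l₂)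
    (hconv : ∀ x ∈ l₁, ∀ y ∈ l₁, ∀ z ∈ l₂, x < z → ¬ z < y)
    (h₁ : ∀ x ∈ l₁, ∀ y ∈ l₁, π x y) (h₂ : ∀ x ∈ l₁, ∀ y ∈ l₂, ¬ π x y)
    (hinc : ∀ v₁ ∈ l₂, ∀ v₂ ∈ l₂, ∀ w ∈ l₁, v₁ < w → w < v₂ → π v₁ v₂ → χ w ≠ Face.boolean)
    (F : Setoid (Fin n) → Setoid (Fin n) → M) :
    ∑ σ ∈ parts χ l with σ ≤ π, F (restr σ l₁) (restr σ l₂) =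
      ∑ σ₂ ∈ parts χ l₂ with σ₂ ≤ π, ∑ σ₁ ∈ parts χ l₁, F σ₁ σ₂ := by
  rw [← Finset.sum_product']
  refine Finset.sum_nbij' (fun σ => (restr σ l₂, restr σ l₁)) (fun q => glueOn l₁ q.2 q.1)
    ?_ ?_ ?_ ?_ (fun _ _ => rfl)
  · intro σ hσ
    simp only [Finset.mem_filter, mem_parts, Finset.mem_product] at hσ ⊢
    refine ⟨⟨hσ.1.restr fun x hx => (hl x).2 (.inr hx), ?_⟩,
      hσ.1.restr fun x hx => (hl x).2 (.inl hx)⟩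
    rintro x y (rfl | ⟨_, _, h⟩)
    · exact π.refl x
    · exact hσ.2 h
  · rintro ⟨σ₂, σ₁⟩ hq
    simp only [Finset.mem_filter, mem_parts, Finset.mem_product] at hq ⊢
    obtain ⟨⟨hσ₂, hπ⟩, hσ₁⟩ := hq
    have m₂ : ∀ x y, x ≠ y → σ₂ x y → x ∈ l₂ ∧ y ∈ l₂ := fun x y hne h =>
      ⟨hσ₂.supp x y h hne, hσ₂.supp_right x y h hne⟩
    refine ⟨⟨?_, ?_, ?_⟩, ?_⟩
    · rintro x y ⟨-, ha, hb⟩ hne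
      rw [hl]
      by_cases hx : x ∈ l₁
      · exact .inl hx
      · exact .inr (m₂ x y hne (hb hx)).1
    · rintro v₁ w₁ v₂ w₂ h1 h2 h3 ⟨hv, hv1, hv2⟩ ⟨hw, hw1, hw2⟩
      by_cases hv' : v₁ ∈ l₁
      · by_cases hw' : w₁ ∈ l₁
        · exact ⟨by tauto, fun _ => hσ₁.nc _ _ _ _ h1 h2 h3 (hv1 hv') (hw1 hw'), by tauto⟩
        · exact absurd h2 (hconv _ hv' _ (hv.1 hv') _ (m₂ _ _ (h2.trans h3).ne (hw2 hw')).1 h1)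
      · by_cases hw' : w₁ ∈ l₁
        · exact absurd h3 (hconv _ hw' _ (hw.1 hw') _ (m₂ _ _ (h1.trans h2).ne (hv2 hv')).2 h2)
        · exact ⟨by tauto, by tauto, fun _ => hσ₂.nc _ _ _ _ h1 h2 h3 (hv2 hv') (hw2 hw')⟩
    · rintro v₁ w v₂ h1 h2 ⟨hv, hv1, hv2⟩ hw hχ
      by_cases hv' : v₁ ∈ l₁
      · by_cases hw' : w ∈ l₁
        · exact ⟨by tauto, fun _ => hσ₁.inc _ _ _ h1 h2 (hv1 hv') hw' hχ, by tauto⟩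
        · exact absurd h2 (hconv _ hv' _ (hv.1 hv') _ (((hl w).1 hw).resolve_left hw') h1)
      · have hs := m₂ _ _ (h1.trans h2).ne (hv2 hv')
        by_cases hw' : w ∈ l₁
        -- A Boolean point of `l₁` below a block of `σ₂` is the only new danger for the Boolean
        -- condition; it is excluded because that block lies in a block of `π`.
        · exact absurd hχ (hinc _ hs.1 _ hs.2 _ hw' h1 h2 (hπ (hv2 hv')))
        · exact ⟨by tauto, by tauto, fun _ => hσ₂.inc _ _ _ h1 h2 (hv2 hv')
            (((hl w).1 hw).resolve_left hw') hχ⟩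
    · rintro x y ⟨h, ha, hb⟩
      by_cases hx : x ∈ l₁
      · exact h₁ x hx y (h.1 hx)
      · exact hπ (hb hx)
  · intro σ hσ
    simp only [Finset.mem_filter, mem_parts] at hσ
    obtain ⟨hσ, hπ⟩ := hσ
    ext x y
    change glueOn l₁ (restr σ l₁) (restr σ l₂) x y ↔ σ x y
    rw [glueOn_iff, restr_iff, restr_iff]
    constructor
    · rintro ⟨h, ha, hb⟩
      by_cases hx : x ∈ l₁
      · rcases ha hx with rfl | h
        exacts [σ.refl _, h.2.2]
      · rcases hb hx with rfl | h
        exacts [σ.refl _, h.2.2]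
    · intro h
      by_cases hne : x = y
      · subst hne; simp
      have hx := (hl x).1 (hσ.supp x y h hne)
      have hy := (hl y).1 (hσ.supp_right x y h hne)
      have := h₂ x
      have := h₂ y
      have := hπ h
      have := π.symm (hπ h)
      have := hd x
      have := hd y
      tauto
  · rintro ⟨σ₂, σ₁⟩ hq
    simp only [Finset.mem_filter, mem_parts, Finset.mem_product] at hq
    obtain ⟨⟨hσ₂, hπ⟩, hσ₁⟩ := hq
    refine Prod.ext ?_ ?_
    · rw [← hσ₂.restr_eq]
      ext x y
      change restr (glueOn l₁ σ₁ (restr σ₂ l₂)) l₂ x y ↔ restr σ₂ l₂ x y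
      rw [restr_iff, restr_iff, glueOn_iff, restr_iff]
      have := hd x
      have := hd y
      have := σ₁.refl x
      tauto
    · rw [← hσ₁.restr_eq]
      ext x y
      change restr (glueOn l₁ (restr σ₁ l₁) σ₂) l₁ x y ↔ restr σ₁ l₁ x y
      rw [restr_iff, restr_iff, glueOn_iff, restr_iff]
      have := hd x
      have := hd y
      tauto

/-- The partitions in which the first index is a singleton. -/
theorem parts_cons_last {m : Fin n} {L : List (Fin n)} (hm : ∀ x ∈ L, m < x) :
    {σ ∈ parts χ (m :: L) | ∀ x ∈ L, ¬ σ m x} = parts χ L := by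
  ext σ
  simp only [Finset.mem_filter, mem_parts]
  constructor
  · rintro ⟨h, hL⟩
    refine ⟨fun x y hxy hne => ?_, h.nc, fun v₁ w v₂ h1 h2 hv hw => h.inc v₁ w v₂ h1 h2 hv
      (List.mem_cons_of_mem _ hw)⟩
    rcases List.mem_cons.1 (h.supp x y hxy hne) with rfl | hx
    · rcases List.mem_cons.1 (h.supp_right x y hxy hne) with rfl | hy
      · exact absurd rfl hne
      · exact absurd hxy (hL y hy)
    · exact hx
  · intro h
    have hmL : m ∉ L := fun hx => lt_irrefl m (hm m hx)
    refine ⟨⟨fun x y hxy hne => List.mem_cons_of_mem _ (h.supp x y hxy hne), h.nc, ?_⟩, ?_⟩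
    · intro v₁ w v₂ h1 h2 hv hw
      rcases List.mem_cons.1 hw with rfl | hw
      · exact absurd h1 (hm v₁ (h.supp _ _ hv (h1.trans h2).ne)).asymm
      · exact h.inc v₁ w v₂ h1 h2 hv hw
    · intro x hx hmx
      exact hmL (h.supp m x hmx (hm x hx).ne)

/-- Removing the first index from its block. -/
theorem sum_parts_cons {M : Type*} [AddCommMonoid M] {m v : Fin n} {g L : List (Fin n)}
    (hm : ∀ x ∈ g ++ v :: L, m < x) (hgv : ∀ x ∈ g, ∀ y ∈ v :: L, x < y) (hvL : ∀ y ∈ L, v < y)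
    (F : Setoid (Fin n) → M) :
    ∑ σ ∈ parts χ (m :: (g ++ v :: L)) with (∀ x ∈ g, ¬ σ m x) ∧ σ m v,
        F (restr σ (g ++ v :: L)) =
      if ∀ x ∈ g, χ x = Face.free then
        ∑ σ ∈ parts χ (g ++ v :: L) with σ ≤ Setoid.ker (· ∈ g), F σ else 0 := by
  have hmL : m ∉ g ++ v :: L := fun hx => lt_irrefl m (hm m hx)
  have hmv : m < v := hm v (by simp)
  split_ifs with hfr
  swap
  -- A Boolean index between `m` and `v` would have to belong to their block, so no partition is
  -- left.
  · refine Finset.sum_eq_zero fun σ hσ => ?_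
    simp only [Finset.mem_filter, mem_parts] at hσ
    push Not at hfr
    obtain ⟨x, hx, hχ⟩ := hfr
    refine absurd (hσ.1.inc m x v (hm x (by simp [hx])) (hgv x hx v (by simp)) hσ.2.2 (by simp [hx])
      ?_) (hσ.2.1 x hx)
    cases h : χ x
    · exact absurd h hχ
    · rfl
  have hf : ∀ x, x ≠ m → Function.update id m v x = x := fun x hx => Function.update_of_ne hx _ _
  have hfm : Function.update id m v m = v := Function.update_self _ _ _
  -- The inverse adds `m` to the block of `v`, as the pullback along the map that sends `m` to `v`
  -- and fixes everything else.
  refine Finset.sum_nbij' (fun σ => restr σ (g ++ v :: L))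
    (fun σ => Setoid.comap (Function.update id m v) σ) ?_ ?_ ?_ ?_ (fun _ _ => rfl)
  · intro σ hσ
    simp only [Finset.mem_filter, mem_parts] at hσ ⊢
    obtain ⟨hσ, hg, hv⟩ := hσ
    refine ⟨hσ.restr fun x hx => List.mem_cons_of_mem _ hx, ?_⟩
    -- As `m` and `v` are consecutive in their block, a block that joins the gap to anything from
    -- `v` on would cross it or contain it.
    have key : ∀ x ∈ g, ∀ y ∈ v :: L, ¬ σ x y := by
      intro x hx y hy hxy
      rcases List.mem_cons.1 hy with rfl | hyL
      · exact hg x hx (σ.trans hv (σ.symm hxy))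
      · exact hg x hx (hσ.nc m x v y (hm x (by simp [hx])) (hgv x hx v (by simp)) (hvL y hyL) hv
          hxy)
    rintro x y (rfl | ⟨hx, hy, h⟩)
    · rfl
    · rw [Setoid.ker_def, eq_iff_iff]
      rcases List.mem_append.1 hx with hx | hx <;> rcases List.mem_append.1 hy with hy | hy
      · tauto
      · exact absurd h (key x hx y hy)
      · exact absurd (σ.symm h) (key y hy x hx)
      · exact iff_of_false (fun h => lt_irrefl x (hgv x h x hx)) fun h => lt_irrefl y (hgv y h y hy)
  · intro σ hσ
    simp only [Finset.mem_filter, mem_parts] at hσ ⊢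
    obtain ⟨hσ, hle⟩ := hσ
    have hmσ : ∀ y, σ m y → y = m := by
      intro y hy
      by_contra hne
      exact hmL (hσ.supp m y hy (Ne.symm hne))
    have hvg : v ∉ g := fun h => lt_irrefl v (hgv v h v (by simp))
    have hvg' : ∀ y, σ v y → y ∉ g := by
      intro y hy h
      have := hle hy
      rw [Setoid.ker_def, eq_iff_iff] at this
      exact hvg (this.2 h)
    have hout : ∀ y, y ∈ g ++ v :: L → y ∉ g → y = v ∨ v < y := by
      intro y hy hyg
      rcases List.mem_append.1 hy with h | h
      · exact absurd h hyg
      · rcases List.mem_cons.1 h with h | h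
        · exact .inl h
        · exact .inr (hvL y h)
    have hsupp : ∀ x y, Setoid.comap (Function.update id m v) σ x y → x ≠ y →
        x ∈ m :: (g ++ v :: L) := by
      intro x y hxy hne
      by_cases hx : x = m
      · simp [hx]
      · rw [Setoid.comap_rel, hf x hx] at hxy
        by_cases hy : y = m
        · rw [hy, hfm] at hxy
          by_cases hxv : x = v
          · simp [hxv]
          · exact List.mem_cons_of_mem _ (hσ.supp x v hxy hxv)
        · rw [hf y hy] at hxy
          exact List.mem_cons_of_mem _ (hσ.supp x y hxy hne)
    have hmle : ∀ x y, Setoid.comap (Function.update id m v) σ x y → x ≠ y → m ≤ x := by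
      intro x y hxy hne
      rcases List.mem_cons.1 (hsupp x y hxy hne) with h | h
      exacts [h.ge, (hm x h).le]
    have hmem : ∀ y, σ v y → y ∈ v :: L := by
      intro y hy
      by_cases hne : v = y
      · simp [hne]
      · exact (List.mem_append.1 (hσ.supp_right v y hy hne)).resolve_left (hvg' y hy)
    refine ⟨⟨hsupp, ?_, ?_⟩, ?_, ?_⟩
    · intro v₁ w₁ v₂ w₂ h1 h2 h3 hv hw
      have hm1 := hmle _ _ hv (h1.trans h2).ne
      rw [Setoid.comap_rel, hf v₂ (hm1.trans_lt (h1.trans h2)).ne'] at hv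
      rw [Setoid.comap_rel, hf w₁ (hm1.trans_lt h1).ne',
        hf w₂ (hm1.trans_lt (h1.trans (h2.trans h3))).ne'] at hw
      rw [Setoid.comap_rel, hf w₁ (hm1.trans_lt h1).ne']
      by_cases hv₁ : v₁ = m
      · rw [hv₁, hfm] at hv ⊢
        have hw₁ := hσ.supp _ _ hw (h2.trans h3).ne
        by_cases hg : w₁ ∈ g
        · have := hle hw
          rw [Setoid.ker_def, eq_iff_iff] at this
          exact absurd h3 (hgv w₂ (this.1 hg) v₂ (hmem v₂ hv)).asymm
        · rcases hout w₁ hw₁ hg with rfl | h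
          · exact σ.refl _
          · exact hσ.nc _ _ _ _ h h2 h3 hv hw
      · rw [hf v₁ hv₁] at hv ⊢
        exact hσ.nc _ _ _ _ h1 h2 h3 hv hw
    · intro v₁ w v₂ h1 h2 hv hw hχ
      have hm1 := hmle _ _ hv (h1.trans h2).ne
      rw [Setoid.comap_rel, hf v₂ (hm1.trans_lt (h1.trans h2)).ne'] at hv
      rw [Setoid.comap_rel, hf w (hm1.trans_lt h1).ne']
      have hw := (List.mem_cons.1 hw).resolve_left (hm1.trans_lt h1).ne'
      by_cases hv₁ : v₁ = m
      · rw [hv₁, hfm] at hv ⊢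
        rcases hout w hw (fun h => by rw [hfr w h] at hχ; cases hχ) with rfl | h
        · exact σ.refl _
        · exact hσ.inc _ _ _ h h2 hv hw hχ
      · rw [hf v₁ hv₁] at hv ⊢
        exact hσ.inc _ _ _ h1 h2 hv hw hχ
    · intro x hx h
      rw [Setoid.comap_rel, hfm, hf x (hm x (by simp [hx])).ne'] at h
      exact hvg' x h hx
    · rw [Setoid.comap_rel, hfm, hf v hmv.ne']
  · intro σ hσ
    simp only [Finset.mem_filter, mem_parts] at hσ
    obtain ⟨hσ, hg, hv⟩ := hσ
    have hr : ∀ x y, x ≠ m → y ≠ m → (restr σ (g ++ v :: L) x y ↔ σ x y) := by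
      intro x y hx hy
      rw [restr_iff]
      constructor
      · rintro (rfl | h)
        exacts [σ.refl x, h.2.2]
      · intro h
        by_cases hne : x = y
        · exact .inl hne
        · exact .inr ⟨(List.mem_cons.1 (hσ.supp x y h hne)).resolve_left hx,
            (List.mem_cons.1 (hσ.supp_right x y h hne)).resolve_left hy, h⟩
    have hfne : ∀ x, Function.update id m v x ≠ m := by
      intro x
      by_cases hx : x = m
      · rw [hx, hfm]; exact hmv.ne'
      · rwa [hf x hx]
    have hfσ : ∀ x, σ (Function.update id m v x) x := by
      intro x
      by_cases hx : x = m
      · rw [hx, hfm]; exact σ.symm hv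
      · rw [hf x hx]
    ext x y
    change restr σ (g ++ v :: L) _ _ ↔ σ x y
    rw [hr _ _ (hfne x) (hfne y)]
    exact ⟨fun h => σ.trans (σ.symm (hfσ x)) (σ.trans h (hfσ y)),
      fun h => σ.trans (hfσ x) (σ.trans h (σ.symm (hfσ y)))⟩
  · intro σ hσ
    simp only [Finset.mem_filter, mem_parts] at hσ
    conv_rhs => rw [← hσ.1.restr_eq]
    ext x y
    rw [restr_iff, restr_iff, Setoid.comap_rel]
    refine or_congr Iff.rfl (and_congr_right fun hx => and_congr_right fun hy => ?_)
    rw [hf x fun h => hmL (h ▸ hx), hf y fun h => hmL (h ▸ hy)]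

end ListPartitions

/-! ### The moment-cumulant formula -/

noncomputable section MomentCumulant

open scoped Classical

variable {𝕜 : Type v} {B A : Type u} [CommRing 𝕜] [Ring B] [Algebra 𝕜 B] [Ring A] [Algebra 𝕜 A]
variable (S : ProbSpace 𝕜 B A) {n : ℕ} (χ : Fin n → Face)

/-- An indexed element, with the face of its index. -/
def faced (e : Fin n × A) : A × Face := (e.2, χ e.1)

theorem parts_nil : parts χ [] = {⊥} := by
  ext σ
  rw [mem_parts, Finset.mem_singleton]
  constructor
  · intro h
    refine eq_bot_iff.2 fun x y hxy => ?_
    by_contra hne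
    exact absurd (h.supp x y hxy hne) (by simp)
  · rintro rfl
    refine ⟨fun x y hxy hne => absurd hxy hne, fun v₁ w₁ v₂ w₂ h1 h2 _ hv _ => ?_,
      fun v₁ w v₂ h1 h2 hv => ?_⟩
    · exact absurd hv (h1.trans h2).ne
    · exact absurd hv (h1.trans h2).ne

/-- The sum over the partitions in which the second element of the first block is given. -/
theorem sum_cumExt_next (e e' : Fin n × A) (g L : List (Fin n × A)) (acc : List (A × Face))
    (hs : ((e :: (g ++ e' :: L)).map Prod.fst).Pairwise (· < ·)) :
    ∑ σ ∈ parts χ ((e :: (g ++ e' :: L)).map Prod.fst) with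
        (∀ x ∈ g.map Prod.fst, ¬ σ e.1 x) ∧ σ e.1 e'.1, S.cumExt χ σ (e :: (g ++ e' :: L)) acc =
      if ∀ x ∈ g.map Prod.fst, χ x = Face.free then
        ∑ σ ∈ parts χ ((e' :: L).map Prod.fst), S.cumExt χ σ
          ((e'.1, S.emb (∑ τ ∈ parts χ (g.map Prod.fst), S.cumExt χ τ g []) * e'.2) :: L)
          (acc ++ [faced χ e]) else 0 := by
  simp only [List.map_cons, List.map_append, List.pairwise_cons, List.pairwise_append] at hs ⊢
  obtain ⟨hm, hg, ⟨hvL, hL⟩, hgv⟩ := hs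
  have hd : ∀ x ∈ g.map Prod.fst, x ∉ e'.1 :: L.map Prod.fst :=
    fun x hx hx' => lt_irrefl x (hgv x hx x hx')
  have hmg : ∀ x ∈ g, x.1 ∈ g.map Prod.fst := fun x hx => List.mem_map_of_mem hx
  have hmL : ∀ (z : A), ∀ x ∈ (e'.1, z) :: L, x.1 ∈ e'.1 :: L.map Prod.fst := by
    intro z x hx
    rcases List.mem_cons.1 hx with rfl | hx
    · simp
    · exact List.mem_cons_of_mem _ (List.mem_map_of_mem hx)
  -- The value depends separately on the partition of the gap and on that of the rest, and the two
  -- can be chosen independently.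
  let F : Setoid (Fin n) → Setoid (Fin n) → B := fun σ₁ σ₂ =>
    S.cumExt χ σ₂ ((e'.1, S.emb (S.cumExt χ σ₁ g []) * e'.2) :: L) (acc ++ [faced χ e])
  have hF : ∀ σ σ' : Setoid (Fin n),
      (∀ x ∈ g.map Prod.fst, ∀ y ∈ g.map Prod.fst, σ x y ↔ σ' x y) →
      ∀ τ τ' : Setoid (Fin n), (∀ x ∈ e'.1 :: L.map Prod.fst, ∀ y ∈ e'.1 :: L.map Prod.fst,
        τ x y ↔ τ' x y) → F σ τ = F σ' τ' := by
    intro σ σ' h τ τ' h'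
    simp only [F]
    rw [S.cumExt_congr χ g [] fun x hx y hy => h _ (hmg x hx) _ (hmg y hy)]
    exact S.cumExt_congr χ _ _ fun x hx y hy => h' _ (hmL _ x hx) _ (hmL _ y hy)
  have h1 := sum_parts_cons (χ := χ) hm hgv hvL fun σ => F σ σ
  have h2 := sum_parts_split (χ := χ) (l := g.map Prod.fst ++ e'.1 :: L.map Prod.fst)
    (l₁ := g.map Prod.fst) (l₂ := e'.1 :: L.map Prod.fst)
    (π := Setoid.ker (· ∈ g.map Prod.fst)) (fun x => List.mem_append) hd
    (fun x _ y hy z hz _ => (hgv y hy z hz).asymm)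
    (fun x hx y hy => by rw [Setoid.ker_def, eq_iff_iff]; tauto)
    (fun x hx y hy h => by
      rw [Setoid.ker_def, eq_iff_iff] at h
      exact hd y (h.1 hx) hy)
    (fun v₁ hv₁ v₂ _ w hw h => absurd h (hgv w hw v₁ hv₁).asymm) F
  refine Eq.trans ?_ (h1.trans ?_)
  · refine Finset.sum_congr rfl fun σ hσ => ?_
    have hσ := (Finset.mem_filter.1 hσ).2
    rw [S.cumExt_next χ σ e e' L acc (fun x hx => hσ.1 _ (hmg x hx)) hσ.2]
    exact hF _ _ (fun x hx y hy => (restr_iff_of_mem (List.mem_append_left _ hx)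
      (List.mem_append_left _ hy)).symm) _ _ fun x hx y hy =>
        (restr_iff_of_mem (List.mem_append_right _ hx) (List.mem_append_right _ hy)).symm
  · split_ifs
    · refine Eq.trans (Finset.sum_congr rfl fun σ _ => ?_) (h2.trans ?_)
      · exact hF _ _ (fun x hx y hy => (restr_iff_of_mem hx hy).symm) _ _
          fun x hx y hy => (restr_iff_of_mem hx hy).symm
      · rw [Finset.filter_true_of_mem]
        · refine Finset.sum_congr rfl fun σ _ => ?_
          exact (S.cumExt_sum χ σ _ e'.1 e'.2 _ [] L _).symm
        · intro σ hσ x y hxy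
          rw [mem_parts] at hσ
          by_cases hne : x = y
          · subst hne; rfl
          · rw [Setoid.ker_def, eq_iff_iff]
            exact iff_of_false (fun h => hd x h (hσ.supp x y hxy hne))
              fun h => hd y h (hσ.supp_right x y hxy hne)
    · rfl

/-- The sum of the cumulants over all partitions, expanded along the first block. -/
theorem sum_cumExt_cons (s : List (Fin n × A)) (hs : (s.map Prod.fst).Pairwise (· < ·)) :
    (∀ e L, s = e :: L → ∀ acc : List (A × Face),
      ∑ σ ∈ parts χ (s.map Prod.fst), S.cumExt χ σ s acc =
      blockSum S.system.mom (fun _ => True) (fun y => y.2 = Face.free) (L.map (faced χ))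
        fun V r => S.kappaList (acc ++ faced χ e :: V.map S.absorb) * S.system.mom r) ∧
    ∑ σ ∈ parts χ (s.map Prod.fst), S.cumExt χ σ s [] = S.system.mom (s.map (faced χ)) := by
  induction hn : s.length using Nat.strong_induction_on generalizing s with
  | _ N ih =>
  subst hn
  -- The list `acc` of earlier entries of the open block has to be arbitrary, since the recursion
  -- moves the first entry into it.
  have hmain : ∀ e L, s = e :: L → ∀ acc : List (A × Face),
      ∑ σ ∈ parts χ (s.map Prod.fst), S.cumExt χ σ s acc =
      blockSum S.system.mom (fun _ => True) (fun y => y.2 = Face.free) (L.map (faced χ))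
        fun V r => S.kappaList (acc ++ faced χ e :: V.map S.absorb) * S.system.mom r := by
    rintro e L rfl acc
    -- Here `g` is the segment already known to avoid the first block, and the induction searches
    -- `L'` for the next element of that block.
    have key : ∀ L' g, L = g ++ L' →
        ∑ σ ∈ parts χ ((e :: L).map Prod.fst) with ∀ x ∈ g.map Prod.fst, ¬ σ e.1 x,
          S.cumExt χ σ (e :: L) acc =
        blockSumFrom S.system.mom (fun _ => True) (fun y => y.2 = Face.free) (g.map (faced χ))
          (L'.map (faced χ)) fun V r =>
            S.kappaList (acc ++ faced χ e :: V.map S.absorb) * S.system.mom r := by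
      intro L'
      induction L' with
      | nil =>
        intro g hg
        rw [List.append_nil] at hg
        subst hg
        rw [List.map_cons, List.pairwise_cons] at hs
        rw [List.map_cons, parts_cons_last hs.1, List.map_nil, blockSumFrom, List.map_nil,
          ← (ih L.length (by simp) L hs.2 rfl).2, Finset.mul_sum]
        refine Finset.sum_congr rfl fun σ hσ => ?_
        rw [← parts_cons_last hs.1] at hσ
        exact S.cumExt_last χ σ e acc fun x hx =>
          (Finset.mem_filter.1 hσ).2 _ (List.mem_map_of_mem hx)
      | cons e' L' ihL =>
        intro g hg
        have h1 := ihL (g ++ [e']) (by simp [hg])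
        rw [List.map_append, List.map_append, List.map_singleton] at h1
        rw [List.map_cons (f := faced χ), blockSumFrom]
        rw [← Finset.sum_filter_add_sum_filter_not _ fun σ : Setoid (Fin n) => ¬ σ e.1 e'.1,
          Finset.filter_filter, Finset.filter_filter]
        refine congrArg₂ (· + ·) (Eq.trans (Finset.sum_congr (Finset.filter_congr fun σ _ => ?_)
          fun _ _ => rfl) h1) ?_
        · simp [or_imp, forall_and]
        · subst hg
          have h2 := sum_cumExt_next S χ e e' g L' acc hs
          simp only [not_not]
          refine h2.trans ?_
          rw [List.map_cons, List.pairwise_cons, List.map_append, List.pairwise_append] at hs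
          -- The block continues at `e'`: the partitions of the gap sum to its moment, which is
          -- multiplied into `e'`, and the shorter list starting there is covered by the induction.
          have h3 := ((ih (e' :: L').length (by simp)
            ((e'.1, S.emb (S.system.mom (g.map (faced χ))) * e'.2) :: L')
            (by simpa using hs.2.2.1) (by simp)).1 _ _ rfl (acc ++ [faced χ e]))
          have hiff : (True ∧ ∀ x ∈ g.map (faced χ), x.2 = Face.free) ↔
              ∀ x ∈ g.map Prod.fst, χ x = Face.free := by
            rw [true_and, List.forall_mem_map, List.forall_mem_map]
            rfl
          by_cases hfr : ∀ x ∈ g.map Prod.fst, χ x = Face.free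
          · rw [if_pos hfr, if_pos (hiff.2 hfr), (ih g.length (by simp) g hs.2.1 rfl).2]
            refine h3.trans ?_
            simp [faced, ProbSpace.absorb]
          · rw [if_neg hfr, if_neg (mt hiff.1 hfr)]
    have := key L [] rfl
    rw [blockSum_eq_blockSumFrom]
    rw [Finset.filter_true_of_mem (by simp)] at this
    exact this
  refine ⟨hmain, ?_⟩
  cases s with
  | nil => simp [parts_nil]
  | cons e L =>
    rw [hmain e L rfl [], List.map_cons, S.system_mom_cons]
    rfl

/-- Iterating the recursion for moments inside gaps and remainders produces every
interval-noncrossing partition exactly once. -/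
theorem sum_cumExt (s : List (Fin n × A)) (hs : (s.map Prod.fst).Pairwise (· < ·)) :
    ∑ σ ∈ parts χ (s.map Prod.fst), S.cumExt χ σ s [] = S.E (s.map Prod.snd).prod := by
  rw [(sum_cumExt_cons S χ s hs).2, S.system_mom, List.map_map]
  rfl

end MomentCumulant

/-! ### The cumulants by Möbius inversion -/

noncomputable section Inversion

open scoped Classical

variable {𝕜 : Type v} {B A : Type u} [CommRing 𝕜] [Ring B] [Algebra 𝕜 B] [Ring A] [Algebra 𝕜 A]
variable (S : ProbSpace 𝕜 B A) {n : ℕ} (χ : Fin n → Face)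

theorem sort_union {s t : Finset (Fin n)} (h : ∀ x ∈ s, ∀ y ∈ t, x < y) :
    (s ∪ t).sort (· ≤ ·) = s.sort (· ≤ ·) ++ t.sort (· ≤ ·) := by
  refine (Finset.sortedLT_sort _).eq_of_mem_iff ?_ (by simp)
  refine (List.pairwise_append.2 ⟨s.sortedLT_sort.pairwise, t.sortedLT_sort.pairwise, ?_⟩).sortedLT
  simpa using h

/-- Every point of `s` is below the last element of its block in `s`. -/
theorem exists_blockEnd (π : Setoid (Fin n)) (s : Finset (Fin n)) {x : Fin n} (hx : x ∈ s) :
    ∃ e ∈ blockEnds π s, π x e ∧ x ≤ e := by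
  have hne : ({y ∈ s | π x y} : Finset (Fin n)).Nonempty :=
    ⟨x, Finset.mem_filter.2 ⟨hx, π.refl x⟩⟩
  have hmem := Finset.mem_filter.1 (Finset.max'_mem _ hne)
  refine ⟨_, ?_, hmem.2, Finset.le_max' _ x (Finset.mem_filter.2 ⟨hx, π.refl x⟩)⟩
  exact Finset.mem_filter.2 ⟨hmem.1, fun y hy h =>
    Finset.le_max' _ y (Finset.mem_filter.2 ⟨hy, π.trans hmem.2 h⟩)⟩

/-- The block that ends first is an interval. -/
theorem rel_of_first_blockEnd {π : Setoid (Fin n)} (hπ : IsNoncrossing π) {s : Finset (Fin n)}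
    {t x z : Fin n} (ht : ∀ e ∈ blockEnds π s, t ≤ e) (hz : z ∈ s) (hx : π t x)
    (hxz : x ≤ z) (hzt : z ≤ t) : π t z := by
  obtain ⟨e, he, hze, -⟩ := exists_blockEnd π s hz
  rcases (ht e he).eq_or_lt with rfl | hte
  · exact π.symm hze
  rcases hzt.eq_or_lt with rfl | hzt
  · exact π.refl _
  rcases hxz.eq_or_lt with rfl | hxz
  · exact hx
  · exact π.trans hx (hπ x z t e hxz hzt hte (π.symm hx) hze)

/-- The multiplicative extension of the moments is the sum of the multiplicative extensions of the
cumulants. -/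
theorem Phi_eq_sum {π : Setoid (Fin n)} (hπ : IsNoncrossing π)
    (hinc : ∀ v₁ w v₂, v₁ < w → w < v₂ → π v₁ v₂ → χ w = Face.boolean → π v₁ w)
    (s : Finset (Fin n)) (a : Fin n → A) :
    Phi S π s a = ∑ σ ∈ parts χ (s.sort (· ≤ ·)) with σ ≤ π,
      S.cumExt χ σ ((s.sort (· ≤ ·)).map fun j => (j, a j)) [] := by
  have hfst : ∀ (l : List (Fin n)) (a : Fin n → A),
      (l.map fun j => (j, a j)).map Prod.fst = l := by
    intro l a; rw [List.map_map]; exact List.map_id l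
  have htop : ∀ (V : Finset (Fin n)) (a : Fin n → A),
      S.E ((V.sort (· ≤ ·)).map a).prod = ∑ σ ∈ parts χ (V.sort (· ≤ ·)),
        S.cumExt χ σ ((V.sort (· ≤ ·)).map fun j => (j, a j)) [] := by
    intro V a
    have := sum_cumExt S χ ((V.sort (· ≤ ·)).map fun j => (j, a j))
      (by rw [hfst]; exact V.sortedLT_sort.pairwise)
    rw [hfst, List.map_map] at this
    exact this.symm
  induction hc : s.card using Nat.strong_induction_on generalizing s a with
  | _ N ih =>
  subst hc
  rw [Phi]
  split_ifs with hs
  swap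
  · rw [Finset.not_nonempty_iff_eq_empty] at hs
    subst hs
    simp [parts_nil, Finset.filter_singleton]
  dsimp only
  set t := (blockEnds π s).min' (blockEnds_nonempty π hs) with ht_def
  have hte : t ∈ blockEnds π s := Finset.min'_mem _ _
  have ht : ∀ e ∈ blockEnds π s, t ≤ e := fun e he => Finset.min'_le _ e he
  have hts : t ∈ s := (Finset.mem_filter.1 hte).1
  have htmax : ∀ x ∈ s, π t x → x ≤ t := (Finset.mem_filter.1 hte).2
  set V : Finset (Fin n) := {x ∈ s | π t x} with hV
  have hVmem : ∀ x, x ∈ V ↔ x ∈ s ∧ π t x := fun x => Finset.mem_filter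
  rw [htop]
  split_ifs with hr
  swap
  · have hVs : V = s := by
      refine Finset.filter_true_of_mem fun x hx => ?_
      obtain ⟨e, he, hxe, -⟩ := exists_blockEnd π s hx
      have : e ≤ t := not_lt.1 fun h => hr ⟨e, Finset.mem_filter.2 ⟨(Finset.mem_filter.1 he).1, h⟩⟩
      rw [← le_antisymm this (ht e he)]
      exact π.symm hxe
    rw [hVs, Finset.filter_true_of_mem]
    intro σ hσ x y hxy
    by_cases hne : x = y
    · rw [hne]
    · have hσ := (mem_parts χ).1 hσ
      have hx := hσ.supp x y hxy hne
      have hy := hσ.supp_right x y hxy hne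
      rw [Finset.mem_sort, ← hVs, hVmem] at hx hy
      exact π.trans (π.symm hx.2) hy.2
  set r := ({x ∈ s | t < x} : Finset (Fin n)).min' hr with hr_def
  have hrmem := Finset.mem_filter.1 (Finset.min'_mem _ hr)
  rw [← hr_def] at hrmem
  have hrle : ∀ x ∈ s, t < x → r ≤ x := fun x hx h =>
    Finset.min'_le _ x (Finset.mem_filter.2 ⟨hx, h⟩)
  -- Because the block `V` that ends first is an interval, `s` is the concatenation of `p`, `V`, `r`
  -- and `q`.
  set p : Finset (Fin n) := {x ∈ s | x < t ∧ ¬ π t x} with hp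
  set q : Finset (Fin n) := {x ∈ s | r < x} with hq
  have hpmem : ∀ x, x ∈ p ↔ x ∈ s ∧ x < t ∧ ¬ π t x := fun x => Finset.mem_filter
  have hqmem : ∀ x, x ∈ q ↔ x ∈ s ∧ r < x := fun x => Finset.mem_filter
  have hpV : ∀ x ∈ p, ∀ y ∈ V, x < y := by
    intro x hx y hy
    rw [hpmem] at hx
    rw [hVmem] at hy
    by_contra hlt
    exact hx.2.2 (rel_of_first_blockEnd hπ ht hx.1 hy.2 (not_lt.1 hlt) hx.2.1.le)
  have hVt : ∀ x ∈ V, x ≤ t := fun x hx => htmax x ((hVmem x).1 hx).1 ((hVmem x).1 hx).2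
  have hsort_r : (insert r q).sort (· ≤ ·) = r :: q.sort (· ≤ ·) :=
    Finset.sort_insert _ (fun x hx => ((hqmem x).1 hx).2.le)
      fun h => lt_irrefl r ((hqmem r).1 h).2
  have hrest : ∀ x ∈ s, t < x → x ∈ insert r q := by
    intro x hx h
    rcases (hrle x hx h).eq_or_lt with rfl | h'
    · exact Finset.mem_insert_self _ _
    · exact Finset.mem_insert_of_mem ((hqmem x).2 ⟨hx, h'⟩)
  have hrq : ∀ x ∈ insert r q, x ∈ s ∧ t < x := by
    intro x hx
    rcases Finset.mem_insert.1 hx with rfl | hx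
    · exact hrmem
    · exact ⟨((hqmem x).1 hx).1, hrmem.2.trans ((hqmem x).1 hx).2⟩
  have hsV : s \ V = p ∪ insert r q := by
    ext x
    rw [Finset.mem_sdiff, hVmem, Finset.mem_union, hpmem]
    constructor
    · rintro ⟨hx, h⟩
      rcases lt_trichotomy x t with hlt | rfl | hlt
      · exact .inl ⟨hx, hlt, fun h' => h ⟨hx, h'⟩⟩
      · exact absurd ⟨hx, π.refl _⟩ h
      · exact .inr (hrest x hx hlt)
    · rintro (⟨hx, -, h⟩ | h)
      · exact ⟨hx, fun h' => h h'.2⟩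
      · exact ⟨(hrq x h).1, fun h' => (htmax x h'.1 h'.2).not_gt (hrq x h).2⟩
  have hsplit : s = p ∪ (V ∪ insert r q) := by
    rw [Finset.union_left_comm, ← hsV, Finset.union_sdiff_of_subset (Finset.filter_subset _ _)]
  have hsort₂ : (s \ V).sort (· ≤ ·) = p.sort (· ≤ ·) ++ r :: q.sort (· ≤ ·) := by
    rw [hsV, sort_union, hsort_r]
    exact fun x hx y hy => ((hpmem x).1 hx).2.1.trans (hrq y hy).2
  have hsort : s.sort (· ≤ ·) =
      p.sort (· ≤ ·) ++ (V.sort (· ≤ ·) ++ r :: q.sort (· ≤ ·)) := by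
    conv_lhs => rw [hsplit]
    rw [sort_union, sort_union, hsort_r]
    · exact fun x hx y hy => (hVt x hx).trans_lt (hrq y hy).2
    · intro x hx y hy
      rcases Finset.mem_union.1 hy with hy | hy
      · exact hpV x hx y hy
      · exact ((hpmem x).1 hx).2.1.trans (hrq y hy).2
  have hcard : (s \ V).card < s.card := Finset.card_lt_card ⟨Finset.sdiff_subset, fun h =>
    (Finset.mem_sdiff.1 (h hts)).2 ((hVmem t).2 ⟨hts, π.refl t⟩)⟩
  rw [ih _ hcard _ _ rfl]
  have hVsub : ∀ x ∈ V, x ∈ s := fun x hx => ((hVmem x).1 hx).1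
  let F : Setoid (Fin n) → Setoid (Fin n) → B := fun σ₁ σ₂ => S.cumExt χ σ₂
    ((p.sort (· ≤ ·)).map (fun j => (j, a j)) ++
      (r, S.emb (S.cumExt χ σ₁ ((V.sort (· ≤ ·)).map fun j => (j, a j)) []) * a r) ::
        (q.sort (· ≤ ·)).map fun j => (j, a j)) []
  have hmain := sum_parts_split (χ := χ) (l := s.sort (· ≤ ·)) (l₁ := V.sort (· ≤ ·))
    (l₂ := (s \ V).sort (· ≤ ·)) (π := π)
    (fun x => by
      simp only [Finset.mem_sort, Finset.mem_sdiff]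
      have := hVsub x
      tauto)
    (fun x hx => by
      simp only [Finset.mem_sort, Finset.mem_sdiff] at hx ⊢
      tauto)
    (fun x hx y hy z hz h1 h2 => by
      simp only [Finset.mem_sort, Finset.mem_sdiff] at hx hy hz
      exact hz.2 ((hVmem z).2 ⟨hz.1, rel_of_first_blockEnd hπ ht hz.1 ((hVmem x).1 hx).2 h1.le
        (h2.le.trans (hVt y hy))⟩))
    (fun x hx y hy => by
      simp only [Finset.mem_sort] at hx hy
      exact π.trans (π.symm ((hVmem x).1 hx).2) ((hVmem y).1 hy).2)
    (fun x hx y hy h => by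
      simp only [Finset.mem_sort, Finset.mem_sdiff] at hx hy
      exact hy.2 ((hVmem y).2 ⟨hy.1, π.trans ((hVmem x).1 hx).2 h⟩))
    -- A Boolean point of `V` below another block of `π` would belong to that block.
    (fun v₁ hv₁ v₂ _ w hw h1 h2 h3 hχ => by
      simp only [Finset.mem_sort, Finset.mem_sdiff] at hv₁ hw
      exact hv₁.2 ((hVmem v₁).2 ⟨hv₁.1, π.trans ((hVmem w).1 hw).2
        (π.symm (hinc v₁ w v₂ h1 h2 h3 hχ))⟩)) F
  refine Eq.trans ?_ (hmain.symm.trans ?_)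
  · refine Finset.sum_congr rfl fun σ₂ _ => ?_
    rw [hsort₂, List.map_append, List.map_cons, Function.update_self]
    have hne : ∀ l : List (Fin n), r ∉ l → ∀ x : A,
        (l.map fun j => (j, Function.update a r x j)) = l.map fun j => (j, a j) := by
      intro l hl x
      refine List.map_congr_left fun j hj => ?_
      rw [Function.update_of_ne (show j ≠ r from fun h => hl (h ▸ hj))]
    rw [hne, hne]
    -- The moment of `V` in the entry at `r` is expanded over the partitions of `V`; `cumExt_remove`
    -- then reinserts `V` into the list.
    · exact S.cumExt_sum χ σ₂ _ r (a r) _ _ _ []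
    · simp [hqmem]
    · rw [Finset.mem_sort, hpmem]
      exact fun h => h.2.1.asymm hrmem.2
  · refine Finset.sum_congr rfl fun σ hσ => ?_
    have hle := (Finset.mem_filter.1 hσ).2
    rw [hsort, List.map_append, List.map_append, List.map_cons, S.cumExt_remove]
    · simp only [F]
      rw [S.cumExt_congr χ (σ := restr σ (V.sort (· ≤ ·))) (σ' := σ)]
      · refine S.cumExt_congr χ _ _ fun x hx y hy => restr_iff_of_mem ?_ ?_
        · rw [hsort₂]
          simp only [List.mem_append, List.mem_map, List.mem_cons] at hx ⊢
          rcases hx with ⟨j, hj, rfl⟩ | rfl | ⟨j, hj, rfl⟩ <;> tauto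
        · rw [hsort₂]
          simp only [List.mem_append, List.mem_map, List.mem_cons] at hy ⊢
          rcases hy with ⟨j, hj, rfl⟩ | rfl | ⟨j, hj, rfl⟩ <;> tauto
      · intro x hx y hy
        simp only [List.mem_map] at hx hy
        obtain ⟨i, hi, rfl⟩ := hx
        obtain ⟨j, hj, rfl⟩ := hy
        exact restr_iff_of_mem hi hj
    · intro _; rfl
    · intro w hw y hy h
      have hw' : w.1 ∈ V := by
        obtain ⟨j, hj, rfl⟩ := List.mem_map.1 hw
        simpa using hj
      have hy' : y.1 ∈ s \ V := by
        rw [← Finset.mem_sort (· ≤ ·), hsort₂]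
        simp only [List.mem_append, List.mem_map, List.mem_cons] at hy ⊢
        rcases hy with ⟨j, hj, rfl⟩ | rfl | ⟨j, hj, rfl⟩ <;> tauto
      rw [Finset.mem_sdiff] at hy'
      exact hy'.2 ((hVmem _).2 ⟨hy'.1, π.trans ((hVmem _).1 hw').2 (hle h)⟩)

/-- With a single block all gaps are empty, and every entry is collected. -/
theorem cumExt_top (L : List (Fin n × A)) (hL : L ≠ []) (acc : List (A × Face)) :
    S.cumExt χ ⊤ L acc = S.kappaList (acc ++ L.map (faced χ)) := by
  induction L generalizing acc with
  | nil => exact absurd rfl hL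
  | cons e L ih =>
    cases L with
    | nil => rw [S.cumExt_last χ ⊤ e acc (by simp)]; simp [faced]
    | cons e' L =>
      have := S.cumExt_next χ ⊤ e e' (g := []) L acc (by simp) trivial
      rw [List.nil_append] at this
      rw [this, S.cumExt_nil, map_one, one_mul, ih (by simp)]
      simp [faced]

/-- The free-Boolean cumulants satisfy the recursion that defines `kappa`. -/
theorem cumulant_top (hn : n ≠ 0) (a : Fin n → A) :
    cumulant S χ ⊤ a = S.kappaList (List.ofFn fun k => (a k, χ k)) := by
  let K : Setoid (Fin n) → B := fun τ =>
    S.cumExt χ τ ((List.finRange n).map fun j => (j, a j)) []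
  have hparts : ∀ τ, τ ∈ parts χ (List.finRange n) ↔ IsNoncrossing τ ∧
      ∀ v₁ w v₂, v₁ < w → w < v₂ → τ v₁ v₂ → χ w = Face.boolean → τ v₁ w := by
    intro τ
    rw [mem_parts]
    exact ⟨fun h => ⟨h.nc, fun v₁ w v₂ h1 h2 h3 => h.inc v₁ w v₂ h1 h2 h3 (List.mem_finRange w)⟩,
      fun h => ⟨fun x _ _ _ => List.mem_finRange x, h.1,
        fun v₁ w v₂ h1 h2 h3 _ => h.2 v₁ w v₂ h1 h2 h3⟩⟩
  have hPhi : ∀ σ : INC χ, Phi S σ.1 Finset.univ a =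
      ∑ τ : INC χ, if τ ≤ σ then K τ.1 else 0 := by
    intro σ
    rw [Phi_eq_sum S χ σ.2.1 σ.2.2, Fin.sort_univ, Finset.sum_filter]
    exact Finset.sum_subtype (parts χ (List.finRange n)) hparts
      fun τ => if τ ≤ σ.1 then K τ else 0
  rw [cumulant, Finset.filter_true_of_mem fun σ _ => le_top]
  simp only [hPhi, Finset.smul_sum]
  rw [Finset.sum_comm]
  -- After the sums are exchanged, the coefficient of `K τ` is the sum of `μ(σ, ⊤)` over the
  -- interval from `τ` to `⊤`, which vanishes unless `τ = ⊤`.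
  have hmu : ∀ τ : INC χ, (∑ σ : INC χ, IncidenceAlgebra.mu ℤ σ ⊤ • if τ ≤ σ then K τ.1 else 0) =
      if τ = ⊤ then K τ.1 else 0 := by
    intro τ
    have h1 : (∑ σ : INC χ, IncidenceAlgebra.mu ℤ σ ⊤ • if τ ≤ σ then K τ.1 else 0) =
        (∑ σ ∈ Finset.Icc τ ⊤, IncidenceAlgebra.mu ℤ σ ⊤) • K τ.1 := by
      rw [Finset.sum_smul, ← Finset.sum_filter_add_sum_filter_not Finset.univ (τ ≤ ·)]
      rw [Finset.sum_eq_zero (s := {σ | ¬ τ ≤ σ}), add_zero]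
      · refine Finset.sum_congr (by ext σ; simp) fun σ hσ => ?_
        rw [if_pos (Finset.mem_Icc.1 hσ).1]
      · intro σ hσ
        rw [if_neg (Finset.mem_filter.1 hσ).2, smul_zero]
    rw [h1, IncidenceAlgebra.sum_Icc_mu_left]
    split_ifs <;> simp
  simp only [hmu]
  rw [Finset.sum_ite_eq' Finset.univ ⊤ fun τ : INC χ => K τ.1, if_pos (Finset.mem_univ _)]
  change S.cumExt χ ⊤ _ [] = _
  rw [cumExt_top, List.nil_append, List.map_map, List.ofFn_eq_map]
  · rfl
  · simpa [List.map_eq_nil_iff] using hn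

end Inversion

/-! ### Combinatorial independence as vanishing of mixed cumulants of letters -/

noncomputable section Equivalence

variable {𝕜 : Type v} {B A : Type u} [CommRing 𝕜] [Ring B] [Algebra 𝕜 B] [Ring A] [Algebra 𝕜 A]
variable {S : ProbSpace 𝕜 B A} {ι : Type w} (F : ι → FacePair S)

/-- By `cumulant_top` both conditions are about the same elements of `B`, and a colouring is not
constant exactly if some later letter differs in colour from the first. -/
theorem combFreeBoolean_iff_mixedVanish : CombFreeBoolean F ↔ MixedVanish F := by
  constructor
  · rintro h a L ⟨x, hx, hxa⟩
    have h1 := h (a :: L).length (fun k => ((a :: L).get k).1) (fun k => ((a :: L).get k).2.1)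
      (fun k => ((a :: L).get k).2.2) (fun k => ((a :: L).get k).2.2.2) ?_
    · rw [cumulant_top S _ (by simp)] at h1
      have h2 := ofFn_comp_get (a :: L) Letter.val
      change S.kappaList (List.ofFn fun k => Letter.val ((a :: L).get k)) = 0 at h1
      rw [h2] at h1
      exact h1
    · obtain ⟨k, hk⟩ := List.mem_iff_get.1 (List.mem_cons_of_mem a hx)
      refine ⟨k, ⟨0, by simp⟩, ?_⟩
      change ((a :: L).get k).1 ≠ a.1
      rw [hk]
      exact hxa
  · rintro h n ω χ a ha ⟨j, k, hjk⟩
    obtain ⟨n, rfl⟩ : ∃ m, n = m + 1 := Nat.exists_eq_succ_of_ne_zero (Fin.pos j).ne'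
    let l : Fin (n + 1) → Letter F := fun k => ⟨ω k, χ k, a k, ha k⟩
    rw [cumulant_top S χ (Nat.succ_ne_zero n)]
    have h1 := h (l 0) (List.ofFn fun k : Fin n => l k.succ) ?_
    · rw [List.map_ofFn] at h1
      rw [List.ofFn_succ]
      exact h1
    · by_contra hne
      push Not at hne
      have h0 : ∀ k, ω k = ω 0 := by
        intro k
        refine Fin.cases rfl (fun k => ?_) k
        exact hne (l k.succ) (List.mem_ofFn.2 ⟨k, rfl⟩)
      exact hjk ((h0 j).trans (h0 k).symm)

end Equivalence

end FreeBoolean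

theorem theorem4p11 {𝕜 : Type v} {B A : Type u} [CommRing 𝕜] [Ring B] [Algebra 𝕜 B] [Ring A]
    [Algebra 𝕜 A] (S : FreeBoolean.ProbSpace 𝕜 B A) {ι : Type w}
    (F : ι → FreeBoolean.FacePair S) :
    FreeBoolean.FreeBooleanIndep F ↔ FreeBoolean.CombFreeBoolean F :=
  (FreeBoolean.freeBooleanIndep_iff_mixedVanish F).trans
    (FreeBoolean.combFreeBoolean_iff_mixedVanish F).symm
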